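/- Let $d\ge 1$. All domains lie in $\mathbb R^d$, $\mathbb R^{d\times d}$ carries the Euclidean (Frobenius) norm, and $\operatorname{dist}$ is the corresponding distance. *Definitions.* For $e\in(0,1]$, $\delta>0$, a set $U\subset\mathbb R^d$ is an $(e,\delta)$-domain if any $x,y\in U$ with $|x-y|<\delta$ are joined by a rectifiable curve $\gamma$ in $U$ with $\operatorname{len}(\gamma)\le \frac1e|x-y|$ and $\operatorname{dist}(z,\partial U)\ge \frac{e|x-z||y-z|}{|x-y|}$ for all $z$ on $\gamma$. "$V=F+G$ in $L^p+L^q(\Omega)$" means $V=F+G$ a.e. in $\Omega$ with $F\in L^p(\Omega)$, $G\in L^q(\Omega)$; similarly for three terms. For nonempty $\mathcal A\subset\mathbb R^{d\times d}$, *$(\mathcal A,p,q)$-rigidity holds on cubes* if for every cube $Q$ (with concentric scaled cube $Q^+=\frac{33}{32}Q$) there is $c_Q>0$ such that for all $u\in W^{1,1}(Q^+,\mathbb R^d)$ and all decompositions $\operatorname{dist}(Du,\mathcal A)=F+G$ in $L^p+L^q(Q^+)$ there are $M\in\mathbb R^{d\times d}$ and a decomposition $Du-M=F'+G'$ in $L^p+L^q(Q,\mathbb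 R^{d\times d})$ with $\|F'\|_{L^p(Q)}\le c_Q\|F\|_{L^p(Q^+)}$ and $\|G'\|_{L^q(Q)}\le c_Q\|G\|_{L^q(Q^+)}$. **Theorem.** Let $U\subset\mathbb R^d$ be a nonempty, open, bounded $(e,\delta)$-domain and $\rho:=\min\{\frac12\operatorname{diam}(U),\delta\}$. Assume that every connected component of $U$ has diameter at least $2\rho$ (this is automatic if $U$ is connected, and can always be achieved by decreasing $\delta$). For $\gamma>0$ put $U^+_\gamma:=\{x\in\mathbb R^d:\operatorname{dist}(x,U)\le\gamma\}$ and $U^-_\gamma:=\{x\in U:\operatorname{dist}(x,\partial U)\ge\gamma\}$. There exist constants $0<\alpha'<\alpha$, $\alpha''>0$ and a bounded linear operator $E:W^{1,1}(U,\mathbb R^d)\to W^{1,1}_{\mathrm{loc}}(\mathbb R^d,\mathbb R^d)$ (in fact $\|Eu\|_{W^{1,1}(\mathbb R^d)}\le C\|u\|_{W^{1,1}(U)}$ for some $C$) with (a) $Eu=u$ a.e. in $U$, and (b) $\operatorname{supp}Eu\subset U^+_{\rho\alpha}$, such that the following holds. Let $r\in[1,\infty]$, $1\le p\le q\le\infty$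 and let $\emptyset\ne\mathcal A\subset\mathbb R^{d\times d}$ be such that $(\mathcal A,p,q)$-rigidity holds on cubes. Then there is $c>0$ such that for all $u\in W^{1,1}(U,\mathbb R^d)$ and all decompositions $\operatorname{dist}(Du,\mathcal A)=F+G$ in $L^p+L^q(U)$ (norms on the right-hand sides may be $+\infty$): (c) There is a decomposition $Eu=F_1+G_1+H_1$ in $L^p+L^q+L^r(\mathbb R^d,\mathbb R^d)$ with $$\|F_1\|_{L^p(\mathbb R^d)}\le c\|F\|_{L^p(U)},\quad \|G_1\|_{L^q(\mathbb R^d)}\le c\|G\|_{L^q(U)},\quad \|H_1\|_{L^r(\mathbb R^d)}\le c\|u\|_{L^r(U)}.$$ (d) Let $V:=U^+_{\rho\alpha}$; if $0\in\overline{\mathcal A}$, also $V:=\mathbb R^d$ is allowed. There is a decomposition $\operatorname{dist}(DEu,\mathcal A)=F_2+G_2+H_2$ in $L^p+L^q+L^r(V)$ with $H_2=0$ a.e. in $U^+_{\rho\alpha'}$ and $$\|F_2\|_{L^p(V)}\le c\|F\|_{L^p(U)},\quad \|G_2\|_{L^q(V)}\le c\|G\|_{L^q(U)},\quad \|H_2\|_{L^r(V)}\le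 c\big(\rho^{-1}\|u\|_{L^r(U^-_{\rho\alpha''})}+\|Du\|_{L^r(U^-_{\rho\alpha''})}\big).$$ Especially, if $p=q=r$, then for all $u\in W^{1,1}(U,\mathbb R^d)$ $$\|Eu\|_{L^p(\mathbb R^d)}\le c\big(\|u\|_{L^p(U)}+\|\operatorname{dist}(Du,\mathcal A)\|_{L^p(U)}\big),\qquad \|\operatorname{dist}(DEu,\mathcal A)\|_{L^p(U^+_{\rho\alpha'})}\le c\|\operatorname{dist}(Du,\mathcal A)\|_{L^p(U)}.$$ The operator $E$ does not depend on $r,p,q,\mathcal A$. The constants $\alpha,\alpha',\alpha''$ depend only on $d$ and $e$, and $c$ depends only on $d,e,p,q,r,\mathcal A$; that is, they depend on the domain $U$ only via its first Jones coefficient $e$. -/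

import Mathlib

open MeasureTheory Set
open scoped ENNReal NNReal ContDiff

/-- Points (and vectors) of `ℝ^d`, with the Euclidean norm. -/
abbrev Vec (d : ℕ) : Type := EuclideanSpace ℝ (Fin d)

/-- The space `ℝ^{d×d}` of real matrices with its Euclidean (that is, Frobenius) norm;
the entry in row `i` and column `j` of `M` is `M (i, j)`. -/
abbrev Mat (d : ℕ) : Type := EuclideanSpace ℝ (Fin d × Fin d)

/-! ### Weak gradients and Sobolev spaces -/

/-- `g` is a weak gradient of `u` on the open set `Ω`: `g (i, j) = ∂_j u_i` in the sense of
distributions, both functions being locally integrable on `Ω`. -/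
def IsWeakGradient {d : ℕ} (Ω : Set (Vec d)) (u : Vec d → Vec d) (g : Vec d → Mat d) : Prop :=
  LocallyIntegrableOn u Ω volume ∧ LocallyIntegrableOn g Ω volume ∧
    ∀ φ : Vec d → ℝ, ContDiff ℝ ∞ φ → HasCompactSupport φ → tsupport φ ⊆ Ω →
      ∀ i j : Fin d,
        ∫ x in Ω, u x i * fderiv ℝ φ x (EuclideanSpace.single j 1)
          = -∫ x in Ω, g x (i, j) * φ x

/-- A locally integrable function times a continuous function with compact support in the
open set is integrable. -/
theorem integrableOn_mul_of_locallyIntegrableOn {d : ℕ} {Ω : Set (Vec d)} {f ψ : Vec d → ℝ}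
    (hf : LocallyIntegrableOn f Ω volume) (hψ : Continuous ψ) (hc : HasCompactSupport ψ)
    (hs : tsupport ψ ⊆ Ω) : IntegrableOn (fun x => f x * ψ x) Ω volume := by
  have h1 : IntegrableOn f (tsupport ψ) volume := hf.integrableOn_compact_subset hs hc
  have h2 : IntegrableOn (fun x => f x * ψ x) (tsupport ψ) volume :=
    h1.mul_continuousOn hψ.continuousOn hc
  have h3 : Integrable (fun x => f x * ψ x) volume := by
    refine (integrableOn_iff_integrable_of_support_subset ?_).1 h2
    intro x hx
    refine subset_tsupport ψ ?_
    intro h0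
    exact hx (by simp [h0])
  exact h3.integrableOn

theorem locallyIntegrableOn_coord {d : ℕ} {ι : Type} [Fintype ι] {Ω : Set (Vec d)}
    {f : Vec d → EuclideanSpace ℝ ι} (hf : LocallyIntegrableOn f Ω volume) (i : ι) :
    LocallyIntegrableOn (fun x => f x i) Ω volume := by
  intro x hx
  obtain ⟨s, hs, h⟩ := hf x hx
  exact ⟨s, hs, (EuclideanSpace.proj (𝕜 := ℝ) i).integrable_comp h⟩

theorem tsupport_fderiv_vec_subset {d : ℕ} (φ : Vec d → ℝ) (v : Vec d) :
    tsupport (fun x => fderiv ℝ φ x v) ⊆ tsupport φ := by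
  refine closure_minimal ?_ (isClosed_tsupport φ)
  intro x hx
  refine support_fderiv_subset ℝ ?_
  intro h0
  exact hx (by simp [h0])

theorem integrableOn_mul_fderiv {d : ℕ} {Ω : Set (Vec d)} {f φ : Vec d → ℝ}
    (hf : LocallyIntegrableOn f Ω volume) (hφ : ContDiff ℝ ∞ φ) (hc : HasCompactSupport φ)
    (hs : tsupport φ ⊆ Ω) (v : Vec d) :
    IntegrableOn (fun x => f x * fderiv ℝ φ x v) Ω volume := by
  refine integrableOn_mul_of_locallyIntegrableOn hf ?_ ?_ ?_
  · exact (hφ.continuous_fderiv (by simp)).clm_apply continuous_const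
  · exact hc.of_isClosed_subset (isClosed_tsupport _) (tsupport_fderiv_vec_subset φ v)
  · exact (tsupport_fderiv_vec_subset φ v).trans hs

namespace IsWeakGradient

variable {d : ℕ} {Ω : Set (Vec d)} {u v : Vec d → Vec d} {g h : Vec d → Mat d}

theorem zero : IsWeakGradient Ω (0 : Vec d → Vec d) 0 :=
  ⟨locallyIntegrableOn_zero, locallyIntegrableOn_zero, by intros; simp⟩

theorem add (hu : IsWeakGradient Ω u g) (hv : IsWeakGradient Ω v h) :
    IsWeakGradient Ω (u + v) (g + h) := by
  refine ⟨hu.1.add hv.1, hu.2.1.add hv.2.1, ?_⟩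
  intro φ hφ hc hs i j
  have e1 := integrableOn_mul_fderiv (locallyIntegrableOn_coord hu.1 i) hφ hc hs (EuclideanSpace.single j 1)
  have e2 := integrableOn_mul_fderiv (locallyIntegrableOn_coord hv.1 i) hφ hc hs (EuclideanSpace.single j 1)
  have e3 := integrableOn_mul_of_locallyIntegrableOn (locallyIntegrableOn_coord hu.2.1 (i, j)) hφ.continuous hc hs
  have e4 := integrableOn_mul_of_locallyIntegrableOn (locallyIntegrableOn_coord hv.2.1 (i, j)) hφ.continuous hc hs
  have k1 := hu.2.2 φ hφ hc hs i j
  have k2 := hv.2.2 φ hφ hc hs i j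
  simp only [Pi.add_apply, PiLp.add_apply, add_mul]
  rw [integral_add e1 e2, integral_add e3 e4, k1, k2]
  ring

theorem const_smul (c : ℝ) (hu : IsWeakGradient Ω u g) :
    IsWeakGradient Ω (c • u) (c • g) := by
  refine ⟨hu.1.smul c, hu.2.1.smul c, ?_⟩
  intro φ hφ hc hs i j
  have k1 := hu.2.2 φ hφ hc hs i j
  simp only [Pi.smul_apply, PiLp.smul_apply, smul_eq_mul, mul_assoc]
  rw [integral_const_mul, integral_const_mul, k1]
  ring

theorem congr_ae (hu : IsWeakGradient Ω u g) (huv : u =ᵐ[volume.restrict Ω] v) :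
    IsWeakGradient Ω v g := by
  refine ⟨?_, hu.2.1, ?_⟩
  · intro x hx
    obtain ⟨s, hs, hi⟩ := hu.1 x hx
    refine ⟨s ∩ Ω, Filter.inter_mem hs self_mem_nhdsWithin, ?_⟩
    exact (hi.mono_set inter_subset_left).congr_fun_ae
      (ae_mono (Measure.restrict_mono inter_subset_right le_rfl) huv)
  · intro φ hφ hc hs i j
    rw [← hu.2.2 φ hφ hc hs i j]
    refine integral_congr_ae ?_
    filter_upwards [huv] with x hx
    rw [hx]

end IsWeakGradient

/-- The Sobolev space `W^{1,1}(Ω, ℝ^d)`: classes (modulo equality a.e. in `Ω`) of integrable maps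
that have an integrable weak gradient on the open set `Ω`. -/
def W11 {d : ℕ} (Ω : Set (Vec d)) : Submodule ℝ (Vec d →ₘ[volume.restrict Ω] Vec d) where
  carrier := {u | ∃ g : Vec d → Mat d, IsWeakGradient Ω u g ∧
    IntegrableOn u Ω volume ∧ IntegrableOn g Ω volume}
  zero_mem' := ⟨0, IsWeakGradient.zero.congr_ae AEEqFun.coeFn_zero.symm,
    (integrable_zero _ _ _).congr AEEqFun.coeFn_zero.symm, integrable_zero _ _ _⟩
  add_mem' := by
    rintro u v ⟨g, hg, hu, hgi⟩ ⟨h, hh, hv, hhi⟩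
    exact ⟨g + h, (hg.add hh).congr_ae (AEEqFun.coeFn_add u v).symm,
      (hu.add hv).congr (AEEqFun.coeFn_add u v).symm, hgi.add hhi⟩
  smul_mem' := by
    rintro c u ⟨g, hg, hu, hgi⟩
    exact ⟨c • g, (hg.const_smul c).congr_ae (AEEqFun.coeFn_smul c u).symm,
      (hu.smul c).congr (AEEqFun.coeFn_smul c u).symm, hgi.smul c⟩

/-- The space `W^{1,1}_loc(ℝ^d, ℝ^d)`: classes (modulo equality a.e.) of locally integrable maps
that have a locally integrable weak gradient on `ℝ^d`. -/
def W11loc (d : ℕ) : Submodule ℝ (Vec d →ₘ[(volume : Measure (Vec d))] Vec d) where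
  carrier := {u | ∃ g : Vec d → Mat d, IsWeakGradient univ u g}
  zero_mem' := ⟨0, IsWeakGradient.zero.congr_ae
    (ae_mono Measure.restrict_le_self AEEqFun.coeFn_zero.symm)⟩
  add_mem' := by
    rintro u v ⟨g, hg⟩ ⟨h, hh⟩
    exact ⟨g + h, (hg.add hh).congr_ae
      (ae_mono Measure.restrict_le_self (AEEqFun.coeFn_add u v).symm)⟩
  smul_mem' := by
    rintro c u ⟨g, hg⟩
    exact ⟨c • g, (hg.const_smul c).congr_ae
      (ae_mono Measure.restrict_le_self (AEEqFun.coeFn_smul c u).symm)⟩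

/-- The representative `ℝ^d → ℝ^d` of `u ∈ W^{1,1}(Ω, ℝ^d)`; it is meaningful a.e. in `Ω`. -/
noncomputable def sobFn {d : ℕ} {Ω : Set (Vec d)} (u : W11 Ω) : Vec d → Vec d :=
  ((u : Vec d →ₘ[volume.restrict Ω] Vec d) : Vec d → Vec d)

/-- The weak gradient `Du` of `u ∈ W^{1,1}(Ω, ℝ^d)`; it is unique up to equality a.e. in `Ω`. -/
noncomputable def sobGrad {d : ℕ} {Ω : Set (Vec d)} (u : W11 Ω) : Vec d → Mat d :=
  Classical.choose u.2

theorem sobGrad_spec {d : ℕ} {Ω : Set (Vec d)} (u : W11 Ω) :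
    IsWeakGradient Ω (sobFn u) (sobGrad u) ∧ IntegrableOn (sobFn u) Ω volume ∧
      IntegrableOn (sobGrad u) Ω volume :=
  Classical.choose_spec u.2

/-- A representative `ℝ^d → ℝ^d` of `u ∈ W^{1,1}_loc(ℝ^d, ℝ^d)`. -/
noncomputable def locFn {d : ℕ} (u : W11loc d) : Vec d → Vec d :=
  ((u : Vec d →ₘ[(volume : Measure (Vec d))] Vec d) : Vec d → Vec d)

/-- The weak gradient `Du` of `u ∈ W^{1,1}_loc(ℝ^d, ℝ^d)`; it is unique up to equality a.e. -/
noncomputable def locGrad {d : ℕ} (u : W11loc d) : Vec d → Mat d :=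
  Classical.choose u.2

theorem locGrad_spec {d : ℕ} (u : W11loc d) : IsWeakGradient univ (locFn u) (locGrad u) :=
  Classical.choose_spec u.2

/-! ### Mixed growth decompositions -/

/-- `V = F + G` is a decomposition in `L^p + L^q` with respect to the measure `μ`. -/
structure IsDecomp₂ {d : ℕ} {X : Type} [NormedAddCommGroup X] (μ : Measure (Vec d))
    (p q : ℝ≥0∞) (V F G : Vec d → X) : Prop where
  eq_add : ∀ᵐ x ∂μ, V x = F x + G x
  memLp_left : MemLp F p μ
  memLp_right : MemLp G q μ

/-- `V = F + G + H` is a decomposition in `L^p + L^q + L^r` with respect to the measure `μ`. -/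
structure IsDecomp₃ {d : ℕ} {X : Type} [NormedAddCommGroup X] (μ : Measure (Vec d))
    (p q r : ℝ≥0∞) (V F G H : Vec d → X) : Prop where
  eq_add : ∀ᵐ x ∂μ, V x = F x + G x + H x
  memLp_fst : MemLp F p μ
  memLp_snd : MemLp G q μ
  memLp_trd : MemLp H r μ

/-- The function `dist(Φ(·), 𝒜)` for a matrix field `Φ`. -/
noncomputable def distTo {d : ℕ} (Φ : Vec d → Mat d) (𝒜 : Set (Mat d)) : Vec d → ℝ :=
  fun x => Metric.infDist (Φ x) 𝒜

/-! ### Rigidity on cubes -/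

/-- The open cube with centre `a` and edge length `l`. -/
def openCube {d : ℕ} (a : Vec d) (l : ℝ) : Set (Vec d) :=
  {x | ∀ i, |x i - a i| < l / 2}

/-- `(𝒜, p, q)`-rigidity holds on `Q` with respect to `Qp`. -/
def RigidityOn {d : ℕ} (𝒜 : Set (Mat d)) (p q : ℝ≥0∞) (Q Qp : Set (Vec d)) : Prop :=
  ∃ c : ℝ≥0, 0 < c ∧ ∀ (u : W11 Qp) (F G : Vec d → ℝ),
    IsDecomp₂ (volume.restrict Qp) p q (distTo (sobGrad u) 𝒜) F G →
    ∃ (M : Mat d) (F' G' : Vec d → Mat d),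
      IsDecomp₂ (volume.restrict Q) p q (fun x => sobGrad u x - M) F' G' ∧
      eLpNorm F' p (volume.restrict Q) ≤ c * eLpNorm F p (volume.restrict Qp) ∧
      eLpNorm G' q (volume.restrict Q) ≤ c * eLpNorm G q (volume.restrict Qp)

/-- `(𝒜, p, q)`-rigidity holds on cubes: on every cube `Q` with respect to `(33/32) Q`. -/
def RigidityOnCubes {d : ℕ} (𝒜 : Set (Mat d)) (p q : ℝ≥0∞) : Prop :=
  ∀ (a : Vec d) (l : ℝ), 0 < l → RigidityOn 𝒜 p q (openCube a l) (openCube a (33 / 32 * l))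

/-! ### Jones domains and their neighbourhoods -/

/-- `U` is an `(e, δ)`-domain: any two points of `U` at distance less than `δ` are joined by a
rectifiable curve in `U` that is not much longer than their distance and stays away from `∂U`. -/
structure IsJonesDomain {d : ℕ} (U : Set (Vec d)) (e δ : ℝ) : Prop where
  e_pos : 0 < e
  e_le_one : e ≤ 1
  δ_pos : 0 < δ
  exists_curve : ∀ x ∈ U, ∀ y ∈ U, dist x y < δ → ∃ γ : ℝ → Vec d,
    ContinuousOn γ (Icc 0 1) ∧ MapsTo γ (Icc 0 1) U ∧ γ 0 = x ∧ γ 1 = y ∧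
    eVariationOn γ (Icc 0 1) ≤ ENNReal.ofReal (1 / e * dist x y) ∧
    ∀ t ∈ Icc (0 : ℝ) 1,
      e * dist x (γ t) * dist y (γ t) / dist x y ≤ Metric.infDist (γ t) (frontier U)

/-- `ρ = min {diam(U) / 2, δ}`. -/
noncomputable def jonesRadius {d : ℕ} (U : Set (Vec d)) (δ : ℝ) : ℝ :=
  min (Metric.diam U / 2) δ

/-- `U⁺_γ = {x ∈ ℝ^d : dist(x, U) ≤ γ}`. -/
def outerNhd {d : ℕ} (U : Set (Vec d)) (γ : ℝ) : Set (Vec d) :=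
  {x | Metric.infDist x U ≤ γ}

/-- `U⁻_γ = {x ∈ U : dist(x, ∂U) ≥ γ}`. -/
def innerPart {d : ℕ} (U : Set (Vec d)) (γ : ℝ) : Set (Vec d) :=
  {x | x ∈ U ∧ γ ≤ Metric.infDist x (frontier U)}

/-! The extension is a linear reflection construction on dyadic scales that does not involve `𝒜`,
`p`, `q` or `r`. Every point `y` within `5 * l` of `U` has a reflected point in `U` whose distance
from `y` is at most of order `l` and whose distance from the boundary is at least of order `l`. It
exists because a point of `U` near `y` lies in a component large enough to contain a partner at
distance exactly `l`, and the middle of the Jones curve between the two is far from the boundary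
(`IsJonesDomain.exists_reflection`). The rough extension takes at `y` the value of the first order
Taylor polynomial, at the reflected point, of `u` mollified at a small multiple of `l`. A further
mollification at scale `l` gives a smooth function `W n` for each scale `l n` (`scaleExt`). Outside
`U` the extension is the telescoping sum `χ 0 • W 0 + ∑ χ (n + 1) • (W (n + 1) - W n)`, with cutoffs
`χ n` to neighbourhoods of width about `3 * l n`. Hence near an exterior point only scales
comparable to its distance from `U` matter.

For the gradient, suppose that around all points of `U` that lie at distance of order `l` from `x`
and from the boundary, `Du` is `β`-close in the mean to a constant matrix that is `β`-close to `𝒜`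
(`OscAt`). Taylor polynomials at neighbouring points then differ by `O(β l)`. A Jones curve has
length `O(l)` and keeps its distance from the boundary, so a chain of boundedly many neighbours
joins any two reflections. Hence one affine map, with gradient `M` close to `𝒜`, approximates the
rough extensions at scales `l` and `l / 2` up to `O(β l)` (`exists_affine_approx`). Mollification
fixes affine maps, so the gradients of `W n` and `W (n + 1)` are `O(β)`-close to `M`, while `W (n +
1) - W n = O(β l)` pays for the derivative of the cutoff. Only the outermost cutoff has no coarser
scale to compensate it; there a local mean of `|u| / ρ` appears, which becomes `H₂`.

Rigidity enters once, on one fixed cube. Rescaling `u` carries it to all balls with the same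
constant (`RigidityOnCubes.exists_oscControl`), so `β` may be a multiple of a local `p`-mean of `F`
plus a local `q`-mean of `G`. By Tonelli these means are dominated by functions whose norms are
controlled by those of `F` and `G` (`exists_mean_dominating`), and truncating `dist(DEu, 𝒜)` against
them yields (d) (`exists_extGrad_decomp`).

The gradient estimate with a singleton `{ξ}` in place of `𝒜` bounds the distance of `DW n` from `ξ`
by a local mean of `|Du - ξ|`. This gives convergence of the smooth approximations in `W^{1,1}`
(`tendsto_approxExt`), hence the weak gradient of the extension. The same convergence for the
constant `1` shows that the boundary is a null set, and the choice `{0}` with `p = q = 1` gives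
boundedness on `W^{1,1}`. In (c) the function `Eu` itself serves as `H₁` when `u` is in `L^r`.
Otherwise the bound on `H₁` is void, and a smooth approximation so close to `Eu` that `F` and `G`
control the error serves instead (`exists_extFn_decomp`). -/

/-! ### Mollification at a given scale -/

/-- The fixed mollification kernel, supported in the ball of radius `1 / 2`. -/
noncomputable def unitKernel (d : ℕ) : ContDiffBump (0 : Vec d) :=
  ⟨1 / 4, 1 / 2, by norm_num, by norm_num⟩

/-- The mollification kernel at scale `l`. -/
noncomputable def mol {d : ℕ} (l : ℝ) (x : Vec d) : ℝ :=
  (l ^ d)⁻¹ * (unitKernel d).normed volume (l⁻¹ • x)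

theorem exists_kernel_bound (d : ℕ) : ∃ C : ℝ, 1 ≤ C ∧
    ∀ x : Vec d, |(unitKernel d).normed volume x| ≤ C ∧
      ‖fderiv ℝ ((unitKernel d).normed volume) x‖ ≤ C := by
  have hs : ContDiff ℝ 1 ((unitKernel d).normed (volume : Measure (Vec d))) :=
    (unitKernel d).contDiff_normed
  have hc : HasCompactSupport ((unitKernel d).normed (volume : Measure (Vec d))) :=
    (unitKernel d).hasCompactSupport_normed
  obtain ⟨A, hA⟩ := hc.exists_bound_of_continuous hs.continuous
  obtain ⟨B, hB⟩ := (hc.fderiv (𝕜 := ℝ)).exists_bound_of_continuous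
    (hs.continuous_fderiv (by simp))
  exact ⟨max 1 (max A B), le_max_left _ _, fun x =>
    ⟨(hA x).trans ((le_max_left _ _).trans (le_max_right _ _)),
      (hB x).trans ((le_max_right _ _).trans (le_max_right _ _))⟩⟩

noncomputable def kernelC (d : ℕ) : ℝ := (exists_kernel_bound d).choose

theorem one_le_kernelC (d : ℕ) : 1 ≤ kernelC d := (exists_kernel_bound d).choose_spec.1

theorem kernelC_pos (d : ℕ) : 0 < kernelC d := one_pos.trans_le (one_le_kernelC d)

section mol

variable {d : ℕ} {l : ℝ}

theorem contDiff_mol : ContDiff ℝ ∞ (mol l : Vec d → ℝ) := by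
  refine contDiff_const.mul ?_
  exact ((unitKernel d).contDiff_normed (n := ⊤)).comp (contDiff_const_smul _)

theorem continuous_mol : Continuous (mol l : Vec d → ℝ) := contDiff_mol.continuous

theorem mol_neg (x : Vec d) : mol l (-x) = mol l x := by
  simp [mol, (unitKernel d).normed_neg]

theorem mol_eq_zero (hl : 0 < l) {x : Vec d} (hx : l / 2 < ‖x‖) : mol l x = 0 := by
  have : l⁻¹ • x ∉ Function.support ((unitKernel d).normed (volume : Measure (Vec d))) := by
    rw [(unitKernel d).support_normed_eq]
    simp only [unitKernel, Metric.mem_ball, dist_zero_right, norm_smul, norm_inv, Real.norm_eq_abs,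
      abs_of_pos hl, not_lt]
    rw [inv_mul_eq_div, le_div_iff₀ hl]; linarith
  rw [mol, Function.notMem_support.1 this, mul_zero]

theorem support_mol_subset (hl : 0 < l) :
    Function.support (mol l : Vec d → ℝ) ⊆ Metric.closedBall 0 (l / 2) := by
  intro x hx
  by_contra h
  exact hx (mol_eq_zero hl (by simpa using h))

theorem hasCompactSupport_mol (hl : 0 < l) : HasCompactSupport (mol l : Vec d → ℝ) :=
  HasCompactSupport.of_support_subset_isCompact (isCompact_closedBall _ _) (support_mol_subset hl)

theorem tsupport_mol_subset (hl : 0 < l) :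
    tsupport (mol l : Vec d → ℝ) ⊆ Metric.closedBall 0 (l / 2) :=
  closure_minimal (support_mol_subset hl) Metric.isClosed_closedBall

theorem integral_mol (hl : 0 < l) : ∫ x : Vec d, mol l x = 1 := by
  simp only [mol]
  rw [integral_const_mul, Measure.integral_comp_inv_smul_of_nonneg _ _ hl.le,
    (unitKernel d).integral_normed]
  simp [hl.ne']

theorem abs_mol_le (hl : 0 < l) (x : Vec d) : |mol l x| ≤ kernelC d * (l ^ d)⁻¹ := by
  rw [mol, abs_mul, abs_of_pos (by positivity : 0 < (l ^ d)⁻¹), mul_comm]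
  exact mul_le_mul_of_nonneg_right ((exists_kernel_bound d).choose_spec.2 _).1 (by positivity)

theorem norm_fderiv_mol_le (hl : 0 < l) (x : Vec d) :
    ‖fderiv ℝ (mol l) x‖ ≤ kernelC d * (l ^ d)⁻¹ * l⁻¹ := by
  have hs : ContDiff ℝ 1 ((unitKernel d).normed (volume : Measure (Vec d))) :=
    (unitKernel d).contDiff_normed
  have h1 := (hs.differentiable (by simp)) (l⁻¹ • x)
  have h2 : HasFDerivAt (mol l) ((l ^ d)⁻¹ • (fderiv ℝ ((unitKernel d).normed volume) (l⁻¹ • x)).comp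
      (l⁻¹ • ContinuousLinearMap.id ℝ (Vec d))) x := by
    refine HasFDerivAt.const_mul ?_ _
    exact h1.hasFDerivAt.comp x ((ContinuousLinearMap.hasFDerivAt (l⁻¹ • ContinuousLinearMap.id ℝ (Vec d))))
  rw [h2.fderiv, norm_smul, Real.norm_eq_abs, abs_of_pos (by positivity)]
  calc (l ^ d)⁻¹ * _ ≤ (l ^ d)⁻¹ * (kernelC d * l⁻¹) := by
        gcongr
        refine (ContinuousLinearMap.opNorm_comp_le _ _).trans ?_
        gcongr
        · exact (kernelC_pos d).le
        · exact ((exists_kernel_bound d).choose_spec.2 _).2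
        · rw [norm_smul, Real.norm_eq_abs, abs_of_pos (by positivity)]
          exact mul_le_of_le_one_right (by positivity) ContinuousLinearMap.norm_id_le
    _ = _ := by ring

theorem fderiv_mol_eq_zero (hl : 0 < l) {x : Vec d} (hx : l / 2 < ‖x‖) :
    fderiv ℝ (mol l) x = 0 := by
  by_contra h
  have := (support_fderiv_subset ℝ).trans (tsupport_mol_subset hl) h
  simp at this
  linarith

end mol

section mollify

variable {d : ℕ} {E : Type*} [NormedAddCommGroup E] [NormedSpace ℝ E]

/-- The mollification of `B` at scale `l`. -/
noncomputable def mollify (l : ℝ) (B : Vec d → E) (x : Vec d) : E :=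
  ∫ y, mol l (x - y) • B y

open scoped Convolution in
theorem mollify_eq_convolution (l : ℝ) (B : Vec d → E) :
    mollify l B = mol l ⋆[ContinuousLinearMap.lsmul ℝ ℝ, volume] B := by
  ext x
  rw [mollify, convolution_lsmul_swap]

variable {l : ℝ} {B B' : Vec d → E}

theorem contDiff_mollify (hl : 0 < l) (hB : LocallyIntegrable B) : ContDiff ℝ ∞ (mollify l B) := by
  rw [mollify_eq_convolution]
  exact (hasCompactSupport_mol hl).contDiff_convolution_left (n := ⊤) _ contDiff_mol hB

theorem integrable_mol_smul (hl : 0 < l) (hB : LocallyIntegrable B) (x : Vec d) :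
    Integrable (fun y => mol l (x - y) • B y) := by
  have h := (hasCompactSupport_mol hl).convolutionExists_left
    (ContinuousLinearMap.lsmul ℝ ℝ) continuous_mol hB x
  have := h.integrable_swap
  simpa using this

theorem fderiv_mollify_apply (hl : 0 < l) (hB : LocallyIntegrable B) (x v : Vec d) :
    fderiv ℝ (mollify l B) x v = ∫ y, (fderiv ℝ (mol l) (x - y) v) • B y := by
  have h := (hasCompactSupport_mol hl).hasFDerivAt_convolution_left
    (ContinuousLinearMap.lsmul ℝ ℝ) (contDiff_mol.of_le (by simp)) hB x
  rw [mollify_eq_convolution, h.fderiv, convolution_eq_swap, ContinuousLinearMap.integral_apply]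
  · rfl
  · have hc : HasCompactSupport (fderiv ℝ (mol l : Vec d → ℝ)) := (hasCompactSupport_mol hl).fderiv (𝕜 := ℝ)
    have hcont : Continuous (fderiv ℝ (mol l : Vec d → ℝ)) := contDiff_mol.continuous_fderiv (by simp)
    have := hc.convolutionExists_left
      ((ContinuousLinearMap.lsmul ℝ ℝ : ℝ →L[ℝ] E →L[ℝ] E).precompL (Vec d)) hcont hB x
    exact this.integrable_swap

theorem differentiable_mollify (hl : 0 < l) (hB : LocallyIntegrable B) :
    Differentiable ℝ (mollify l B) := (contDiff_mollify hl hB).differentiable (by simp)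

/-- The kernel is left arbitrary so that the same bound serves `mol l` and its directional
derivatives. -/
theorem norm_integral_smul_le_of_support {k : Vec d → ℝ} {c r : ℝ} {x : Vec d}
    (hB : LocallyIntegrable B) (hk : ∀ y, ‖k y‖ ≤ c) (h0 : ∀ y, r < ‖y‖ → k y = 0) :
    ‖∫ y, k (x - y) • B y‖ ≤ c * ∫ y in Metric.closedBall x r, ‖B y‖ := by
  have hi : IntegrableOn B (Metric.closedBall x r) :=
    hB.integrableOn_isCompact (isCompact_closedBall _ _)
  have h1 : ∫ y, k (x - y) • B y = ∫ y in Metric.closedBall x r, k (x - y) • B y := by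
    refine (setIntegral_eq_integral_of_forall_compl_eq_zero ?_).symm
    intro y hy
    rw [h0, zero_smul]
    rw [Metric.mem_closedBall, dist_comm, dist_eq_norm] at hy
    exact not_le.1 hy
  rw [h1, ← integral_const_mul]
  refine norm_integral_le_of_norm_le (hi.norm.const_mul c) (Filter.Eventually.of_forall fun y => ?_)
  rw [norm_smul]
  gcongr
  exact hk _

theorem norm_mollify_le (hl : 0 < l) (hB : LocallyIntegrable B) (x : Vec d) :
    ‖mollify l B x‖ ≤ kernelC d * (l ^ d)⁻¹ * ∫ y in Metric.closedBall x (l / 2), ‖B y‖ :=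
  norm_integral_smul_le_of_support hB (abs_mol_le hl) fun _ h => mol_eq_zero hl h

theorem norm_fderiv_mollify_le (hl : 0 < l) (hB : LocallyIntegrable B) (x : Vec d) :
    ‖fderiv ℝ (mollify l B) x‖ ≤
      kernelC d * (l ^ d)⁻¹ * l⁻¹ * ∫ y in Metric.closedBall x (l / 2), ‖B y‖ := by
  have hC := kernelC_pos d
  refine ContinuousLinearMap.opNorm_le_bound _ (by positivity) fun v => ?_
  rw [fderiv_mollify_apply hl hB]
  have := norm_integral_smul_le_of_support (x := x) (k := fun y => fderiv ℝ (mol l) y v)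
    (c := kernelC d * (l ^ d)⁻¹ * l⁻¹ * ‖v‖) (r := l / 2) hB
    (fun y => (ContinuousLinearMap.le_opNorm _ _).trans (by gcongr; exact norm_fderiv_mol_le hl y))
    (fun y hy => by simp [fderiv_mol_eq_zero hl hy])
  refine this.trans (le_of_eq ?_)
  ring

theorem mollify_add (hl : 0 < l) (hB : LocallyIntegrable B) (hB' : LocallyIntegrable B') :
    mollify l (B + B') = mollify l B + mollify l B' := by
  ext x
  simp only [mollify, Pi.add_apply, smul_add]
  exact integral_add (integrable_mol_smul hl hB x) (integrable_mol_smul hl hB' x)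

theorem mollify_sub (hl : 0 < l) (hB : LocallyIntegrable B) (hB' : LocallyIntegrable B') :
    mollify l (B - B') = mollify l B - mollify l B' := by
  ext x
  simp only [mollify, Pi.sub_apply, smul_sub]
  exact integral_sub (integrable_mol_smul hl hB x) (integrable_mol_smul hl hB' x)

theorem mollify_const_smul (c : ℝ) : mollify l (c • B) = c • mollify l B := by
  ext x
  simp only [mollify, Pi.smul_apply, smul_comm _ c]
  exact integral_smul _ _

theorem mollify_congr_ae (h : B =ᵐ[volume] B') : mollify l B = mollify l B' := by
  ext x
  refine integral_congr_ae ?_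
  filter_upwards [h] with y hy
  rw [hy]

theorem mollify_congr (hl : 0 < l) {x : Vec d}
    (h : ∀ y ∈ Metric.closedBall x (l / 2), B y = B' y) : mollify l B x = mollify l B' x := by
  refine integral_congr_ae (Filter.Eventually.of_forall fun y => ?_)
  by_cases hy : y ∈ Metric.closedBall x (l / 2)
  · simp only [h y hy]
  · rw [Metric.mem_closedBall, dist_comm, dist_eq_norm] at hy
    simp only [mol_eq_zero hl (not_le.1 hy), zero_smul]

theorem integral_mol_sub (hl : 0 < l) (x : Vec d) : ∫ y, mol l (x - y) = 1 := by
  rw [integral_sub_left_eq_self (fun y : Vec d => mol l y), integral_mol hl]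

theorem mollify_const [CompleteSpace E] (hl : 0 < l) (a : E) :
    mollify l (fun _ : Vec d => a) = fun _ => a := by
  ext x
  rw [mollify, integral_smul_const, integral_mol_sub hl, one_smul]

/-- The kernel is even, so its first moments vanish. This is what lets mollification smooth the
rough extension without losing its affine approximation. -/
theorem mollify_affine [CompleteSpace E] (hl : 0 < l) (a : E) (z : Vec d) (L : Vec d →L[ℝ] E) :
    mollify l (fun y => a + L (y - z)) = fun x => a + L (x - z) := by
  have hc : LocallyIntegrable (fun y : Vec d => L y) := L.continuous.locallyIntegrable
  have hL : mollify l (fun y : Vec d => L y) = fun x => L x := by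
    ext x
    have h0 : ∫ y : Vec d, mol l y • L y = 0 := by
      have h : ∫ y : Vec d, mol l y • L y = - ∫ y : Vec d, mol l y • L y := by
        rw [← integral_neg, ← integral_neg_eq_self]
        simp [mol_neg]
      have h2 : (2 : ℝ) • ∫ y : Vec d, mol l y • L y = 0 := by
        rw [two_smul]; nth_rewrite 1 [h]; exact neg_add_cancel _
      exact (smul_eq_zero.1 h2).resolve_left two_ne_zero
    have h1 : ∫ y : Vec d, mol l (x - y) • L (x - y) = 0 := by
      rw [integral_sub_left_eq_self (fun y : Vec d => mol l y • L y), h0]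
    have h2 : ∫ y : Vec d, mol l (x - y) • L (x - y) = L x - mollify l (fun y : Vec d => L y) x := by
      have e : mollify l (fun _ : Vec d => L x) x = L x := by rw [mollify_const hl]
      conv_rhs => rw [← e]
      rw [mollify, mollify, ← integral_sub (integrable_mol_smul hl continuous_const.locallyIntegrable x)
        (integrable_mol_smul hl hc x)]
      simp [smul_sub]
    rw [h1] at h2
    exact (sub_eq_zero.1 h2.symm).symm
  have : (fun y => a + L (y - z)) = (fun _ : Vec d => a - L z) + fun y => L y := by
    ext y; simp; abel
  rw [this, mollify_add hl continuous_const.locallyIntegrable hc, hL, mollify_const hl]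

/-- The volume of the unit ball. -/
noncomputable def ballVol (d : ℕ) : ℝ := volume.real (Metric.closedBall (0 : Vec d) 1)

theorem ballVol_nonneg (d : ℕ) : 0 ≤ ballVol d := measureReal_nonneg

theorem volume_real_closedBall (hl : 0 ≤ l) (x : Vec d) :
    volume.real (Metric.closedBall x l) = l ^ d * ballVol d := by
  rw [measureReal_def, Measure.addHaar_closedBall' _ _ hl, ballVol, measureReal_def, ENNReal.toReal_mul,
    ENNReal.toReal_ofReal (by positivity)]
  simp

theorem volume_closedBall (hl : 0 ≤ l) (x : Vec d) :
    volume (Metric.closedBall x l) = ENNReal.ofReal (l ^ d * ballVol d) := by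
  rw [← volume_real_closedBall hl x, measureReal_def, ENNReal.ofReal_toReal measure_closedBall_lt_top.ne]

/-- Constant relating a supremum on a ball to a mollification. -/
noncomputable def supC (d : ℕ) : ℝ := kernelC d * ballVol d

theorem supC_nonneg (d : ℕ) : 0 ≤ supC d := mul_nonneg (kernelC_pos d).le (ballVol_nonneg d)

theorem integral_closedBall_le_of_bound {F : Type*} [NormedAddCommGroup F] {B : Vec d → F}
    (hl : 0 < l) (hB : LocallyIntegrable B) {x : Vec d} {s : ℝ}
    (hs : ∀ y ∈ Metric.closedBall x l, ‖B y‖ ≤ s) :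
    ∫ y in Metric.closedBall x (l / 2), ‖B y‖ ≤ l ^ d * ballVol d * s := by
  have hi : IntegrableOn B (Metric.closedBall x l) :=
    hB.integrableOn_isCompact (isCompact_closedBall _ _)
  calc _ ≤ ∫ y in Metric.closedBall x l, ‖B y‖ :=
        setIntegral_mono_set hi.norm (Filter.Eventually.of_forall fun _ => norm_nonneg _)
          (Metric.closedBall_subset_closedBall (by linarith)).eventuallyLE
    _ ≤ ∫ y in Metric.closedBall x l, s :=
        setIntegral_mono_on hi.norm (integrableOn_const measure_closedBall_lt_top.ne)
          measurableSet_closedBall hs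
    _ = _ := by
        rw [setIntegral_const, volume_real_closedBall hl.le, smul_eq_mul]

theorem norm_mollify_le_of_bound (hl : 0 < l) (hB : LocallyIntegrable B) {x : Vec d} {s : ℝ}
    (hs : ∀ y ∈ Metric.closedBall x l, ‖B y‖ ≤ s) : ‖mollify l B x‖ ≤ supC d * s := by
  refine (norm_mollify_le hl hB x).trans ?_
  have hC := kernelC_pos d
  calc _ ≤ kernelC d * (l ^ d)⁻¹ * (l ^ d * ballVol d * s) := by
        gcongr; exact integral_closedBall_le_of_bound hl hB hs
    _ = _ := by rw [supC]; field_simp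

theorem norm_fderiv_mollify_le_of_bound (hl : 0 < l) (hB : LocallyIntegrable B) {x : Vec d} {s : ℝ}
    (hs : ∀ y ∈ Metric.closedBall x l, ‖B y‖ ≤ s) :
    ‖fderiv ℝ (mollify l B) x‖ ≤ supC d * (s / l) := by
  refine (norm_fderiv_mollify_le hl hB x).trans ?_
  have hC := kernelC_pos d
  calc _ ≤ kernelC d * (l ^ d)⁻¹ * l⁻¹ * (l ^ d * ballVol d * s) := by
        gcongr; exact integral_closedBall_le_of_bound hl hB hs
    _ = _ := by rw [supC]; field_simp

/-- Affine maps are fixed by mollification, so subtracting one reduces both bounds to a sup estimate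
of the difference. The derivative costs a factor `1 / l`. -/
theorem norm_mollify_sub_affine_le [CompleteSpace E] (hl : 0 < l) (hB : LocallyIntegrable B)
    {x z : Vec d} {a : E} {L : Vec d →L[ℝ] E} {s : ℝ}
    (hs : ∀ y ∈ Metric.closedBall x l, ‖B y - (a + L (y - z))‖ ≤ s) :
    ‖mollify l B x - (a + L (x - z))‖ ≤ supC d * s ∧
      ‖fderiv ℝ (mollify l B) x - L‖ ≤ supC d * (s / l) := by
  have hc : LocallyIntegrable (fun y : Vec d => a + L (y - z)) :=
    Continuous.locallyIntegrable (by fun_prop)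
  have e := mollify_sub hl hB hc
  rw [mollify_affine hl] at e
  constructor
  · have := norm_mollify_le_of_bound hl (hB.sub hc) hs
    rwa [e] at this
  · have := norm_fderiv_mollify_le_of_bound hl (hB.sub hc) hs
    have hd : HasFDerivAt (mollify l B - fun x => a + L (x - z)) (fderiv ℝ (mollify l B) x - L) x := by
      refine ((differentiable_mollify hl hB) x).hasFDerivAt.sub ?_
      exact (L.hasFDerivAt.comp x ((hasFDerivAt_id x).sub_const z)).const_add a
    rwa [e, hd.fderiv] at this

/-- Used to compare mollifications at two different scales through their common double
mollification. -/
theorem mollify_mollify_comm [CompleteSpace E] {s : ℝ} (hl : 0 < l) (hs : 0 < s) (hB : Integrable B) :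
    mollify s (mollify l B) = mollify l (mollify s B) := by
  ext x
  simp only [mollify, ← integral_smul]
  have key : ∀ {a b : ℝ}, 0 < a → 0 < b →
      ∫ y, ∫ z, mol a (x - y) • mol b (y - z) • B z
        = ∫ z, (∫ y, mol a (x - y) * mol b (y - z)) • B z := by
    intro a b ha hb
    rw [integral_integral_swap]
    · refine integral_congr_ae (Filter.Eventually.of_forall fun z => ?_)
      simp only [smul_smul]
      rw [integral_smul_const]
    · have h1 : Integrable (mol b : Vec d → ℝ) := continuous_mol.integrable_of_hasCompactSupport (hasCompactSupport_mol hb)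
      have h := (hB.convolution_integrand (ContinuousLinearMap.lsmul ℝ ℝ).flip h1)
      have h2 : Integrable (fun p : Vec d × Vec d => mol b (p.1 - p.2) • B p.2) (volume.prod volume) := by
        simpa using h
      refine h2.bdd_smul (φ := fun p : Vec d × Vec d => mol a (x - p.1)) (kernelC d * (a ^ d)⁻¹) ?_ ?_
      · exact (continuous_mol.comp (continuous_const.sub continuous_fst)).aestronglyMeasurable
      · exact Filter.Eventually.of_forall fun p => abs_mol_le ha _
  rw [key hs hl, key hl hs]
  refine integral_congr_ae (Filter.Eventually.of_forall fun z => ?_)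
  simp only
  congr 1
  -- The substitution `y ↦ x + z - y` exchanges the arguments of the two kernels.
  rw [← integral_sub_left_eq_self _ volume (x + z)]
  refine integral_congr_ae (Filter.Eventually.of_forall fun y => ?_)
  simp only
  rw [mul_comm, show x + z - y - z = x - y by abel,
    show x - (x + z - y) = y - z by abel]

end mollify

/-! ### Matrices and linear maps -/

/-- The linear map with matrix `M`. -/
noncomputable def ofMat {d : ℕ} : Mat d →L[ℝ] (Vec d →L[ℝ] Vec d) :=
  LinearMap.toContinuousLinearMap
    { toFun := fun M => LinearMap.toContinuousLinearMap
        { toFun := fun v => WithLp.toLp 2 (fun i => ∑ j, M (i, j) * v j)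
          map_add' := fun v w => by ext i; simp [mul_add, Finset.sum_add_distrib]
          map_smul' := fun c v => by
            ext i; simp only [PiLp.smul_apply, smul_eq_mul, Finset.mul_sum, RingHom.id_apply]
            exact Finset.sum_congr rfl fun j _ => by ring }
      map_add' := fun M N => by ext v i; simp [add_mul, Finset.sum_add_distrib]
      map_smul' := fun c M => by ext v i; simp [Finset.mul_sum, mul_assoc] }

/-- The matrix of a linear map. -/
noncomputable def toMat {d : ℕ} : (Vec d →L[ℝ] Vec d) →L[ℝ] Mat d :=
  LinearMap.toContinuousLinearMap
    { toFun := fun L => WithLp.toLp 2 (fun ij => L (EuclideanSpace.single ij.2 1) ij.1)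
      map_add' := fun L K => by ext ij; simp
      map_smul' := fun c L => by ext ij; simp }

theorem ofMat_apply {d : ℕ} (M : Mat d) (v : Vec d) (i : Fin d) :
    ofMat M v i = ∑ j, M (i, j) * v j := rfl

theorem toMat_apply {d : ℕ} (L : Vec d →L[ℝ] Vec d) (i j : Fin d) :
    toMat L (i, j) = L (EuclideanSpace.single j 1) i := rfl

theorem toMat_ofMat {d : ℕ} (M : Mat d) : toMat (ofMat M) = M := by
  ext ⟨i, j⟩
  rw [toMat_apply, ofMat_apply]
  simp

theorem ofMat_toMat {d : ℕ} (L : Vec d →L[ℝ] Vec d) : ofMat (toMat L) = L := by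
  refine ContinuousLinearMap.coe_injective ((EuclideanSpace.basisFun (Fin d) ℝ).toBasis.ext fun j => ?_)
  ext i
  simp [ofMat_apply, toMat_apply]

/-- A bound for the norms of the conversions between matrices and linear maps. -/
noncomputable def matC (d : ℕ) : ℝ := max 1 (max ‖(ofMat : Mat d →L[ℝ] _)‖ ‖(toMat : _ →L[ℝ] Mat d)‖)

theorem one_le_matC (d : ℕ) : 1 ≤ matC d := le_max_left _ _

theorem norm_ofMat_le {d : ℕ} (M : Mat d) : ‖ofMat M‖ ≤ matC d * ‖M‖ :=
  (ofMat.le_opNorm M).trans (by gcongr; exact (le_max_left _ _).trans (le_max_right _ _))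

theorem norm_toMat_le {d : ℕ} (L : Vec d →L[ℝ] Vec d) : ‖toMat L‖ ≤ matC d * ‖L‖ :=
  (toMat.le_opNorm L).trans (by gcongr; exact (le_max_right _ _).trans (le_max_right _ _))

/-! ### Weak gradients -/

/-- `sobGrad` and `locGrad` are arbitrary choices; this identifies them almost everywhere with
gradients that are constructed explicitly. -/
theorem IsWeakGradient.ae_unique {d : ℕ} {Ω : Set (Vec d)} (hΩ : IsOpen Ω) {u : Vec d → Vec d}
    {g h : Vec d → Mat d} (hg : IsWeakGradient Ω u g) (hh : IsWeakGradient Ω u h) :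
    g =ᵐ[volume.restrict Ω] h := by
  have key : ∀ i j : Fin d, ∀ᵐ x ∂(volume.restrict Ω), g x (i, j) = h x (i, j) := by
    intro i j
    have e1 := locallyIntegrableOn_coord hg.2.1 (i, j)
    have e2 := locallyIntegrableOn_coord hh.2.1 (i, j)
    have := IsOpen.ae_eq_zero_of_integral_contDiff_smul_eq_zero (μ := volume) hΩ (e1.sub e2) ?_
    · filter_upwards [(ae_restrict_iff' hΩ.measurableSet).2 this] with x hx
      simpa [sub_eq_zero] using hx
    · intro φ hφ hc hs
      have k1 := hg.2.2 φ hφ hc hs i j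
      have k2 := hh.2.2 φ hφ hc hs i j
      have i1 := integrableOn_mul_of_locallyIntegrableOn e1 hφ.continuous hc hs
      have i2 := integrableOn_mul_of_locallyIntegrableOn e2 hφ.continuous hc hs
      have e : ∫ x, φ x • ((fun x => g x (i, j)) - fun x => h x (i, j)) x
          = ∫ x in Ω, (g x (i, j) * φ x - h x (i, j) * φ x) := by
        rw [setIntegral_eq_integral_of_forall_compl_eq_zero]
        · refine integral_congr_ae (Filter.Eventually.of_forall fun x => ?_)
          simp only [Pi.sub_apply, smul_eq_mul]; ring
        · intro x hx
          have : φ x = 0 := image_eq_zero_of_notMem_tsupport fun h => hx (hs h)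
          simp [this]
      rw [e, integral_sub i1 i2]
      linarith
  have : ∀ᵐ x ∂(volume.restrict Ω), ∀ ij : Fin d × Fin d, g x ij = h x ij := by
    rw [Filter.eventually_all]
    exact fun ij => key ij.1 ij.2
  filter_upwards [this] with x hx
  ext ij
  exact hx ij

theorem IsWeakGradient.mono {d : ℕ} {Ω Ω' : Set (Vec d)} (hsub : Ω' ⊆ Ω)
    {u : Vec d → Vec d} {g : Vec d → Mat d} (hg : IsWeakGradient Ω u g) :
    IsWeakGradient Ω' u g := by
  refine ⟨hg.1.mono_set hsub, hg.2.1.mono_set hsub, ?_⟩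
  intro φ hφ hc hs i j
  have k := hg.2.2 φ hφ hc (hs.trans hsub) i j
  have h0 : ∀ x, x ∉ Ω' → φ x = 0 := fun x hx => image_eq_zero_of_notMem_tsupport fun h => hx (hs h)
  have h1 : ∀ x, x ∉ Ω' → fderiv ℝ φ x (EuclideanSpace.single j 1) = 0 := fun x hx =>
    image_eq_zero_of_notMem_tsupport (f := fun x => fderiv ℝ φ x (EuclideanSpace.single j 1))
      fun h => hx (hs (tsupport_fderiv_vec_subset φ _ h))
  have e : ∀ f : Vec d → ℝ, (∀ x, x ∉ Ω' → f x = 0) → ∫ x in Ω, f x = ∫ x in Ω', f x := by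
    intro f hf
    rw [setIntegral_eq_integral_of_forall_compl_eq_zero hf,
      setIntegral_eq_integral_of_forall_compl_eq_zero fun x hx => hf x fun h => hx (hsub h)]
  rw [← e _ fun x hx => by rw [h1 x hx, mul_zero], ← e _ fun x hx => by rw [h0 x hx, mul_zero]]
  exact k

theorem isWeakGradient_of_contDiff {d : ℕ} {v : Vec d → Vec d} (hv : ContDiff ℝ 1 v) :
    IsWeakGradient univ v (fun x => toMat (fderiv ℝ v x)) := by
  have hD : Continuous (fun x => toMat (fderiv ℝ v x)) :=
    toMat.continuous.comp (hv.continuous_fderiv (by simp))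
  refine ⟨hv.continuous.locallyIntegrable.locallyIntegrableOn _,
    hD.locallyIntegrable.locallyIntegrableOn _, ?_⟩
  intro φ hφ hc hs i j
  simp only [Measure.restrict_univ]
  have hl1 := locallyIntegrableOn_coord (hv.continuous.locallyIntegrable.locallyIntegrableOn univ) i
  have hl2 := locallyIntegrableOn_coord (hD.locallyIntegrable.locallyIntegrableOn univ) (i, j)
  have hp : ∀ x, HasFDerivAt (fun x => v x i) ((EuclideanSpace.proj (𝕜 := ℝ) i).comp (fderiv ℝ v x)) x :=
    fun x => (EuclideanSpace.proj (𝕜 := ℝ) i).hasFDerivAt.comp x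
      ((hv.differentiable (by simp)) x).hasFDerivAt
  have hp' : ∀ x, fderiv ℝ (fun x => v x i) x (EuclideanSpace.single j 1) = toMat (fderiv ℝ v x) (i, j) :=
    fun x => by rw [(hp x).fderiv]; rfl
  rw [integral_mul_fderiv_eq_neg_fderiv_mul_of_integrable (f := fun x => v x i)]
  · simp only [hp']
  · simp only [hp']
    simpa using integrableOn_mul_of_locallyIntegrableOn hl2 hφ.continuous hc hs
  · simpa using integrableOn_mul_fderiv hl1 hφ hc hs (EuclideanSpace.single j 1)
  · simpa using integrableOn_mul_of_locallyIntegrableOn hl1 hφ.continuous hc hs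
  · exact fun x _ => (hp x).differentiableAt
  · exact fun x _ => hφ.differentiable (by simp) x

theorem tendsto_integral_mul_of_L1 {d : ℕ} {f : ℕ → Vec d → ℝ} {f' ψ : Vec d → ℝ} {C : ℝ}
    (hC : ∀ x, ‖ψ x‖ ≤ C)
    (hf' : Integrable (fun x => f' x * ψ x)) (hf : ∀ n, Integrable (fun x => f n x * ψ x))
    (h : Filter.Tendsto (fun n => ∫⁻ x, ‖f n x - f' x‖ₑ) Filter.atTop (nhds 0)) :
    Filter.Tendsto (fun n => ∫ x, f n x * ψ x) Filter.atTop (nhds (∫ x, f' x * ψ x)) := by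
  refine tendsto_integral_of_L1' _ hf'.aestronglyMeasurable (Filter.Eventually.of_forall hf) ?_
  simp only [eLpNorm_one_eq_lintegral_enorm]
  have h2 : Filter.Tendsto (fun n => ENNReal.ofReal C * ∫⁻ x, ‖f n x - f' x‖ₑ) Filter.atTop (nhds 0) := by
    have := ENNReal.Tendsto.const_mul h (Or.inr (ENNReal.ofReal_ne_top (r := C)))
    simpa using this
  refine tendsto_of_tendsto_of_tendsto_of_le_of_le tendsto_const_nhds h2 (fun _ => zero_le) fun n => ?_
  simp only
  rw [← lintegral_const_mul' _ _ ENNReal.ofReal_ne_top]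
  refine lintegral_mono fun x => ?_
  simp only [Pi.sub_apply]
  rw [← sub_mul, enorm_mul, mul_comm]
  gcongr
  rw [← ofReal_norm]
  exact ENNReal.ofReal_le_ofReal (hC x)

/-- The integration by parts formula passes to the limit because a test function and its derivatives
are bounded. It provides the weak gradient of the extension across the boundary of `U`. -/
theorem isWeakGradient_of_tendsto_L1 {d : ℕ} {v : ℕ → Vec d → Vec d} {w : Vec d → Vec d}
    {g : Vec d → Mat d} (hv : ∀ n, ContDiff ℝ 1 (v n)) (hw : Integrable w) (hg : Integrable g)
    (h1 : Filter.Tendsto (fun n => ∫⁻ x, ‖v n x - w x‖ₑ) Filter.atTop (nhds 0))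
    (h2 : Filter.Tendsto (fun n => ∫⁻ x, ‖toMat (fderiv ℝ (v n) x) - g x‖ₑ) Filter.atTop (nhds 0)) :
    IsWeakGradient univ w g := by
  have hw' := hw.locallyIntegrable.locallyIntegrableOn univ
  have hg' := hg.locallyIntegrable.locallyIntegrableOn univ
  refine ⟨hw', hg', ?_⟩
  intro φ hφ hc hs i j
  have coord : ∀ {ι : Type} [Fintype ι] (i : ι) (a b : EuclideanSpace ℝ ι), ‖a i - b i‖ₑ ≤ ‖a - b‖ₑ := by
    intro ι _ i a b
    rw [← PiLp.sub_apply]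
    have := PiLp.norm_apply_le (a - b) i
    rw [← ofReal_norm, ← ofReal_norm]
    exact ENNReal.ofReal_le_ofReal this
  have hc' : HasCompactSupport (fun x => fderiv ℝ φ x (EuclideanSpace.single j 1)) :=
    hc.of_isClosed_subset (isClosed_tsupport _) (tsupport_fderiv_vec_subset φ _)
  have hk : Continuous (fun x => fderiv ℝ φ x (EuclideanSpace.single j 1)) :=
    (hφ.continuous_fderiv (by simp)).clm_apply continuous_const
  obtain ⟨C1, hC1⟩ := hc'.exists_bound_of_continuous hk
  obtain ⟨C2, hC2⟩ := hc.exists_bound_of_continuous hφ.continuous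
  have hW := fun n => isWeakGradient_of_contDiff (hv n)
  have t1 := tendsto_integral_mul_of_L1 (f := fun n x => v n x i) (f' := fun x => w x i) hC1
    (by simpa using integrableOn_mul_fderiv (locallyIntegrableOn_coord hw' i) hφ hc hs (EuclideanSpace.single j 1))
    (fun n => by simpa using integrableOn_mul_fderiv (locallyIntegrableOn_coord (hW n).1 i) hφ hc hs (EuclideanSpace.single j 1))
    (tendsto_of_tendsto_of_tendsto_of_le_of_le tendsto_const_nhds h1 (fun _ => zero_le)
      fun n => lintegral_mono fun x => coord i _ _)
  have t2 := tendsto_integral_mul_of_L1 (f := fun n x => toMat (fderiv ℝ (v n) x) (i, j))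
    (f' := fun x => g x (i, j)) hC2
    (by simpa using integrableOn_mul_of_locallyIntegrableOn (locallyIntegrableOn_coord hg' (i, j)) hφ.continuous hc hs)
    (fun n => by simpa using integrableOn_mul_of_locallyIntegrableOn (locallyIntegrableOn_coord (hW n).2.1 (i, j)) hφ.continuous hc hs)
    (tendsto_of_tendsto_of_tendsto_of_le_of_le tendsto_const_nhds h2 (fun _ => zero_le)
      fun n => lintegral_mono fun x => coord (i, j) _ _)
  have e : ∀ n, ∫ x, v n x i * fderiv ℝ φ x (EuclideanSpace.single j 1) =
      -∫ x, toMat (fderiv ℝ (v n) x) (i, j) * φ x := fun n => by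
    simpa using (hW n).2.2 φ hφ hc hs i j
  simp only [e] at t1
  simp only [Measure.restrict_univ]
  exact tendsto_nhds_unique t1 t2.neg

/-! ### The gradient of a mollification -/

theorem euclidean_integral_apply {d : ℕ} {ι : Type} [Fintype ι] {f : Vec d → EuclideanSpace ℝ ι}
    (hf : Integrable f) (i : ι) : (∫ x, f x) i = ∫ x, f x i :=
  ((EuclideanSpace.proj (𝕜 := ℝ) i).integral_comp_comm hf).symm

/-- The kernel centred at `z` is supported in `U`, hence is an admissible test function; the jump of
the indicator at the boundary is not seen. -/
theorem fderiv_mollify_indicator {d : ℕ} {U : Set (Vec d)} (hU : MeasurableSet U) {u : Vec d → Vec d}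
    {g : Vec d → Mat d} (hg : IsWeakGradient U u g) (hui : IntegrableOn u U) (hgi : IntegrableOn g U)
    {t : ℝ} (ht : 0 < t) {z : Vec d} (hz : Metric.closedBall z (t / 2) ⊆ U) :
    fderiv ℝ (mollify t (U.indicator u)) z = ofMat (mollify t (U.indicator g) z) := by
  have hu' : LocallyIntegrable (U.indicator u) := (hui.integrable_indicator hU).locallyIntegrable
  have hg' : LocallyIntegrable (U.indicator g) := (hgi.integrable_indicator hU).locallyIntegrable
  rw [← ofMat_toMat (fderiv ℝ (mollify t (U.indicator u)) z)]
  congr 1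
  ext ⟨i, j⟩
  rw [toMat_apply, fderiv_mollify_apply ht hu', mollify,
    euclidean_integral_apply (integrable_mol_smul ht hg' z)]
  set φ : Vec d → ℝ := fun y => mol t (z - y) with hφ
  have hφs : ContDiff ℝ ∞ φ := contDiff_mol.comp (contDiff_const.sub contDiff_id)
  have hts : tsupport φ ⊆ Metric.closedBall z (t / 2) := by
    refine closure_minimal (fun y hy => ?_) Metric.isClosed_closedBall
    have := support_mol_subset ht (hy : mol t (z - y) ≠ 0)
    rw [Metric.mem_closedBall, dist_zero_right] at this
    rwa [Metric.mem_closedBall, dist_comm, dist_eq_norm]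
  have hφc : HasCompactSupport φ :=
    (isCompact_closedBall z (t / 2)).of_isClosed_subset (isClosed_tsupport _) hts
  have hfd : ∀ y v, fderiv ℝ φ y v = - fderiv ℝ (mol t) (z - y) v := by
    intro y v
    have h1 : HasFDerivAt (mol t) (fderiv ℝ (mol t) (z - y)) (z - y) :=
      (contDiff_mol.differentiable (by simp) _).hasFDerivAt
    have h2 : HasFDerivAt φ _ y := h1.comp y ((hasFDerivAt_id y).const_sub z)
    rw [h2.fderiv]; simp
  have k := hg.2.2 φ hφs hφc (hts.trans hz) i j
  have hint : Integrable (fun y => (fderiv ℝ (mol t) (z - y) (EuclideanSpace.single j 1)) • U.indicator u y) := by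
    refine (hui.integrable_indicator hU).bdd_smul (φ := fun y => (fderiv ℝ (mol t) (z - y) (EuclideanSpace.single j 1)))
      (kernelC d * (t ^ d)⁻¹ * t⁻¹ * ‖(EuclideanSpace.single j 1 : Vec d)‖) ?_ ?_
    · have : Continuous (fderiv ℝ (mol t : Vec d → ℝ)) := contDiff_mol.continuous_fderiv (by simp)
      exact ((this.comp (continuous_const.sub continuous_id)).clm_apply continuous_const).aestronglyMeasurable
    · refine Filter.Eventually.of_forall fun y => (ContinuousLinearMap.le_opNorm _ _).trans ?_
      gcongr
      exact norm_fderiv_mol_le ht _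
  rw [euclidean_integral_apply hint]
  have e1 : ∫ y, (fderiv ℝ (mol t) (z - y) (EuclideanSpace.single j 1) • U.indicator u y) i
      = - ∫ y in U, u y i * fderiv ℝ φ y (EuclideanSpace.single j 1) := by
    rw [← integral_indicator hU, ← integral_neg]
    refine integral_congr_ae (Filter.Eventually.of_forall fun y => ?_)
    by_cases hy : y ∈ U <;> simp [hy, hfd, mul_comm]
  have e2 : ∫ y, (mol t (z - y) • U.indicator g y) (i, j) = ∫ y in U, g y (i, j) * φ y := by
    rw [← integral_indicator hU]
    refine integral_congr_ae (Filter.Eventually.of_forall fun y => ?_)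
    by_cases hy : y ∈ U <;> simp [hy, hφ, mul_comm]
  rw [e1, e2, k, neg_neg]

/-! ### Geometry of Jones domains -/

/-- Otherwise the interior of `t` and the complement of its closure would separate `s`. -/
theorem IsPreconnected.inter_frontier_nonempty {X : Type*} [TopologicalSpace X] {s t : Set X}
    (hs : IsPreconnected s) (h1 : (s ∩ t).Nonempty) (h2 : (s ∩ tᶜ).Nonempty) :
    (s ∩ frontier t).Nonempty := by
  by_contra hne
  have hx : ∀ x ∈ s, x ∉ frontier t := fun x hx hf => hne ⟨x, hx, hf⟩
  have hi : ∀ x ∈ s, x ∈ t → x ∈ interior t := fun x hxs hxt => by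
    by_contra h
    exact hx x hxs ⟨subset_closure hxt, h⟩
  have hc : ∀ x ∈ s, x ∉ t → x ∉ closure t := fun x hxs hxt h =>
    hx x hxs ⟨h, fun h' => hxt (interior_subset h')⟩
  obtain ⟨a, has, hat⟩ := h1
  obtain ⟨b, hbs, hbt⟩ := h2
  obtain ⟨x, -, hx1, hx2⟩ := hs (interior t) (closure t)ᶜ isOpen_interior isClosed_closure.isOpen_compl
    (fun x hxs => by
      by_cases h : x ∈ t
      · exact Or.inl (hi x hxs h)
      · exact Or.inr (hc x hxs h)) ⟨a, has, hi a has hat⟩ ⟨b, hbs, hc b hbs hbt⟩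
  exact hx2 (subset_closure (interior_subset hx1))

section geometry

variable {d : ℕ} {U : Set (Vec d)} {e δ l : ℝ} {x y z : Vec d}

/-- The segment from `z` to `y` leaves `U` and so meets the frontier. -/
theorem infDist_frontier_le_dist (hz : z ∈ U) (hy : y ∉ U) :
    Metric.infDist z (frontier U) ≤ dist z y := by
  have hc : IsPreconnected (segment ℝ z y) := (convex_segment z y).isPreconnected
  obtain ⟨w, hw, hwf⟩ := hc.inter_frontier_nonempty ⟨z, left_mem_segment ℝ z y, hz⟩
    ⟨y, right_mem_segment ℝ z y, hy⟩
  refine (Metric.infDist_le_dist_of_mem hwf).trans ?_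
  obtain ⟨a, b, ha, hb, hab, rfl⟩ := hw
  rw [dist_eq_norm, dist_eq_norm]
  have : z - (a • z + b • y) = b • (z - y) := by
    have : a = 1 - b := by linarith
    rw [this]; module
  rw [this, norm_smul, Real.norm_eq_abs, abs_of_nonneg hb]
  exact mul_le_of_le_one_left (norm_nonneg _) (by linarith)

theorem closedBall_subset_of_lt_infDist {r : ℝ} (hz : z ∈ U)
    (hr : r < Metric.infDist z (frontier U)) : Metric.closedBall z r ⊆ U := by
  intro y hy
  by_contra h
  rw [Metric.mem_closedBall, dist_comm] at hy
  linarith [infDist_frontier_le_dist hz h]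

/-- If no point of the component were farther than `s` from `x`, its diameter would be at most `2 *
s`, less than `2 * ρ`. Connectedness then yields every intermediate distance. This is where the
lower bound on the diameters of components enters. -/
theorem exists_mem_dist_eq {s ρ : ℝ}
    (hcomp : 2 * ρ ≤ Metric.diam (connectedComponentIn U x)) (hx : x ∈ U) (hs0 : 0 ≤ s) (hs : s < ρ) :
    ∃ y ∈ U, dist x y = s := by
  have hxc : x ∈ connectedComponentIn U x := mem_connectedComponentIn hx
  have hsub : connectedComponentIn U x ⊆ U := connectedComponentIn_subset U x
  have : ∃ y ∈ connectedComponentIn U x, s < dist x y := by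
    by_contra! h
    have h2 : connectedComponentIn U x ⊆ Metric.closedBall x s := fun y hy => by
      rw [Metric.mem_closedBall, dist_comm]; exact h y hy
    have := (Metric.diam_mono h2 Metric.isBounded_closedBall).trans (Metric.diam_closedBall hs0)
    linarith
  obtain ⟨y, hy, hxy⟩ := this
  have h1 := isPreconnected_connectedComponentIn.intermediate_value hxc hy
    (f := fun w => dist x w) (by fun_prop)
  obtain ⟨w, hw, hws⟩ := h1 (⟨by simpa using hs0, hxy.le⟩ : s ∈ Icc (dist x x) (dist x y))
  exact ⟨w, hsub hw, hws⟩

/-- Two points of `U` at distance exactly `l` are joined by a Jones curve. Its point at distance `l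
/ 2` from one end is at least `l / 2` from the other, so it is at least `e * l / 4` from the
frontier. The slack in both strict inequalities makes the set of good reflections open. -/
theorem IsJonesDomain.exists_reflection (hJ : IsJonesDomain U e δ) (hne : U.Nonempty)
    (hcomp : ∀ x ∈ U, 2 * jonesRadius U δ ≤ Metric.diam (connectedComponentIn U x))
    (hl : 0 < l) (hlρ : l < jonesRadius U δ) (hy : Metric.infDist y U ≤ 5 * l) :
    ∃ z ∈ U, dist z y < 7 * l ∧ e * l / 8 < Metric.infDist z (frontier U) := by
  have he := hJ.e_pos
  obtain ⟨x, hx, hxy⟩ := (Metric.infDist_lt_iff hne).1 (hy.trans_lt (by linarith : 5 * l < 6 * l))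
  obtain ⟨x', hx', hd⟩ := exists_mem_dist_eq (hcomp x hx) hx hl.le hlρ
  have hlδ : l < δ := hlρ.trans_le (min_le_right _ _)
  obtain ⟨γ, hγc, hγU, h0, h1, -, hγ⟩ := hJ.exists_curve x hx x' hx' (by rwa [hd])
  have hc : ContinuousOn (fun t => dist x (γ t)) (Icc 0 1) := continuous_dist.comp_continuousOn (continuousOn_const.prodMk hγc)
  obtain ⟨t, ht, hts⟩ := intermediate_value_Icc zero_le_one hc
    (⟨by simp only [h0, dist_self]; linarith, by simp only [h1, hd]; linarith⟩ :
      l / 2 ∈ Icc (dist x (γ 0)) (dist x (γ 1)))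
  simp only at hts
  refine ⟨γ t, hγU ht, ?_, ?_⟩
  · calc dist (γ t) y ≤ dist (γ t) x + dist x y := dist_triangle _ _ _
      _ < 7 * l := by rw [dist_comm (γ t), hts, dist_comm x]; linarith
  · have h2 : l / 2 ≤ dist x' (γ t) := by
      have := dist_triangle x (γ t) x'
      rw [hd, hts, dist_comm (γ t)] at this
      linarith
    refine lt_of_lt_of_le ?_ (hγ t ht)
    rw [hts, hd]
    rw [lt_div_iff₀ hl]
    have : e * (l / 2) * (l / 2) ≤ e * (l / 2) * dist x' (γ t) := by gcongr
    nlinarith [mul_pos he (mul_pos hl hl)]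

/-- Points at distance comparable to `l` from `x` and from the boundary. -/
structure Admissible (U : Set (Vec d)) (e l : ℝ) (x z : Vec d) : Prop where
  mem : z ∈ U
  dist_le : dist z x ≤ 24 * l / e
  le_infDist : e ^ 3 / 16384 * l ≤ Metric.infDist z (frontier U)

/-- The bound `e * l / 16` is met by reflections at scale `l` and also by those at scale `l / 2`, so
both can be compared at scale `l`. -/
theorem Admissible.of_near (he : 0 < e) (he1 : e ≤ 1) (hl : 0 < l) (hz : z ∈ U)
    (h1 : dist z x ≤ 8 * l) (h2 : e * l / 16 ≤ Metric.infDist z (frontier U)) :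
    Admissible U e l x z := by
  refine ⟨hz, h1.trans ?_, le_trans ?_ h2⟩
  · rw [le_div_iff₀ he]; nlinarith
  · have : e ^ 3 ≤ e := by
      calc e ^ 3 ≤ e ^ 1 := pow_le_pow_of_le_one he.le he1 (by norm_num)
        _ = e := pow_one e
    nlinarith

/-- Walk along the curve in jumps of size exactly `t`, found by the intermediate value theorem. Each
jump uses up length at least `t`, so at most `n + 1` jumps are needed. -/
theorem norm_sub_le_of_curve {E : Type*} [SeminormedAddCommGroup E] {γ : ℝ → Vec d} {f : Vec d → E}
    {t D : ℝ} (ht : 0 < t) (hγ : ContinuousOn γ (Icc 0 1))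
    (hf : ∀ r ∈ Icc (0 : ℝ) 1, ∀ s ∈ Icc (0 : ℝ) 1, dist (γ r) (γ s) ≤ t → ‖f (γ r) - f (γ s)‖ ≤ D)
    (n : ℕ) : ∀ a ∈ Icc (0 : ℝ) 1, eVariationOn γ (Icc a 1) ≤ ENNReal.ofReal (n * t) →
      ‖f (γ a) - f (γ 1)‖ ≤ (n + 1) * D := by
  have hD : 0 ≤ D := (norm_nonneg _).trans (hf 0 (by simp) 0 (by simp) (by simpa using ht.le))
  have h1m : (1 : ℝ) ∈ Icc (0 : ℝ) 1 := by simp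
  induction n with
  | zero =>
    intro a ha hv
    have := eVariationOn.edist_le γ (left_mem_Icc.2 ha.2) (right_mem_Icc.2 ha.2)
    have h0 : edist (γ a) (γ 1) = 0 := by
      simpa using this.trans hv
    have h0' : dist (γ a) (γ 1) = 0 := by rw [edist_dist] at h0; simpa using h0
    simpa using hf a ha 1 h1m (by rw [h0']; exact ht.le)
  | succ n ih =>
    intro a ha hv
    by_cases hat : dist (γ a) (γ 1) ≤ t
    · refine (hf a ha 1 h1m hat).trans ?_
      push_cast
      nlinarith [mul_nonneg (Nat.cast_nonneg (α := ℝ) n) hD]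
    · have hc : ContinuousOn (fun s => dist (γ a) (γ s)) (Icc a 1) :=
        continuous_dist.comp_continuousOn
          (continuousOn_const.prodMk (hγ.mono (Icc_subset_Icc_left ha.1)))
      obtain ⟨b, hb, hbt⟩ := intermediate_value_Icc ha.2 hc
        (⟨by simpa using ht.le, (not_le.1 hat).le⟩ : t ∈ Icc (dist (γ a) (γ a)) (dist (γ a) (γ 1)))
      simp only at hbt
      have hb' : b ∈ Icc (0 : ℝ) 1 := ⟨ha.1.trans hb.1, hb.2⟩
      have hsum := eVariationOn.Icc_add_Icc γ (s := univ) hb.1 hb.2 (mem_univ b)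
      simp only [univ_inter] at hsum
      have h2 : ENNReal.ofReal t ≤ eVariationOn γ (Icc a b) := by
        have := eVariationOn.edist_le γ (left_mem_Icc.2 hb.1) (right_mem_Icc.2 hb.1)
        rwa [edist_dist, hbt] at this
      have h3 : eVariationOn γ (Icc b 1) ≤ ENNReal.ofReal (n * t) := by
        have h4 : ENNReal.ofReal t + eVariationOn γ (Icc b 1) ≤
            ENNReal.ofReal t + ENNReal.ofReal (n * t) := by
          calc _ ≤ eVariationOn γ (Icc a b) + eVariationOn γ (Icc b 1) := by gcongr
            _ ≤ ENNReal.ofReal ((n + 1 : ℕ) * t) := hsum.trans_le hv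
            _ = _ := by
              rw [← ENNReal.ofReal_add ht.le (by positivity)]
              congr 1; push_cast; ring
        exact (ENNReal.add_le_add_iff_left ENNReal.ofReal_ne_top).1 h4
      have h5 := ih b hb' h3
      have h6 := hf a ha b hb' hbt.le
      have h7 := norm_sub_le_norm_sub_add_norm_sub (f (γ a)) (f (γ b)) (f (γ 1))
      push_cast
      linarith

/-- A function on `U` that varies by at most `D` between admissible points at distance `t` varies by
a bounded multiple of `D` between two reflections, since the Jones curve between them consists of
admissible points. -/
theorem IsJonesDomain.norm_sub_le_of_step (hJ : IsJonesDomain U e δ) {E : Type*}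
    [SeminormedAddCommGroup E] {f : Vec d → E} {t D : ℝ} {z z' : Vec d} (hl : 0 < l)
    (hlδ : 16 * l < δ) (ht : 0 < t)
    (hz : z ∈ U) (h1 : dist z x ≤ 8 * l) (h2 : e * l / 16 ≤ Metric.infDist z (frontier U))
    (hz' : z' ∈ U) (h1' : dist z' x ≤ 8 * l) (h2' : e * l / 16 ≤ Metric.infDist z' (frontier U))
    (hf : ∀ w w', Admissible U e l x w → Admissible U e l x w' → dist w w' ≤ t → ‖f w - f w'‖ ≤ D) :
    ‖f z - f z'‖ ≤ (16 * l / (e * t) + 2) * D := by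
  have he := hJ.e_pos
  have he1 := hJ.e_le_one
  have ha := Admissible.of_near he he1 hl hz h1 h2
  have hD : 0 ≤ D := (norm_nonneg _).trans (hf z z ha ha (by simpa using ht.le))
  have hd : dist z z' ≤ 16 * l := by
    have := dist_triangle_right z z' x; linarith
  obtain ⟨γ, hγc, hγU, h0, h1e, hlen, hγ⟩ := hJ.exists_curve z hz z' hz' (hd.trans_lt hlδ)
  have hlen' : eVariationOn γ (Icc 0 1) ≤ ENNReal.ofReal (16 * l / e) := by
    refine hlen.trans (ENNReal.ofReal_le_ofReal ?_)
    rw [one_div, inv_mul_eq_div]; gcongr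
  have hpt : ∀ s ∈ Icc (0 : ℝ) 1, dist z (γ s) ≤ 1 / e * dist z z' := by
    intro s hs
    have := (eVariationOn.edist_le γ (by simp : (0 : ℝ) ∈ Icc (0 : ℝ) 1) hs).trans hlen
    rw [h0, edist_dist] at this
    exact (ENNReal.ofReal_le_ofReal_iff (by positivity)).1 this
  have hadm : ∀ s ∈ Icc (0 : ℝ) 1, Admissible U e l x (γ s) := by
    intro s hs
    have hp := hpt s hs
    have hp' : dist z (γ s) ≤ 16 * l / e := by
      refine hp.trans ?_
      rw [one_div, inv_mul_eq_div]; gcongr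
    refine ⟨hγU hs, ?_, ?_⟩
    · have h8 : 8 * l ≤ 8 * l / e := by
        rw [le_div_iff₀ he]; nlinarith
      have h24 : 24 * l / e = 16 * l / e + 8 * l / e := by ring
      rw [h24]
      have := dist_triangle (γ s) z x
      rw [dist_comm (γ s) z] at this
      linarith
    · have he3 : e ^ 3 ≤ e := by
        calc e ^ 3 ≤ e ^ 1 := pow_le_pow_of_le_one he.le he1 (by norm_num)
          _ = e := pow_one e
      have hsmall : e ^ 3 / 16384 * l ≤ e * l / 32 := by nlinarith
      -- Close to an endpoint the curve inherits the endpoint's distance from the frontier. Away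
      -- from both, the Jones inequality gives `e * (e * l / 32) ^ 2 / (16 * l)`, which is the
      -- constant `e ^ 3 / 16384 * l` of `Admissible`.
      by_cases c1 : dist z (γ s) ≤ e * l / 32
      · have := Metric.infDist_le_infDist_add_dist (s := frontier U) (x := z) (y := γ s)
        linarith
      by_cases c2 : dist z' (γ s) ≤ e * l / 32
      · have := Metric.infDist_le_infDist_add_dist (s := frontier U) (x := z') (y := γ s)
        linarith
      push Not at c1 c2
      have hpos : 0 < dist z z' := by
        rcases (dist_nonneg (x := z) (y := z')).eq_or_lt with h | h
        · rw [← h, mul_zero] at hp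
          have : 0 < e * l / 32 := by positivity
          linarith
        · exact h
      refine le_trans ?_ (hγ s hs)
      rw [le_div_iff₀ hpos]
      calc e ^ 3 / 16384 * l * dist z z' ≤ e ^ 3 / 16384 * l * (16 * l) := by gcongr
        _ = e * (e * l / 32) * (e * l / 32) := by ring
        _ ≤ _ := by gcongr
  have hn : 16 * l / (e * t) ≤ ⌈16 * l / (e * t)⌉₊ := Nat.le_ceil _
  have hn' : (⌈16 * l / (e * t)⌉₊ : ℝ) < 16 * l / (e * t) + 1 := Nat.ceil_lt_add_one (by positivity)
  have := norm_sub_le_of_curve ht hγc (fun r hr s hs h => hf _ _ (hadm r hr) (hadm s hs) h)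
    ⌈16 * l / (e * t)⌉₊ 0 (by simp) (hlen'.trans (ENNReal.ofReal_le_ofReal (by
      rw [div_le_iff₀ (by positivity)] at hn
      rw [div_le_iff₀ he]; linarith)))
  rw [h0, h1e] at this
  refine this.trans (mul_le_mul_of_nonneg_right (by linarith) hD)

theorem jonesRadius_pos (hd : 1 ≤ d) (hU : IsOpen U) (hb : Bornology.IsBounded U) (hne : U.Nonempty)
    (hδ : 0 < δ) : 0 < jonesRadius U δ := by
  have : Nonempty (Fin d) := ⟨⟨0, hd⟩⟩
  refine lt_min ?_ hδ
  obtain ⟨x, hx⟩ := hne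
  obtain ⟨r, hr, hball⟩ := Metric.isOpen_iff.1 hU x hx
  obtain ⟨v, hv⟩ := exists_norm_eq (Vec d) (by positivity : 0 ≤ r / 2)
  have hy : x + v ∈ U := hball (by simp [hv]; linarith)
  have := Metric.dist_le_diam_of_mem hb hy hx
  rw [dist_eq_norm, add_sub_cancel_left, hv] at this
  linarith

end geometry

/-! ### Local affine approximation at a fixed scale -/

section taylor

variable {d : ℕ} {U : Set (Vec d)} {u : Vec d → Vec d} {g : Vec d → Mat d} {𝒜 : Set (Mat d)}
  {t β : ℝ} {z : Vec d}

/-- The first order Taylor polynomial at `z` of the mollification of `f`. -/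
noncomputable def taylor (t : ℝ) (f : Vec d → Vec d) (z x : Vec d) : Vec d :=
  mollify t f z + fderiv ℝ (mollify t f) z (x - z)

/-- `g` is close, in the mean near `z`, to a constant matrix that is close to `𝒜`. -/
def OscAt (g : Vec d → Mat d) (𝒜 : Set (Mat d)) (t : ℝ) (z : Vec d) (β : ℝ) : Prop :=
  ∃ M : Mat d, ∫ y in Metric.closedBall z (2 * t), ‖g y - M‖ ≤ t ^ d * β ∧ Metric.infDist M 𝒜 ≤ β

theorem OscAt.nonneg (h : OscAt g 𝒜 t z β) : 0 ≤ β := by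
  obtain ⟨M, -, h⟩ := h
  exact Metric.infDist_nonneg.trans h

/-- The constant of the gradient estimate for mollifications. -/
noncomputable def gradC (d : ℕ) : ℝ := matC d * (kernelC d * 2 ^ d)

theorem gradC_pos (d : ℕ) : 0 < gradC d := by
  have := kernelC_pos d
  have := one_le_matC d
  unfold gradC
  positivity

/-- The gradient of the mollification is the mollification of `g`, and constants are preserved. The
scale `s` ranges over `[t / 2, t]`, so that one matrix `M` serves both `t` and `t / 2`; this is the
origin of the `2 ^ d` in `gradC`. -/
theorem norm_fderiv_mollify_sub_le (hU : MeasurableSet U) (hg : IsWeakGradient U u g)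
    (hui : IntegrableOn u U) (hgi : IntegrableOn g U) (ht : 0 < t)
    (hz : Metric.closedBall z (2 * t) ⊆ U) {M : Mat d}
    (hM : ∫ y in Metric.closedBall z (2 * t), ‖g y - M‖ ≤ t ^ d * β) {s : ℝ} (hs : t / 2 ≤ s)
    (hst : s ≤ t) {ζ : Vec d} (hζ : ζ ∈ Metric.closedBall z t) :
    ‖fderiv ℝ (mollify s (U.indicator u)) ζ - ofMat M‖ ≤ gradC d * β := by
  have hs0 : 0 < s := by linarith
  have hsub : Metric.closedBall ζ (s / 2) ⊆ Metric.closedBall z (2 * t) :=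
    Metric.closedBall_subset_closedBall' (by rw [Metric.mem_closedBall] at hζ; linarith)
  rw [fderiv_mollify_indicator hU hg hui hgi hs0 (hsub.trans hz), ← map_sub]
  refine (norm_ofMat_le _).trans ?_
  have hm0 := one_le_matC d
  have hk0 := kernelC_pos d
  rw [gradC, mul_assoc]
  gcongr
  have hgl : LocallyIntegrable (U.indicator g) := (hgi.integrable_indicator hU).locallyIntegrable
  have hcl : LocallyIntegrable (fun _ : Vec d => M) := continuous_const.locallyIntegrable
  have e := congrFun (mollify_sub hs0 hgl hcl) ζ
  rw [mollify_const hs0] at e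
  have e' : mollify s (U.indicator g) ζ - M = mollify s (U.indicator g - fun _ => M) ζ := by
    rw [e]; rfl
  rw [e']
  refine (norm_mollify_le hs0 (hgl.sub hcl) ζ).trans ?_
  have hi : IntegrableOn (fun y => g y - M) (Metric.closedBall z (2 * t)) :=
    (hgi.mono_set hz).sub (integrableOn_const measure_closedBall_lt_top.ne)
  have h1 : ∫ y in Metric.closedBall ζ (s / 2), ‖(U.indicator g - fun _ => M : Vec d → Mat d) y‖ ≤ t ^ d * β := by
    refine le_trans ?_ hM
    rw [setIntegral_congr_fun (g := fun y => ‖g y - M‖) measurableSet_closedBall]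
    · exact setIntegral_mono_set hi.norm (Filter.Eventually.of_forall fun _ => norm_nonneg _)
        hsub.eventuallyLE
    · intro y hy
      simp [hz (hsub hy)]
  have h0 : 0 ≤ t ^ d * β := (integral_nonneg fun _ => norm_nonneg _).trans h1
  have hβ : 0 ≤ β := nonneg_of_mul_nonneg_right h0 (by positivity)
  calc _ ≤ kernelC d * ((t / 2) ^ d)⁻¹ * (t ^ d * β) := by gcongr
    _ = _ := by
      rw [div_pow]; field_simp

theorem norm_mollify_sub_sub_le (hU : MeasurableSet U) (hg : IsWeakGradient U u g)
    (hui : IntegrableOn u U) (hgi : IntegrableOn g U) (ht : 0 < t)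
    (hz : Metric.closedBall z (2 * t) ⊆ U) {M : Mat d}
    (hM : ∫ y in Metric.closedBall z (2 * t), ‖g y - M‖ ≤ t ^ d * β) {s : ℝ} (hs : t / 2 ≤ s)
    (hst : s ≤ t) {ζ : Vec d} (hζ : ζ ∈ Metric.closedBall z t) :
    ‖mollify s (U.indicator u) ζ - mollify s (U.indicator u) z - ofMat M (ζ - z)‖
      ≤ gradC d * β * ‖ζ - z‖ := by
  have hul : LocallyIntegrable (U.indicator u) := (hui.integrable_indicator hU).locallyIntegrable
  exact (convex_closedBall z t).norm_image_sub_le_of_norm_fderiv_le'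
    (fun y _ => differentiable_mollify (by linarith) hul y)
    (fun y hy => norm_fderiv_mollify_sub_le hU hg hui hgi ht hz hM hs hst hy)
    (Metric.mem_closedBall_self ht.le) hζ

/-- Both centres lie in the ball where one matrix `M` approximates the gradient, so each polynomial
is compared with an affine map of slope `M`. Only the oscillation around `z` is needed. -/
theorem norm_taylor_sub_taylor_le (hU : MeasurableSet U) (hg : IsWeakGradient U u g)
    (hui : IntegrableOn u U) (hgi : IntegrableOn g U) (ht : 0 < t)
    (hz : Metric.closedBall z (2 * t) ⊆ U) (hosc : OscAt g 𝒜 t z β) {z' : Vec d}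
    (hz' : dist z z' ≤ t) (x : Vec d) :
    ‖taylor t (U.indicator u) z x - taylor t (U.indicator u) z' x‖
      ≤ gradC d * β * (t + dist x z + dist x z') := by
  obtain ⟨M, hM, -⟩ := id hosc
  have hβ := hosc.nonneg
  have hC := gradC_pos d
  have hz'm : z' ∈ Metric.closedBall z t := by rwa [Metric.mem_closedBall, dist_comm]
  have h1 := norm_mollify_sub_sub_le hU hg hui hgi ht hz hM (by linarith) le_rfl hz'm
  have h2 := norm_fderiv_mollify_sub_le hU hg hui hgi ht hz hM (by linarith) le_rfl
    (Metric.mem_closedBall_self ht.le)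
  have h3 := norm_fderiv_mollify_sub_le hU hg hui hgi ht hz hM (by linarith) le_rfl hz'm
  set b := mollify t (U.indicator u)
  have e : taylor t (U.indicator u) z x - taylor t (U.indicator u) z' x =
      -(b z' - b z - ofMat M (z' - z)) + (fderiv ℝ b z - ofMat M) (x - z)
        - (fderiv ℝ b z' - ofMat M) (x - z') := by
    simp only [taylor, _root_.sub_apply, map_sub]
    abel
  rw [e]
  calc _ ≤ ‖b z' - b z - ofMat M (z' - z)‖ + ‖(fderiv ℝ b z - ofMat M) (x - z)‖
        + ‖(fderiv ℝ b z' - ofMat M) (x - z')‖ := by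
        refine (norm_sub_le _ _).trans ?_
        gcongr
        refine (norm_add_le _ _).trans ?_
        rw [norm_neg]
    _ ≤ gradC d * β * t + gradC d * β * dist x z + gradC d * β * dist x z' := by
        gcongr
        · refine h1.trans ?_
          gcongr
          rwa [← dist_eq_norm, dist_comm]
        · rw [dist_eq_norm]
          exact (ContinuousLinearMap.le_opNorm _ _).trans (by gcongr)
        · rw [dist_eq_norm]
          exact (ContinuousLinearMap.le_opNorm _ _).trans (by gcongr)
    _ = _ := by ring

/-- The slopes are both close to `M`. The values at `z` are compared without reference to `u`
itself: the double mollification is close to each of the two single ones, because each of these is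
nearly affine near `z`. -/
theorem norm_taylor_sub_taylor_half_le (hU : MeasurableSet U) (hg : IsWeakGradient U u g)
    (hui : IntegrableOn u U) (hgi : IntegrableOn g U) (ht : 0 < t)
    (hz : Metric.closedBall z (2 * t) ⊆ U) (hosc : OscAt g 𝒜 t z β) (x : Vec d) :
    ‖taylor (t / 2) (U.indicator u) z x - taylor t (U.indicator u) z x‖
      ≤ 2 * gradC d * β * (supC d * t + dist x z) := by
  obtain ⟨M, hM, -⟩ := id hosc
  have hβ := hosc.nonneg
  have hC := gradC_pos d
  have hint := hui.integrable_indicator hU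
  have hul : LocallyIntegrable (U.indicator u) := hint.locallyIntegrable
  have hzm := Metric.mem_closedBall_self (x := z) ht.le
  have ht2 : 0 < t / 2 := by linarith
  have hl : ∀ s, 0 < s → LocallyIntegrable (mollify s (U.indicator u)) := fun s hs =>
    (contDiff_mollify hs hul).continuous.locallyIntegrable
  have key : ∀ s r : ℝ, t / 2 ≤ s → s ≤ t → t / 2 ≤ r → r ≤ t →
      ‖mollify r (mollify s (U.indicator u)) z - mollify s (U.indicator u) z‖
        ≤ supC d * (gradC d * β * t) := by
    intro s r hs hst hr hrt
    have hr0 : 0 < r := by linarith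
    have := (norm_mollify_sub_affine_le (x := z) (z := z) (a := mollify s (U.indicator u) z)
      (L := ofMat M) (s := gradC d * β * t) hr0 (hl s (by linarith)) fun y hy => by
        have hy' : y ∈ Metric.closedBall z t := Metric.closedBall_subset_closedBall hrt hy
        have h := norm_mollify_sub_sub_le hU hg hui hgi ht hz hM hs hst hy'
        rw [← sub_sub]
        refine h.trans ?_
        gcongr
        rwa [← dist_eq_norm]).1
    simpa using this
  have k1 := key t (t / 2) (by linarith) le_rfl le_rfl (by linarith)
  have k2 := key (t / 2) t le_rfl (by linarith) (by linarith) le_rfl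
  -- Now both estimates concern the same double mollification.
  rw [mollify_mollify_comm ht ht2 hint] at k1
  have h2 := norm_fderiv_mollify_sub_le hU hg hui hgi ht hz hM (by linarith) le_rfl hzm
  have h3 := norm_fderiv_mollify_sub_le hU hg hui hgi ht hz hM (le_refl (t / 2)) (by linarith) hzm
  set b := mollify t (U.indicator u)
  set b' := mollify (t / 2) (U.indicator u)
  have e : taylor (t / 2) (U.indicator u) z x - taylor t (U.indicator u) z x =
      ((mollify t b' z - b z) - (mollify t b' z - b' z))
        + ((fderiv ℝ b' z - ofMat M) (x - z) - (fderiv ℝ b z - ofMat M) (x - z)) := by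
    simp only [taylor, _root_.sub_apply]
    abel
  rw [e]
  calc _ ≤ (‖mollify t b' z - b z‖ + ‖mollify t b' z - b' z‖)
        + (‖(fderiv ℝ b' z - ofMat M) (x - z)‖ + ‖(fderiv ℝ b z - ofMat M) (x - z)‖) :=
        (norm_add_le _ _).trans (add_le_add (norm_sub_le _ _) (norm_sub_le _ _))
    _ ≤ (supC d * (gradC d * β * t) + supC d * (gradC d * β * t))
        + (gradC d * β * dist x z + gradC d * β * dist x z) := by
        gcongr
        · rw [dist_eq_norm]
          exact (ContinuousLinearMap.le_opNorm _ _).trans (by gcongr)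
        · rw [dist_eq_norm]
          exact (ContinuousLinearMap.le_opNorm _ _).trans (by gcongr)
    _ = _ := by ring

theorem norm_taylor_sub_affine_le (hU : MeasurableSet U) (hg : IsWeakGradient U u g)
    (hui : IntegrableOn u U) (hgi : IntegrableOn g U) (ht : 0 < t)
    (hz : Metric.closedBall z (2 * t) ⊆ U) {M : Mat d}
    (hM : ∫ y in Metric.closedBall z (2 * t), ‖g y - M‖ ≤ t ^ d * β) (x : Vec d) :
    ‖taylor t (U.indicator u) z x - (mollify t (U.indicator u) z + ofMat M (x - z))‖
      ≤ gradC d * β * dist x z := by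
  have h2 := norm_fderiv_mollify_sub_le hU hg hui hgi ht hz hM (by linarith) le_rfl
    (Metric.mem_closedBall_self ht.le)
  rw [taylor, add_sub_add_left_eq_sub, ← _root_.sub_apply, dist_eq_norm]
  exact (ContinuousLinearMap.le_opNorm _ _).trans (by gcongr)

/-- Crude bound for the Taylor polynomial, relative to a constant. -/
theorem norm_taylor_sub_const_le {f : Vec d → Vec d} (hf : LocallyIntegrable f) (ht : 0 < t)
    (z x ξ : Vec d) :
    ‖taylor t f z x - ξ‖ ≤ kernelC d * (t ^ d)⁻¹ * (1 + t⁻¹ * dist x z) *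
      ∫ y in Metric.closedBall z (t / 2), ‖f y - ξ‖ := by
  have hcl : LocallyIntegrable (fun _ : Vec d => ξ) := continuous_const.locallyIntegrable
  have e := mollify_sub ht hf hcl
  rw [mollify_const ht] at e
  have h1 := norm_mollify_le ht (hf.sub hcl) z
  have h2 := norm_fderiv_mollify_le ht (hf.sub hcl) z
  rw [e] at h1 h2
  have e2 : fderiv ℝ (mollify t f - fun _ => ξ : Vec d → Vec d) z = fderiv ℝ (mollify t f) z := by
    rw [fderiv_sub (differentiable_mollify ht hf z) (differentiableAt_const ξ)]
    simp
  rw [e2] at h2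
  have hk := kernelC_pos d
  have h0 : 0 ≤ ∫ y in Metric.closedBall z (t / 2), ‖f y - ξ‖ := integral_nonneg fun _ => norm_nonneg _
  calc ‖taylor t f z x - ξ‖ = ‖(mollify t f - fun _ => ξ : Vec d → Vec d) z + fderiv ℝ (mollify t f) z (x - z)‖ := by
        rw [taylor, Pi.sub_apply]; congr 1; abel
    _ ≤ ‖(mollify t f - fun _ => ξ : Vec d → Vec d) z‖ + ‖fderiv ℝ (mollify t f) z‖ * dist x z := by
        rw [dist_eq_norm]
        exact (norm_add_le _ _).trans (by gcongr; exact ContinuousLinearMap.le_opNorm _ _)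
    _ ≤ _ := by
        refine (add_le_add h1 (mul_le_mul_of_nonneg_right h2 dist_nonneg)).trans (le_of_eq ?_)
        simp only [Pi.sub_apply]
        ring

end taylor

/-! ### Reflections and the rough extension at one scale -/

section rough

variable {d : ℕ} {U : Set (Vec d)} {u f : Vec d → Vec d} {g : Vec d → Mat d} {𝒜 : Set (Mat d)}
  {e δ l β : ℝ} {x y z : Vec d}

/-- The ratio of the mollification scale to the scale of the reflection. -/
noncomputable def scaleRatio (d : ℕ) (e : ℝ) : ℝ := e ^ 3 / 16384 / (6 * (d + 1))

theorem scaleRatio_pos (d : ℕ) (he : 0 < e) : 0 < scaleRatio d e := by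
  unfold scaleRatio; positivity

theorem scaleRatio_mul (d : ℕ) (e : ℝ) : 6 * (d + 1) * scaleRatio d e = e ^ 3 / 16384 := by
  unfold scaleRatio; field_simp

theorem scaleRatio_le (d : ℕ) (he : 0 < e) : 6 * scaleRatio d e ≤ e ^ 3 / 16384 := by
  rw [← scaleRatio_mul d e]
  have := scaleRatio_pos d he
  have hd : (0 : ℝ) ≤ d := Nat.cast_nonneg d
  nlinarith [mul_nonneg hd this.le]

/-- Points of `U` at distance comparable to `l` from `x` and from the boundary. -/
def nearSet (U : Set (Vec d)) (e l : ℝ) (x : Vec d) : Set (Vec d) :=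
  {w | w ∈ U ∧ dist w x ≤ 25 * l / e ∧ e ^ 3 / 32768 * l ≤ Metric.infDist w (frontier U)}

theorem measurableSet_nearSet (hU : MeasurableSet U) : MeasurableSet (nearSet U e l x) := by
  refine hU.inter (MeasurableSet.inter ?_ ?_)
  · exact (isClosed_le (continuous_id.dist continuous_const) continuous_const).measurableSet
  · exact (isClosed_le continuous_const (Metric.continuous_infDist_pt _)).measurableSet

theorem nearSet_subset : nearSet U e l x ⊆ U := fun _ h => h.1

/-- The radius is half of the distance from the frontier that an admissible point is guaranteed to
have; `scaleRatio` is chosen for this. The factor `3 * (d + 1)` leaves room for the enlarged cube on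
which rigidity is applied. -/
theorem Admissible.closedBall_subset (hz : Admissible U e l x z) (he : 0 < e) (he1 : e ≤ 1)
    (hl : 0 < l) {r : ℝ} (hr : r ≤ 3 * (d + 1) * (scaleRatio d e * l)) :
    Metric.closedBall z r ⊆ nearSet U e l x := by
  have hr' : r ≤ e ^ 3 / 32768 * l := by
    refine hr.trans (le_of_eq ?_)
    have := scaleRatio_mul d e
    calc _ = (6 * (d + 1) * scaleRatio d e) / 2 * l := by ring
      _ = _ := by rw [this]; ring
  have he3 : 0 < e ^ 3 := by positivity
  have hpos : 0 < e ^ 3 / 32768 * l := by positivity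
  have h2 : e ^ 3 / 16384 * l = 2 * (e ^ 3 / 32768 * l) := by ring
  have h3 := hz.le_infDist
  intro w hw
  have hwz : dist w z ≤ e ^ 3 / 32768 * l := (Metric.mem_closedBall.1 hw).trans hr'
  refine ⟨closedBall_subset_of_lt_infDist hz.mem (by linarith) (Metric.mem_closedBall.2 hwz), ?_, ?_⟩
  · have h5 : e ^ 3 / 32768 * l ≤ l / e := by
      have : e ^ 3 ≤ 1 := pow_le_one₀ he.le he1
      have : l ≤ l / e := by rw [le_div_iff₀ he]; nlinarith
      nlinarith
    have h6 : 25 * l / e = 24 * l / e + l / e := by ring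
    have := dist_triangle w z x
    have := hz.dist_le
    linarith
  · have := Metric.infDist_le_infDist_add_dist (s := frontier U) (x := z) (y := w)
    rw [dist_comm] at this
    linarith

/-- The `n`-th point of a dense sequence is a reflection of `y` at scale `l`. -/
def IsReflection (U : Set (Vec d)) (e l : ℝ) (y : Vec d) (n : ℕ) : Prop :=
  TopologicalSpace.denseSeq (Vec d) n ∈ U ∧ dist (TopologicalSpace.denseSeq (Vec d) n) y < 7 * l ∧
    e * l / 8 < Metric.infDist (TopologicalSpace.denseSeq (Vec d) n) (frontier U)

/-- The second alternative does not depend on `n`; it makes the search for the least index total and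
keeps the choice measurable. -/
theorem exists_reflectionIndex (U : Set (Vec d)) (e l : ℝ) (y : Vec d) :
    ∃ n, IsReflection U e l y n ∨ ¬ ∃ m, IsReflection U e l y m := by
  by_cases h : ∃ m, IsReflection U e l y m
  · obtain ⟨n, hn⟩ := h
    exact ⟨n, Or.inl hn⟩
  · exact ⟨0, Or.inr h⟩

open scoped Classical in
/-- A measurable choice of reflections at scale `l`. -/
noncomputable def reflection (U : Set (Vec d)) (e l : ℝ) (y : Vec d) : Vec d :=
  TopologicalSpace.denseSeq (Vec d) (Nat.find (exists_reflectionIndex U e l y))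

theorem measurable_reflection (U : Set (Vec d)) (e l : ℝ) : Measurable (reflection U e l) := by
  classical
  have h1 : ∀ n, MeasurableSet {y | IsReflection U e l y n} := fun n => by
    by_cases h : TopologicalSpace.denseSeq (Vec d) n ∈ U ∧
        e * l / 8 < Metric.infDist (TopologicalSpace.denseSeq (Vec d) n) (frontier U)
    · have : {y | IsReflection U e l y n} = {y | dist (TopologicalSpace.denseSeq (Vec d) n) y < 7 * l} := by
        ext y
        exact ⟨fun h => h.2.1, fun hy => ⟨h.1, hy, h.2⟩⟩
      rw [this]
      exact (isOpen_lt (by fun_prop) continuous_const).measurableSet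
    · have : {y | IsReflection U e l y n} = ∅ := by
        ext y
        exact ⟨fun hy => h ⟨hy.1, hy.2.2⟩, fun hy => hy.elim⟩
      rw [this]
      exact MeasurableSet.empty
  have h2 : MeasurableSet {y | ∃ m, IsReflection U e l y m} := by
    rw [ofPred_exists]
    exact MeasurableSet.iUnion h1
  exact Measurable.find (f := fun n _ => TopologicalSpace.denseSeq (Vec d) n)
    (p := fun n y => IsReflection U e l y n ∨ ¬ ∃ m, IsReflection U e l y m) (fun n => measurable_const) (fun n => (h1 n).union h2.compl) (exists_reflectionIndex U e l)

/-- The conditions on a reflection are open, so the dense sequence meets the nonempty set of good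
reflections. -/
theorem reflection_spec (hJ : IsJonesDomain U e δ) (hU : IsOpen U) (hne : U.Nonempty)
    (hcomp : ∀ x ∈ U, 2 * jonesRadius U δ ≤ Metric.diam (connectedComponentIn U x))
    (hl : 0 < l) (hlρ : l < jonesRadius U δ) (hy : Metric.infDist y U ≤ 5 * l) :
    reflection U e l y ∈ U ∧ dist (reflection U e l y) y < 7 * l ∧
      e * l / 8 < Metric.infDist (reflection U e l y) (frontier U) := by
  classical
  obtain ⟨z, hz1, hz2, hz3⟩ := hJ.exists_reflection hne hcomp hl hlρ hy
  have hopen : IsOpen {w | w ∈ U ∧ dist w y < 7 * l ∧ e * l / 8 < Metric.infDist w (frontier U)} :=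
    hU.inter ((isOpen_lt (continuous_id.dist continuous_const) continuous_const).inter
      (isOpen_lt continuous_const (Metric.continuous_infDist_pt _)))
  obtain ⟨n, hn⟩ := (TopologicalSpace.denseRange_denseSeq (Vec d)).exists_mem_open hopen ⟨z, hz1, hz2, hz3⟩
  rcases Nat.find_spec (exists_reflectionIndex U e l y) with h | h
  · exact h
  · exact absurd ⟨n, hn⟩ h

open scoped Classical in
/-- The rough extension at scale `l`: at `y` it is the value of the Taylor polynomial at the
reflected point. -/
noncomputable def rough (U : Set (Vec d)) (e l : ℝ) (f : Vec d → Vec d) (y : Vec d) : Vec d :=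
  if Metric.infDist y U ≤ 5 * l then taylor (scaleRatio d e * l) f (reflection U e l y) y else 0

theorem measurable_rough (he : 0 < e) (hl : 0 < l) (hf : LocallyIntegrable f) :
    Measurable (rough U e l f) := by
  classical
  have ht : 0 < scaleRatio d e * l := mul_pos (scaleRatio_pos d he) hl
  have hs := contDiff_mollify ht hf
  have hc : Continuous (fun p : Vec d × Vec d => taylor (scaleRatio d e * l) f p.1 p.2) := by
    unfold taylor
    refine (hs.continuous.comp continuous_fst).add ?_
    exact ((hs.continuous_fderiv (by simp)).comp continuous_fst).clm_apply
      (continuous_snd.sub continuous_fst)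
  have hp : Measurable (fun y : Vec d => (reflection U e l y, y)) :=
    (measurable_reflection U e l).prodMk measurable_id
  have h : Measurable (fun y => taylor (scaleRatio d e * l) f (reflection U e l y) y) :=
    (hc.measurable.comp hp :)
  have hs : MeasurableSet {y | Metric.infDist y U ≤ 5 * l} :=
    (isClosed_le (Metric.continuous_infDist_pt _) continuous_const).measurableSet
  unfold rough
  exact h.ite hs measurable_const

/-- The constant of the crude estimate. -/
noncomputable def crudeC (d : ℕ) (e : ℝ) : ℝ :=
  kernelC d * (scaleRatio d e ^ d)⁻¹ * (1 + (scaleRatio d e)⁻¹ * 7)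

theorem crudeC_pos (d : ℕ) (he : 0 < e) : 0 < crudeC d e := by
  have := kernelC_pos d
  have := scaleRatio_pos d he
  unfold crudeC; positivity

/-- The set `S` is kept free: the whole space gives local boundedness of the rough extension, and
`nearSet` gives the localized estimates. -/
theorem norm_rough_sub_const_le_of_subset (hJ : IsJonesDomain U e δ) (hU : IsOpen U) (hne : U.Nonempty)
    (hcomp : ∀ x ∈ U, 2 * jonesRadius U δ ≤ Metric.diam (connectedComponentIn U x))
    (hl : 0 < l) (hlρ : l < jonesRadius U δ) (hy : Metric.infDist y U ≤ 5 * l)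
    (hf : LocallyIntegrable f) (ξ : Vec d) {S : Set (Vec d)} (hfS : IntegrableOn (fun w => f w - ξ) S)
    (hS : Metric.closedBall (reflection U e l y) (scaleRatio d e * l / 2) ⊆ S) :
    ‖rough U e l f y - ξ‖ ≤ crudeC d e * (l ^ d)⁻¹ * ∫ w in S, ‖f w - ξ‖ := by
  have he := hJ.e_pos
  have hτ := scaleRatio_pos d he
  have hk := kernelC_pos d
  have ht : 0 < scaleRatio d e * l := mul_pos hτ hl
  have hsp := reflection_spec hJ hU hne hcomp hl hlρ hy
  rw [rough, if_pos hy]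
  refine (norm_taylor_sub_const_le hf ht _ _ _).trans ?_
  have hI : ∫ w in Metric.closedBall (reflection U e l y) (scaleRatio d e * l / 2), ‖f w - ξ‖ ≤
      ∫ w in S, ‖f w - ξ‖ :=
    setIntegral_mono_set hfS.norm (Filter.Eventually.of_forall fun _ => norm_nonneg _) hS.eventuallyLE
  have h0 : 0 ≤ ∫ w in S, ‖f w - ξ‖ := integral_nonneg fun _ => norm_nonneg _
  calc _ ≤ kernelC d * ((scaleRatio d e * l) ^ d)⁻¹ * (1 + (scaleRatio d e * l)⁻¹ * (7 * l)) *
        ∫ w in S, ‖f w - ξ‖ := by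
        gcongr
        rw [dist_comm]; exact hsp.2.1.le
    _ = _ := by
        rw [crudeC, mul_pow]; field_simp

theorem Admissible.of_reflection (hJ : IsJonesDomain U e δ) (hU : IsOpen U) (hne : U.Nonempty)
    (hcomp : ∀ x ∈ U, 2 * jonesRadius U δ ≤ Metric.diam (connectedComponentIn U x))
    (hl : 0 < l) (hlρ : l < jonesRadius U δ) (hx : Metric.infDist x U ≤ 4 * l)
    (hy : y ∈ Metric.closedBall x l) :
    Metric.infDist y U ≤ 5 * l ∧ Admissible U e l x (reflection U e l y) ∧
      dist (reflection U e l y) x ≤ 8 * l := by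
  have he := hJ.e_pos
  have h5 : Metric.infDist y U ≤ 5 * l := by
    have := Metric.infDist_le_infDist_add_dist (s := U) (x := y) (y := x)
    rw [Metric.mem_closedBall] at hy
    linarith
  have hsp := reflection_spec hJ hU hne hcomp hl hlρ h5
  have h8 : dist (reflection U e l y) x ≤ 8 * l := by
    have := dist_triangle (reflection U e l y) y x
    rw [Metric.mem_closedBall] at hy
    linarith [hsp.2.1]
  refine ⟨h5, Admissible.of_near he hJ.e_le_one hl hsp.1 h8 ?_, h8⟩
  have : 0 < e * l := mul_pos he hl
  linarith [hsp.2.2]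

theorem norm_rough_sub_const_le (hJ : IsJonesDomain U e δ) (hU : IsOpen U) (hne : U.Nonempty)
    (hcomp : ∀ x ∈ U, 2 * jonesRadius U δ ≤ Metric.diam (connectedComponentIn U x))
    (hl : 0 < l) (hlρ : l < jonesRadius U δ) (hx : Metric.infDist x U ≤ 4 * l)
    (hy : y ∈ Metric.closedBall x l) (hf : LocallyIntegrable f) (ξ : Vec d)
    (hfS : IntegrableOn (fun w => f w - ξ) (nearSet U e l x)) :
    ‖rough U e l f y - ξ‖ ≤ crudeC d e * (l ^ d)⁻¹ * ∫ w in nearSet U e l x, ‖f w - ξ‖ := by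
  obtain ⟨h5, ha, -⟩ := Admissible.of_reflection hJ hU hne hcomp hl hlρ hx hy
  refine norm_rough_sub_const_le_of_subset hJ hU hne hcomp hl hlρ h5 hf ξ hfS ?_
  refine ha.closedBall_subset hJ.e_pos hJ.e_le_one hl ?_
  have := mul_pos (scaleRatio_pos d hJ.e_pos) hl
  have hd : (0 : ℝ) ≤ d := Nat.cast_nonneg d
  nlinarith [mul_nonneg hd this.le]

/-- The constant of the oscillation estimate for rough extensions. -/
noncomputable def roughC (d : ℕ) (e : ℝ) : ℝ :=
  (16 / (e * scaleRatio d e) + 2) * (gradC d * (51 / e)) + 2 * gradC d * (supC d + 25 / e) +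
    gradC d * (25 / e)

theorem roughC_pos (d : ℕ) (he : 0 < e) : 0 < roughC d e := by
  have := gradC_pos d
  have := scaleRatio_pos d he
  have := supC_nonneg d
  unfold roughC; positivity

/-- The core of the construction. All reflections of points near `x`, at scales `l` and `l / 2`, are
linked to the reflection of `x` by chains inside the admissible set, so one affine map approximates
both rough extensions. That the two scales share the same map is what makes the gluing harmless. -/
theorem exists_affine_approx (hJ : IsJonesDomain U e δ) (hU : IsOpen U) (hne : U.Nonempty)
    (hcomp : ∀ x ∈ U, 2 * jonesRadius U δ ≤ Metric.diam (connectedComponentIn U x))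
    (hg : IsWeakGradient U u g) (hui : IntegrableOn u U) (hgi : IntegrableOn g U)
    (hl : 0 < l) (hlρ : 16 * l < jonesRadius U δ) (hx : Metric.infDist x U ≤ 4 * l)
    (hosc : ∀ z, Admissible U e l x z → OscAt g 𝒜 (scaleRatio d e * l) z β) :
    ∃ (a : Vec d) (M : Mat d), Metric.infDist M 𝒜 ≤ β ∧
      (∀ y ∈ Metric.closedBall x l,
        ‖rough U e l (U.indicator u) y - (a + ofMat M (y - x))‖ ≤ roughC d e * l * β) ∧
      (Metric.infDist x U ≤ 2 * l → ∀ y ∈ Metric.closedBall x (l / 2),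
        ‖rough U e (l / 2) (U.indicator u) y - (a + ofMat M (y - x))‖ ≤ roughC d e * l * β) := by
  have he := hJ.e_pos
  have he1 := hJ.e_le_one
  have hUm := hU.measurableSet
  have hlρ1 : l < jonesRadius U δ := by linarith
  have hlδ : 16 * l < δ := hlρ.trans_le (min_le_right _ _)
  have hτ := scaleRatio_pos d he
  have hgC := gradC_pos d
  have hsC := supC_nonneg d
  set t := scaleRatio d e * l with ht_def
  have ht : 0 < t := mul_pos hτ hl
  have hle : l ≤ l / e := by rw [le_div_iff₀ he]; nlinarith
  have htl : t ≤ l / e := by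
    refine le_trans ?_ hle
    have h1 := scaleRatio_le d he
    have h2 : e ^ 3 ≤ 1 := pow_le_one₀ he.le he1
    have h3 : scaleRatio d e ≤ 1 := by linarith
    nlinarith
  have hball : ∀ z, Admissible U e l x z → Metric.closedBall z (2 * t) ⊆ U := fun z hz =>
    (hz.closedBall_subset he he1 hl (by
      have hd : (0 : ℝ) ≤ d := Nat.cast_nonneg d
      nlinarith [mul_nonneg hd ht.le])).trans nearSet_subset
  have hdist : ∀ z, Admissible U e l x z → ∀ y ∈ Metric.closedBall x l, dist y z ≤ 25 * l / e := by
    intro z hz y hy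
    have h1 := hz.dist_le
    have h2 := dist_triangle_right y z x
    rw [Metric.mem_closedBall] at hy
    have h3 : 25 * l / e = 24 * l / e + l / e := by ring
    linarith
  have hxm := Metric.mem_closedBall_self (x := x) hl.le
  obtain ⟨-, ha0, hd0⟩ := Admissible.of_reflection hJ hU hne hcomp hl hlρ1 hx hxm
  have hn0 := (reflection_spec hJ hU hne hcomp hl hlρ1 (hx.trans (by linarith) : _ ≤ 5 * l)).2.2
  set z0 := reflection U e l x with hz0
  have hβ : 0 ≤ β := (hosc z0 ha0).nonneg
  have hel : 0 < e * l := mul_pos he hl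
  -- The slope of the affine map is the matrix belonging to the reflection of `x`; the matrices at
  -- other points are used only to compare neighbours.
  obtain ⟨M, hM, hMA⟩ := hosc z0 ha0
  -- comparison of the Taylor polynomials at different points
  have hchain : ∀ z ∈ U, dist z x ≤ 8 * l → e * l / 16 ≤ Metric.infDist z (frontier U) →
      ∀ y ∈ Metric.closedBall x l, ‖taylor t (U.indicator u) z y - taylor t (U.indicator u) z0 y‖ ≤
        (16 / (e * scaleRatio d e) + 2) * (gradC d * (51 / e)) * l * β := by
    intro z hz h8 h16 y hy
    have := hJ.norm_sub_le_of_step (f := fun z => taylor t (U.indicator u) z y)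
      -- Both distances to `y` are at most `25 * l / e`, and the step `t` is at most `l / e`.
      (D := gradC d * β * (51 * l / e)) hl hlδ ht hz h8 h16 ha0.mem hd0 (by linarith)
      (fun w w' hw hw' hww => by
        refine (norm_taylor_sub_taylor_le hUm hg hui hgi ht (hball w hw) (hosc w hw) hww y).trans ?_
        gcongr
        have h1 := hdist w hw y hy
        have h2 := hdist w' hw' y hy
        have h3 : 51 * l / e = 25 * l / e + 25 * l / e + l / e := by ring
        linarith)
    refine this.trans (le_of_eq ?_)
    rw [ht_def]
    field_simp
  have hmain : ∀ y ∈ Metric.closedBall x l, ‖taylor t (U.indicator u) z0 y -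
      (mollify t (U.indicator u) z0 + ofMat M (x - z0) + ofMat M (y - x))‖ ≤
        gradC d * (25 / e) * l * β := by
    intro y hy
    have := norm_taylor_sub_affine_le hUm hg hui hgi ht (hball z0 ha0) hM y
    rw [add_assoc, ← map_add, show x - z0 + (y - x) = y - z0 by abel]
    refine this.trans ?_
    calc gradC d * β * dist y z0 ≤ gradC d * β * (25 * l / e) := by
          gcongr; exact hdist z0 ha0 y hy
      _ = _ := by ring
  have hD : 0 ≤ 2 * gradC d * (supC d + 25 / e) * l * β := by positivity
  refine ⟨mollify t (U.indicator u) z0 + ofMat M (x - z0), M, hMA, ?_, ?_⟩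
  · intro y hy
    obtain ⟨h5, ha, h8⟩ := Admissible.of_reflection hJ hU hne hcomp hl hlρ1 hx hy
    have hsp := reflection_spec hJ hU hne hcomp hl hlρ1 h5
    have h1 := hchain _ ha.mem h8 (by linarith [hsp.2.2]) y hy
    have h2 := hmain y hy
    rw [rough, if_pos h5]
    refine (norm_sub_le_norm_sub_add_norm_sub _ (taylor t (U.indicator u) z0 y) _).trans ?_
    refine (add_le_add h1 h2).trans ?_
    unfold roughC
    linarith
  · intro hx2 y hy
    have hl2 : 0 < l / 2 := by linarith
    have hyl : y ∈ Metric.closedBall x l := Metric.closedBall_subset_closedBall (by linarith) hy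
    obtain ⟨h5, ha', h8'⟩ := Admissible.of_reflection hJ hU hne hcomp hl2 (by linarith)
      (by linarith : Metric.infDist x U ≤ 4 * (l / 2)) hy
    have hsp := reflection_spec hJ hU hne hcomp hl2 (by linarith) h5
    set z := reflection U e (l / 2) y
    have h8 : dist z x ≤ 8 * l := by linarith
    have h16 : e * l / 16 ≤ Metric.infDist z (frontier U) := by linarith [hsp.2.2]
    have ha : Admissible U e l x z := Admissible.of_near he he1 hl ha'.mem h8 h16
    have h1 := hchain z ha.mem h8 h16 y hyl
    have h2 := hmain y hyl
    -- At scale `l / 2` the reflected point and the mollification both change: first the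
    -- mollification scale is restored at the same point, then the chain leads to `z0`.
    have h3 := norm_taylor_sub_taylor_half_le hUm hg hui hgi ht (hball z ha) (hosc z ha) y
    have h3' : ‖taylor (t / 2) (U.indicator u) z y - taylor t (U.indicator u) z y‖ ≤
        2 * gradC d * (supC d + 25 / e) * l * β := by
      refine h3.trans ?_
      have htl' : t ≤ l := by
        have h1 := scaleRatio_le d he
        have h2 : e ^ 3 ≤ 1 := pow_le_one₀ he.le he1
        have h3 : scaleRatio d e ≤ 1 := by linarith
        nlinarith
      calc 2 * gradC d * β * (supC d * t + dist y z) ≤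
            2 * gradC d * β * (supC d * l + 25 * l / e) := by
            gcongr; exact hdist z ha y hyl
        _ = _ := by ring
    rw [rough, if_pos h5, show scaleRatio d e * (l / 2) = t / 2 by rw [ht_def]; ring]
    refine (norm_sub_le_norm_sub_add_norm_sub _ (taylor t (U.indicator u) z y) _).trans ?_
    refine (add_le_add h3' ((norm_sub_le_norm_sub_add_norm_sub _ (taylor t (U.indicator u) z0 y) _).trans
      (add_le_add h1 h2))).trans (le_of_eq ?_)
    unfold roughC
    ring

end rough

section

open Filter Topology

/-! ### The extension -/

/-- The standing assumptions on the domain. -/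
structure IsExtensionDomain {d : ℕ} (U : Set (Vec d)) (e δ : ℝ) : Prop where
  isOpen : IsOpen U
  isBounded : Bornology.IsBounded U
  nonempty : U.Nonempty
  jones : IsJonesDomain U e δ
  le_diam : ∀ x ∈ U, 2 * jonesRadius U δ ≤ Metric.diam (connectedComponentIn U x)
  radius_pos : 0 < jonesRadius U δ

/-- The `n`-th scale of the extension. -/
noncomputable def scl {d : ℕ} (U : Set (Vec d)) (δ : ℝ) (n : ℕ) : ℝ := jonesRadius U δ / 32 / 2 ^ n

section ext

variable {d : ℕ} {U : Set (Vec d)} {e δ : ℝ} {f f' u : Vec d → Vec d} {g : Vec d → Mat d}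
  {𝒜 : Set (Mat d)} {x : Vec d} {n m N : ℕ} {β : ℝ}

/-- The mollified rough extension at the `n`-th scale. -/
noncomputable def scaleExt (U : Set (Vec d)) (e δ : ℝ) (n : ℕ) (f : Vec d → Vec d) : Vec d → Vec d :=
  mollify (scl U δ n) (rough U e (scl U δ n) f)

/-- The smooth cutoff to a neighbourhood of `U` of the `n`-th scale. -/
noncomputable def cutoff (U : Set (Vec d)) (δ : ℝ) (n : ℕ) : Vec d → ℝ :=
  mollify (scl U δ n) ({y | Metric.infDist y U < 3 * scl U δ n}.indicator fun _ => (1 : ℝ))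

/-- The approximation of the extension that uses the scales up to `N`. -/
noncomputable def approxExt (U : Set (Vec d)) (e δ : ℝ) (N : ℕ) (f : Vec d → Vec d) (x : Vec d) : Vec d :=
  cutoff U δ 0 x • scaleExt U e δ 0 f x +
    ∑ n ∈ Finset.range N, cutoff U δ (n + 1) x • (scaleExt U e δ (n + 1) f x - scaleExt U e δ n f x)

open scoped Classical in
/-- The number of scales needed at an exterior point. -/
noncomputable def scaleIndex (U : Set (Vec d)) (δ : ℝ) (x : Vec d) : ℕ :=
  if h : ∃ n, 7 / 4 * scl U δ n < Metric.infDist x U then Nat.find h else 0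

open scoped Classical in
/-- The extension of `f`. -/
noncomputable def extFn (U : Set (Vec d)) (e δ : ℝ) (f : Vec d → Vec d) (x : Vec d) : Vec d :=
  if x ∈ U then f x else if Metric.infDist x U = 0 then 0 else
    approxExt U e δ (scaleIndex U δ x) (U.indicator f) x

open scoped Classical in
/-- The gradient of the extension of `f`, where `g` is the gradient of `f`. -/
noncomputable def extGrad (U : Set (Vec d)) (e δ : ℝ) (f : Vec d → Vec d) (g : Vec d → Mat d)
    (x : Vec d) : Mat d :=
  if x ∈ U then g x else if Metric.infDist x U = 0 then 0 else
    toMat (fderiv ℝ (approxExt U e δ (scaleIndex U δ x) (U.indicator f)) x)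

theorem scl_succ : scl U δ (n + 1) = scl U δ n / 2 := by
  unfold scl; rw [pow_succ]; field_simp

namespace IsExtensionDomain

theorem scl_pos (hU : IsExtensionDomain U e δ) (n : ℕ) : 0 < scl U δ n := by
  have := hU.radius_pos
  unfold scl; positivity

theorem scl_antitone (hU : IsExtensionDomain U e δ) (h : n ≤ m) : scl U δ m ≤ scl U δ n := by
  have := hU.radius_pos
  unfold scl
  gcongr
  norm_num

theorem scl_zero_eq : scl U δ 0 = jonesRadius U δ / 32 := by simp [scl]

theorem scl_lt (hU : IsExtensionDomain U e δ) (n : ℕ) : 16 * scl U δ n < jonesRadius U δ := by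
  have h := hU.scl_antitone (Nat.zero_le n)
  rw [scl_zero_eq] at h
  linarith [hU.radius_pos]

theorem scl_lt' (hU : IsExtensionDomain U e δ) (n : ℕ) : scl U δ n < jonesRadius U δ := by
  linarith [hU.scl_lt n, hU.scl_pos n]

theorem tendsto_scl : Tendsto (scl U δ) atTop (𝓝 0) := by
  have : scl U δ = fun n => jonesRadius U δ / 32 * (1 / 2) ^ n := by
    ext n; simp [scl, div_eq_mul_inv]
  rw [this]
  have := (tendsto_pow_atTop_nhds_zero_of_lt_one (r := (1 / 2 : ℝ)) (by norm_num) (by norm_num)).const_mul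
    (jonesRadius U δ / 32)
  simpa using this

theorem norm_rough_le (hU : IsExtensionDomain U e δ) (hf : Integrable f) (n : ℕ) (y : Vec d) :
    ‖rough U e (scl U δ n) f y‖ ≤ crudeC d e * (scl U δ n ^ d)⁻¹ * ∫ w, ‖f w‖ := by
  by_cases h : Metric.infDist y U ≤ 5 * scl U δ n
  · have := norm_rough_sub_const_le_of_subset hU.jones hU.isOpen hU.nonempty hU.le_diam (hU.scl_pos n)
      (hU.scl_lt' n) h hf.locallyIntegrable 0 (S := univ) (by simpa using hf) (subset_univ _)
    simpa using this
  · have h1 := crudeC_pos d hU.jones.e_pos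
    have h2 := hU.scl_pos n
    have h3 : 0 ≤ ∫ w, ‖f w‖ := integral_nonneg fun _ => norm_nonneg _
    rw [rough, if_neg h, norm_zero]
    positivity

theorem locallyIntegrable_rough (hU : IsExtensionDomain U e δ) (hf : Integrable f) (n : ℕ) :
    LocallyIntegrable (rough U e (scl U δ n) f) :=
  (locallyIntegrable_const (crudeC d e * (scl U δ n ^ d)⁻¹ * ∫ w, ‖f w‖)).mono
    (measurable_rough hU.jones.e_pos (hU.scl_pos n) hf.locallyIntegrable).aestronglyMeasurable
    (Eventually.of_forall fun y => (hU.norm_rough_le hf n y).trans (le_abs_self _))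

theorem contDiff_scaleExt (hU : IsExtensionDomain U e δ) (hf : Integrable f) (n : ℕ) :
    ContDiff ℝ ∞ (scaleExt U e δ n f) :=
  contDiff_mollify (hU.scl_pos n) (hU.locallyIntegrable_rough hf n)

theorem locallyIntegrable_cutoff_indicator (a : ℝ) :
    LocallyIntegrable ({y | Metric.infDist y U < a}.indicator fun _ => (1 : ℝ)) := by
  have hm : MeasurableSet {y | Metric.infDist y U < a} :=
    (isOpen_lt (Metric.continuous_infDist_pt _) continuous_const).measurableSet
  refine (locallyIntegrable_const (1 : ℝ)).mono (measurable_const.indicator hm).aestronglyMeasurable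
    (Eventually.of_forall fun y => ?_)
  exact norm_indicator_le_norm_self _ _

theorem contDiff_cutoff (hU : IsExtensionDomain U e δ) (n : ℕ) : ContDiff ℝ ∞ (cutoff U δ n) :=
  contDiff_mollify (hU.scl_pos n) (locallyIntegrable_cutoff_indicator _)

theorem norm_cutoff_le (hU : IsExtensionDomain U e δ) (n : ℕ) (x : Vec d) :
    ‖cutoff U δ n x‖ ≤ supC d ∧ ‖fderiv ℝ (cutoff U δ n) x‖ ≤ supC d * (1 / scl U δ n) := by
  have hb : ∀ y ∈ Metric.closedBall x (scl U δ n),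
      ‖{y | Metric.infDist y U < 3 * scl U δ n}.indicator (fun _ => (1 : ℝ)) y‖ ≤ 1 := fun y _ =>
    (norm_indicator_le_norm_self _ _).trans (by simp)
  constructor
  · have := norm_mollify_le_of_bound (hU.scl_pos n) (locallyIntegrable_cutoff_indicator _) hb
    rwa [mul_one] at this
  · exact norm_fderiv_mollify_le_of_bound (hU.scl_pos n) (locallyIntegrable_cutoff_indicator _) hb

/-- The indicator switches at distance `3 * l` and the kernel has radius `l / 2`, so the transition
of the cutoff takes place between `5 / 2 * l` and `7 / 2 * l`. -/
theorem cutoff_eq_one (hU : IsExtensionDomain U e δ) (hx : Metric.infDist x U < 5 / 2 * scl U δ n) :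
    cutoff U δ n x = 1 := by
  have h : cutoff U δ n x = mollify (scl U δ n) (fun _ => (1 : ℝ)) x := by
    refine mollify_congr (hU.scl_pos n) fun y hy => ?_
    rw [Metric.mem_closedBall] at hy
    have := Metric.infDist_le_infDist_add_dist (s := U) (x := y) (y := x)
    rw [indicator_of_mem]
    simp only [mem_ofPred_eq]
    linarith
  rw [h, mollify_const (hU.scl_pos n)]

theorem cutoff_eq_zero (hU : IsExtensionDomain U e δ) (hx : 7 / 2 * scl U δ n < Metric.infDist x U) :
    cutoff U δ n x = 0 := by
  have h : cutoff U δ n x = mollify (scl U δ n) (fun _ => (0 : ℝ)) x := by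
    refine mollify_congr (hU.scl_pos n) fun y hy => ?_
    rw [Metric.mem_closedBall] at hy
    have := Metric.infDist_le_infDist_add_dist (s := U) (x := x) (y := y)
    rw [dist_comm] at this
    rw [indicator_of_notMem]
    simp only [mem_ofPred_eq]
    linarith
  rw [h, mollify_const (hU.scl_pos n)]

theorem contDiff_approxExt (hU : IsExtensionDomain U e δ) (hf : Integrable f) (N : ℕ) :
    ContDiff ℝ ∞ (approxExt U e δ N f) := by
  unfold approxExt
  refine ((hU.contDiff_cutoff 0).smul (hU.contDiff_scaleExt hf 0)).add ?_
  refine ContDiff.sum fun n _ => ?_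
  exact (hU.contDiff_cutoff _).smul ((hU.contDiff_scaleExt hf _).sub (hU.contDiff_scaleExt hf _))

/-- All cutoffs up to index `N` equal one here, and the sum telescopes. -/
theorem approxExt_eq_scaleExt (hU : IsExtensionDomain U e δ)
    (hx : Metric.infDist x U < 5 / 2 * scl U δ N) : approxExt U e δ N f x = scaleExt U e δ N f x := by
  have h1 : ∀ n ≤ N, cutoff U δ n x = 1 := fun n hn =>
    hU.cutoff_eq_one (hx.trans_le (by linarith [hU.scl_antitone hn]))
  rw [approxExt, h1 0 (Nat.zero_le _), one_smul, Finset.sum_congr rfl fun n hn => by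
    rw [h1 (n + 1) (Finset.mem_range.1 hn), one_smul], Finset.sum_range_sub (fun n => scaleExt U e δ n f x)]
  abel

/-- Every later cutoff vanishes, since `7 / 2 * scl U δ (N + 1) = 7 / 4 * scl U δ N`. -/
theorem approxExt_eq_of_le (hU : IsExtensionDomain U e δ)
    (hx : 7 / 4 * scl U δ N < Metric.infDist x U) (hm : N ≤ m) :
    approxExt U e δ m f x = approxExt U e δ N f x := by
  obtain ⟨k, rfl⟩ := Nat.exists_eq_add_of_le hm
  rw [approxExt, approxExt, Finset.sum_range_add, ← add_assoc]
  rw [Finset.sum_eq_zero (s := Finset.range k), add_zero]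
  intro n _
  rw [hU.cutoff_eq_zero, zero_smul]
  refine lt_of_le_of_lt ?_ hx
  have := hU.scl_antitone (Nat.le_add_right N n)
  rw [scl_succ]
  linarith

theorem approxExt_eq_zero (hU : IsExtensionDomain U e δ)
    (hx : 7 / 2 * scl U δ 0 < Metric.infDist x U) (m : ℕ) : approxExt U e δ m f x = 0 := by
  rw [hU.approxExt_eq_of_le (by linarith [hU.scl_pos 0]) (Nat.zero_le m), approxExt,
    hU.cutoff_eq_zero hx]
  simp

theorem approxExt_succ_eq (hU : IsExtensionDomain U e δ)
    (hx : Metric.infDist x U < 5 / 2 * scl U δ n) :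
    approxExt U e δ (n + 1) f x =
      scaleExt U e δ n f x + cutoff U δ (n + 1) x • (scaleExt U e δ (n + 1) f x - scaleExt U e δ n f x) := by
  have h := hU.approxExt_eq_scaleExt (f := f) hx
  rw [approxExt] at h
  rw [approxExt, Finset.sum_range_succ, ← add_assoc, h]

theorem eventually_infDist_lt {a : ℝ} (hx : Metric.infDist x U < a) :
    ∀ᶠ y in 𝓝 x, Metric.infDist y U < a :=
  (isOpen_lt (Metric.continuous_infDist_pt _) continuous_const).mem_nhds hx

theorem eventually_lt_infDist {a : ℝ} (hx : a < Metric.infDist x U) :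
    ∀ᶠ y in 𝓝 x, a < Metric.infDist y U :=
  (isOpen_lt continuous_const (Metric.continuous_infDist_pt _)).mem_nhds hx

/-- The index `scaleIndex` may be replaced by any admissible `N`, which is then constant near `x`;
this justifies differentiating the extension at exterior points. -/
theorem extFn_eq (hU : IsExtensionDomain U e δ) (hx : 7 / 4 * scl U δ N < Metric.infDist x U) :
    extFn U e δ f x = approxExt U e δ N (U.indicator f) x ∧
      extGrad U e δ f g x = toMat (fderiv ℝ (approxExt U e δ N (U.indicator f)) x) := by
  have h0 : 0 < Metric.infDist x U := lt_trans (by linarith [hU.scl_pos N]) hx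
  have hxU : x ∉ U := fun h => by
    rw [Metric.infDist_zero_of_mem h] at h0; exact lt_irrefl _ h0
  have hex : ∃ n, 7 / 4 * scl U δ n < Metric.infDist x U := ⟨N, hx⟩
  classical
  have hidx : scaleIndex U δ x = Nat.find hex := dif_pos hex
  have hle : scaleIndex U δ x ≤ N := by rw [hidx]; exact Nat.find_min' hex hx
  have hsp : 7 / 4 * scl U δ (scaleIndex U δ x) < Metric.infDist x U := by
    rw [hidx]; exact Nat.find_spec hex
  constructor
  · rw [extFn, if_neg hxU, if_neg h0.ne', hU.approxExt_eq_of_le hsp hle]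
  · rw [extGrad, if_neg hxU, if_neg h0.ne']
    congr 1
    refine EventuallyEq.fderiv_eq ?_
    filter_upwards [eventually_lt_infDist hsp] with y hy
    rw [hU.approxExt_eq_of_le hy hle]

theorem extFn_of_mem (hx : x ∈ U) : extFn U e δ f x = f x := if_pos hx

theorem extGrad_of_mem (hx : x ∈ U) : extGrad U e δ f g x = g x := if_pos hx

/-! #### Pointwise estimates at a fixed scale -/

theorem infDist_add_le {M M' : Mat d} {s : ℝ} (h : Metric.infDist M 𝒜 ≤ β) (hM : ‖M' - M‖ ≤ s) :
    Metric.infDist M' 𝒜 ≤ β + s := by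
  have := Metric.infDist_le_infDist_add_dist (s := 𝒜) (x := M') (y := M)
  rw [dist_eq_norm] at this
  linarith

theorem norm_scaleExt_sub_const_le (hU : IsExtensionDomain U e δ) (hf : Integrable f)
    (hx : Metric.infDist x U ≤ 4 * scl U δ n) (ξ : Vec d)
    (hfS : IntegrableOn (fun w => f w - ξ) (nearSet U e (scl U δ n) x)) :
    ‖scaleExt U e δ n f x - ξ‖ ≤
        supC d * (crudeC d e * (scl U δ n ^ d)⁻¹ * ∫ w in nearSet U e (scl U δ n) x, ‖f w - ξ‖) ∧
      ‖fderiv ℝ (scaleExt U e δ n f) x‖ ≤ supC d * (crudeC d e * (scl U δ n ^ d)⁻¹ *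
        (∫ w in nearSet U e (scl U δ n) x, ‖f w - ξ‖) / scl U δ n) := by
  have := norm_mollify_sub_affine_le (x := x) (z := x) (a := ξ) (L := (0 : Vec d →L[ℝ] Vec d))
    (hU.scl_pos n) (hU.locallyIntegrable_rough hf n) (s := crudeC d e * (scl U δ n ^ d)⁻¹ *
      ∫ w in nearSet U e (scl U δ n) x, ‖f w - ξ‖) fun y hy => by
      simpa using norm_rough_sub_const_le hU.jones hU.isOpen hU.nonempty hU.le_diam (hU.scl_pos n)
        (hU.scl_lt' n) hx hy hf.locallyIntegrable ξ hfS
  simpa [scaleExt] using this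

/-- Mollifying the affine approximation gives the same matrix at two consecutive scales. The factor
`2` in the finer gradient comes from dividing an error of size `l` by the scale `l / 2`. -/
theorem exists_gradient_approx (hU : IsExtensionDomain U e δ) (hg : IsWeakGradient U u g)
    (hui : IntegrableOn u U) (hgi : IntegrableOn g U)
    (hx : Metric.infDist x U ≤ 4 * scl U δ n)
    (hosc : ∀ z, Admissible U e (scl U δ n) x z → OscAt g 𝒜 (scaleRatio d e * scl U δ n) z β) :
    ∃ M : Mat d, Metric.infDist M 𝒜 ≤ β ∧
      ‖fderiv ℝ (scaleExt U e δ n (U.indicator u)) x - ofMat M‖ ≤ supC d * (roughC d e * β) ∧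
      (Metric.infDist x U ≤ 2 * scl U δ n →
        ‖fderiv ℝ (scaleExt U e δ (n + 1) (U.indicator u)) x - ofMat M‖ ≤
            2 * (supC d * (roughC d e * β)) ∧
          ‖scaleExt U e δ (n + 1) (U.indicator u) x - scaleExt U e δ n (U.indicator u) x‖ ≤
            2 * (supC d * (roughC d e * scl U δ n * β))) := by
  have hl := hU.scl_pos n
  have hint : Integrable (U.indicator u) := hui.integrable_indicator hU.isOpen.measurableSet
  obtain ⟨a, M, hMA, h1, h2⟩ := exists_affine_approx hU.jones hU.isOpen hU.nonempty hU.le_diam hg hui hgi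
    hl (hU.scl_lt n) hx hosc
  have k1 := norm_mollify_sub_affine_le hl (hU.locallyIntegrable_rough hint n) h1
  refine ⟨M, hMA, k1.2.trans (le_of_eq ?_), fun hx2 => ?_⟩
  · field_simp
  have hl2 := hU.scl_pos (n + 1)
  have h2' := h2 hx2
  rw [← scl_succ] at h2'
  have k2 := norm_mollify_sub_affine_le hl2 (hU.locallyIntegrable_rough hint (n + 1)) h2'
  refine ⟨k2.2.trans (le_of_eq ?_), ?_⟩
  · rw [scl_succ]; field_simp
  · have := norm_sub_le_norm_sub_add_norm_sub (scaleExt U e δ (n + 1) (U.indicator u) x)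
      (a + ofMat M (x - x)) (scaleExt U e δ n (U.indicator u) x)
    refine this.trans ?_
    rw [norm_sub_rev (a + ofMat M (x - x))]
    refine (add_le_add k2.1 k1.1).trans (le_of_eq ?_)
    ring

/-- Constant of the gradient estimate for the extension. -/
noncomputable def _root_.extGradC (d : ℕ) (e : ℝ) : ℝ :=
  1 + matC d * ((1 + 7 * supC d) * (supC d * roughC d e))

/-- Constant of the estimates for the lower order terms. -/
noncomputable def _root_.extLowC (d : ℕ) (e : ℝ) : ℝ :=
  matC d * ((1 + 2 * supC d) * (supC d * crudeC d e))

theorem infDist_fderiv_scaleExt_le (hU : IsExtensionDomain U e δ) (hg : IsWeakGradient U u g)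
    (hui : IntegrableOn u U) (hgi : IntegrableOn g U) (hβ : 0 ≤ β)
    (hx : Metric.infDist x U ≤ 4 * scl U δ n)
    (hosc : ∀ z, Admissible U e (scl U δ n) x z → OscAt g 𝒜 (scaleRatio d e * scl U δ n) z β) :
    Metric.infDist (toMat (fderiv ℝ (scaleExt U e δ n (U.indicator u)) x)) 𝒜 ≤ extGradC d e * β := by
  obtain ⟨M, hMA, h1, -⟩ := hU.exists_gradient_approx hg hui hgi hx hosc
  have hm := one_le_matC d
  have hs := supC_nonneg d
  have hr := roughC_pos d hU.jones.e_pos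
  have h2 : ‖toMat (fderiv ℝ (scaleExt U e δ n (U.indicator u)) x) - M‖ ≤
      matC d * (supC d * (roughC d e * β)) := by
    rw [← toMat_ofMat M, ← map_sub]
    exact (norm_toMat_le _).trans (by gcongr)
  refine (infDist_add_le hMA h2).trans ?_
  have : 0 ≤ matC d * (supC d * (supC d * roughC d e)) * β := by positivity
  unfold extGradC
  linarith

/-- The gradient of the extension in the region where two consecutive scales are active. -/
theorem infDist_extGrad_le (hU : IsExtensionDomain U e δ) (hg : IsWeakGradient U u g)
    (hui : IntegrableOn u U) (hgi : IntegrableOn g U) (hβ : 0 ≤ β)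
    (hx1 : scl U δ n < Metric.infDist x U) (hx2 : Metric.infDist x U ≤ 2 * scl U δ n)
    (hosc : ∀ z, Admissible U e (scl U δ n) x z → OscAt g 𝒜 (scaleRatio d e * scl U δ n) z β) :
    Metric.infDist (extGrad U e δ u g x) 𝒜 ≤ extGradC d e * β := by
  have hl := hU.scl_pos n
  have hint : Integrable (U.indicator u) := hui.integrable_indicator hU.isOpen.measurableSet
  obtain ⟨M, hMA, h1, h2⟩ := hU.exists_gradient_approx hg hui hgi (by linarith) hosc
  obtain ⟨h2, h3⟩ := h2 hx2
  rw [(hU.extFn_eq (N := n + 1) (by rw [scl_succ]; linarith)).2]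
  -- At a distance between `l n` and `2 * l n`, only the scales `n` and `n + 1` are present.
  have hev : approxExt U e δ (n + 1) (U.indicator u) =ᶠ[𝓝 x] fun y =>
      scaleExt U e δ n (U.indicator u) y + cutoff U δ (n + 1) y •
        (scaleExt U e δ (n + 1) (U.indicator u) y - scaleExt U e δ n (U.indicator u) y) := by
    filter_upwards [eventually_infDist_lt (by linarith : Metric.infDist x U < 5 / 2 * scl U δ n)] with y hy
    exact hU.approxExt_succ_eq hy
  rw [hev.fderiv_eq]
  have dW : ∀ m, HasFDerivAt (scaleExt U e δ m (U.indicator u))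
      (fderiv ℝ (scaleExt U e δ m (U.indicator u)) x) x := fun m =>
    ((hU.contDiff_scaleExt hint m).differentiable (by simp) x).hasFDerivAt
  have dC : HasFDerivAt (cutoff U δ (n + 1)) (fderiv ℝ (cutoff U δ (n + 1)) x) x :=
    ((hU.contDiff_cutoff (n + 1)).differentiable (by simp) x).hasFDerivAt
  have hd := (dW n).add (dC.smul ((dW (n + 1)).sub (dW n)))
  have hd' := hd.fderiv
  simp only [Pi.add_def, Pi.sub_apply, Pi.smul_def'] at hd'
  rw [hd']
  obtain ⟨hc1, hc2⟩ := hU.norm_cutoff_le (n + 1) x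
  have hm := one_le_matC d
  have hs := supC_nonneg d
  have hr := roughC_pos d hU.jones.e_pos
  have hl1 := hU.scl_pos (n + 1)
  set W := fun m => fderiv ℝ (scaleExt U e δ m (U.indicator u)) x
  set w := fun m => scaleExt U e δ m (U.indicator u) x
  set K := supC d * (roughC d e * β) with hK
  have hK0 : 0 ≤ K := by positivity
  set X := W n + (cutoff U δ (n + 1) x • (W (n + 1) - W n) +
    (fderiv ℝ (cutoff U δ (n + 1)) x).smulRight (w (n + 1) - w n)) with hX
  -- The difference of the gradients contributes `3 * K`. The derivative of the cutoff, of order `2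
  -- / l n`, meets a difference of values of order `2 * l n * β` and contributes `4 * K`.
  have hXM : ‖X - ofMat M‖ ≤ (1 + 7 * supC d) * K := by
    have e1 : X - ofMat M = (W n - ofMat M) + (cutoff U δ (n + 1) x • ((W (n + 1) - ofMat M) - (W n - ofMat M)) +
      (fderiv ℝ (cutoff U δ (n + 1)) x).smulRight (w (n + 1) - w n)) := by
      rw [hX, sub_sub_sub_cancel_right]; abel
    rw [e1]
    calc _ ≤ ‖W n - ofMat M‖ + (‖cutoff U δ (n + 1) x‖ * (‖W (n + 1) - ofMat M‖ + ‖W n - ofMat M‖) +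
          ‖fderiv ℝ (cutoff U δ (n + 1)) x‖ * ‖w (n + 1) - w n‖) := by
          refine (norm_add_le _ _).trans ?_
          gcongr
          refine (norm_add_le _ _).trans ?_
          rw [norm_smul, ContinuousLinearMap.norm_smulRight_apply]
          gcongr
          exact norm_sub_le _ _
      _ ≤ K + (supC d * (2 * K + K) + supC d * (1 / scl U δ (n + 1)) * (2 * (supC d * (roughC d e * scl U δ n * β)))) := by
          gcongr
      _ = _ := by
          rw [scl_succ, hK]; field_simp; ring
  have h4 : ‖toMat X - M‖ ≤ matC d * ((1 + 7 * supC d) * K) := by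
    rw [← toMat_ofMat M, ← map_sub]
    exact (norm_toMat_le _).trans (by gcongr)
  refine (infDist_add_le hMA h4).trans (le_of_eq ?_)
  rw [extGradC, hK]; ring

/-- The gradient of the extension in the region of the outer cutoff. -/
theorem infDist_extGrad_le_of_far (hU : IsExtensionDomain U e δ) (hg : IsWeakGradient U u g)
    (hui : IntegrableOn u U) (hgi : IntegrableOn g U) (hβ : 0 ≤ β)
    (hx1 : 2 * scl U δ 0 < Metric.infDist x U) (hx2 : Metric.infDist x U ≤ 4 * scl U δ 0)
    (hosc : ∀ z, Admissible U e (scl U δ 0) x z → OscAt g 𝒜 (scaleRatio d e * scl U δ 0) z β) :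
    Metric.infDist (extGrad U e δ u g x) 𝒜 ≤ extGradC d e * β +
      extLowC d e * ((scl U δ 0)⁻¹ * ((scl U δ 0 ^ d)⁻¹ * ∫ w in nearSet U e (scl U δ 0) x, ‖u w‖)) := by
  have hl := hU.scl_pos 0
  have hint : Integrable (U.indicator u) := hui.integrable_indicator hU.isOpen.measurableSet
  obtain ⟨M, hMA, h1, -⟩ := hU.exists_gradient_approx hg hui hgi hx2 hosc
  have hsub : nearSet U e (scl U δ 0) x ⊆ U := nearSet_subset
  obtain ⟨c1, c2⟩ := hU.norm_scaleExt_sub_const_le hint hx2 0 (by simpa using hint.integrableOn)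
  have hI : ∫ w in nearSet U e (scl U δ 0) x, ‖U.indicator u w - 0‖ =
      ∫ w in nearSet U e (scl U δ 0) x, ‖u w‖ :=
    setIntegral_congr_fun (measurableSet_nearSet hU.isOpen.measurableSet) fun y hy => by
      simp [hsub hy]
  rw [hI] at c1 c2
  rw [sub_zero] at c1
  set I := ∫ w in nearSet U e (scl U δ 0) x, ‖u w‖
  have hI0 : 0 ≤ I := integral_nonneg fun _ => norm_nonneg _
  rw [(hU.extFn_eq (N := 0) (by linarith)).2]
  have hE : approxExt U e δ 0 (U.indicator u) = fun y =>
      cutoff U δ 0 y • scaleExt U e δ 0 (U.indicator u) y := by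
    ext1 y; simp [approxExt]
  rw [hE]
  have dW : HasFDerivAt (scaleExt U e δ 0 (U.indicator u))
      (fderiv ℝ (scaleExt U e δ 0 (U.indicator u)) x) x :=
    ((hU.contDiff_scaleExt hint 0).differentiable (by simp) x).hasFDerivAt
  have dC : HasFDerivAt (cutoff U δ 0) (fderiv ℝ (cutoff U δ 0) x) x :=
    ((hU.contDiff_cutoff 0).differentiable (by simp) x).hasFDerivAt
  have hd' := (dC.smul dW).fderiv
  simp only [Pi.smul_def'] at hd'
  rw [hd']
  obtain ⟨hc1, hc2⟩ := hU.norm_cutoff_le 0 x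
  have hm := one_le_matC d
  have hs := supC_nonneg d
  have hr := roughC_pos d hU.jones.e_pos
  have hcr := crudeC_pos d hU.jones.e_pos
  set W := fderiv ℝ (scaleExt U e δ 0 (U.indicator u)) x
  set w := scaleExt U e δ 0 (U.indicator u) x
  set K := supC d * (roughC d e * β) with hK
  have hK0 : 0 ≤ K := by positivity
  set X := cutoff U δ 0 x • W + (fderiv ℝ (cutoff U δ 0) x).smulRight w with hX
  have hXM : ‖X - ofMat M‖ ≤ K + (1 + 2 * supC d) * (supC d * crudeC d e) *
      ((scl U δ 0)⁻¹ * ((scl U δ 0 ^ d)⁻¹ * I)) := by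
    -- Only the first summand is compared with `𝒜`. The rest comes from the outer cutoff, which
    -- multiplies a value and not a difference, and is estimated by the mean of `u`.
    have e1 : X - ofMat M = (W - ofMat M) + (cutoff U δ 0 x • W +
      ((fderiv ℝ (cutoff U δ 0) x).smulRight w - W)) := by
      rw [hX]; abel
    rw [e1]
    calc _ ≤ ‖W - ofMat M‖ + (‖cutoff U δ 0 x‖ * ‖W‖ +
          (‖fderiv ℝ (cutoff U δ 0) x‖ * ‖w‖ + ‖W‖)) := by
          refine (norm_add_le _ _).trans ?_
          gcongr
          refine (norm_add_le _ _).trans ?_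
          rw [norm_smul]
          gcongr
          refine (norm_sub_le _ _).trans ?_
          rw [ContinuousLinearMap.norm_smulRight_apply]
      _ ≤ K + (supC d * (supC d * (crudeC d e * (scl U δ 0 ^ d)⁻¹ * I / scl U δ 0)) +
          (supC d * (1 / scl U δ 0) * (supC d * (crudeC d e * (scl U δ 0 ^ d)⁻¹ * I)) +
            supC d * (crudeC d e * (scl U δ 0 ^ d)⁻¹ * I / scl U δ 0))) := by
          gcongr
      _ = _ := by
          field_simp; ring
  have h4 : ‖toMat X - M‖ ≤ matC d * (K + (1 + 2 * supC d) * (supC d * crudeC d e) *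
      ((scl U δ 0)⁻¹ * ((scl U δ 0 ^ d)⁻¹ * I))) := by
    rw [← toMat_ofMat M, ← map_sub]
    exact (norm_toMat_le _).trans (by gcongr)
  refine (infDist_add_le hMA h4).trans ?_
  have : 0 ≤ matC d * (7 * supC d * (supC d * roughC d e)) * β := by positivity
  rw [extGradC, extLowC, hK]
  linarith

theorem extGrad_eq_zero (hU : IsExtensionDomain U e δ) (hx : 4 * scl U δ 0 < Metric.infDist x U) :
    extFn U e δ u x = 0 ∧ extGrad U e δ u g x = 0 := by
  have hl := hU.scl_pos 0
  obtain ⟨h1, h2⟩ := hU.extFn_eq (f := u) (g := g) (x := x) (N := 0) (by linarith)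
  have hx' : 7 / 2 * scl U δ 0 < Metric.infDist x U := by linarith
  refine ⟨by rw [h1, hU.approxExt_eq_zero hx'], ?_⟩
  have : approxExt U e δ 0 (U.indicator u) =ᶠ[𝓝 x] fun _ => 0 := by
    filter_upwards [eventually_lt_infDist hx'] with y hy
    exact hU.approxExt_eq_zero hy 0
  rw [h2, this.fderiv_eq]
  simp

/-- Take the least index whose scale is below the distance; its predecessor is not. -/
theorem exists_scale (h0 : 0 < Metric.infDist x U)
    (h2 : Metric.infDist x U ≤ 2 * scl U δ 0) :
    ∃ n, scl U δ n < Metric.infDist x U ∧ Metric.infDist x U ≤ 2 * scl U δ n := by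
  classical
  have hex : ∃ n, scl U δ n < Metric.infDist x U :=
    ((tendsto_order.1 tendsto_scl).2 _ h0).exists
  refine ⟨Nat.find hex, Nat.find_spec hex, ?_⟩
  rcases h : Nat.find hex with _ | k
  · exact h2
  · have := Nat.find_min hex (m := k) (by omega)
    rw [scl_succ]
    linarith

end IsExtensionDomain

end ext

/-! ### Local means -/

section means

variable {d : ℕ} {E : Type*} [NormedAddCommGroup E]

/-- The constant of the estimate for local means. -/
noncomputable def meanC (d : ℕ) (R : ℝ) : ℝ := max 1 (R ^ d * ballVol d)

theorem one_le_meanC (d : ℕ) (R : ℝ) : 1 ≤ meanC d R := le_max_left _ _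

/-- Schur type bound for the kernel of local means. -/
theorem lintegral_kernel_le {X : Set (Vec d)} {T : Set (Vec d × Vec d)} {lam : Vec d → ℝ} {R r : ℝ}
    (hX : MeasurableSet X) (hR : 0 ≤ R) {y : Vec d} (hr : 0 < r)
    (hker : ∀ x ∈ X, (x, y) ∈ T → r ≤ lam x ∧ dist x y ≤ R * r) :
    ∫⁻ x in X, T.indicator (fun _ => (ENNReal.ofReal (lam x ^ d))⁻¹) (x, y) ≤
      ENNReal.ofReal (meanC d R) := by
  calc ∫⁻ x in X, T.indicator (fun _ => (ENNReal.ofReal (lam x ^ d))⁻¹) (x, y)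
      ≤ ∫⁻ x in X, (Metric.closedBall y (R * r)).indicator (fun _ => (ENNReal.ofReal (r ^ d))⁻¹) x := by
        refine setLIntegral_mono' hX fun x hx => ?_
        by_cases h : (x, y) ∈ T
        · obtain ⟨h1, h2⟩ := hker x hx h
          rw [indicator_of_mem h, indicator_of_mem (Metric.mem_closedBall.2 h2)]
          gcongr
        · rw [indicator_of_notMem h]; exact zero_le
    _ ≤ ∫⁻ x, (Metric.closedBall y (R * r)).indicator (fun _ => (ENNReal.ofReal (r ^ d))⁻¹) x :=
        setLIntegral_le_lintegral _ _
    _ = (ENNReal.ofReal (r ^ d))⁻¹ * ENNReal.ofReal ((R * r) ^ d * ballVol d) := by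
        rw [lintegral_indicator measurableSet_closedBall, setLIntegral_const,
          volume_closedBall (by positivity)]
    _ = ENNReal.ofReal (R ^ d * ballVol d) := by
        rw [← ENNReal.ofReal_inv_of_pos (by positivity), ← ENNReal.ofReal_mul (by positivity)]
        congr 1
        rw [mul_pow]; field_simp
    _ ≤ _ := ENNReal.ofReal_le_ofReal (le_max_right _ _)

/-- Tonelli estimate for local means. -/
theorem lintegral_mean_le {X : Set (Vec d)} {T : Set (Vec d × Vec d)} {lam : Vec d → ℝ} {R : ℝ}
    (hX : MeasurableSet X) (hT : MeasurableSet T) (hlam : Measurable lam) (hR : 0 ≤ R)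
    (hker : ∀ y, ∃ r > 0, ∀ x ∈ X, (x, y) ∈ T → r ≤ lam x ∧ dist x y ≤ R * r)
    {h : Vec d → ℝ≥0∞} (hh : Measurable h) :
    ∫⁻ x in X, (ENNReal.ofReal (lam x ^ d))⁻¹ * ∫⁻ y in {y | (x, y) ∈ T}, h y ≤
      ENNReal.ofReal (meanC d R) * ∫⁻ y, h y := by
  have hTx : ∀ x, MeasurableSet {y | (x, y) ∈ T} := fun x => measurable_prodMk_left hT
  have hm : Measurable fun q : Vec d × Vec d =>
      T.indicator (fun q => (ENNReal.ofReal (lam q.1 ^ d))⁻¹) q * h q.2 := by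
    refine Measurable.mul (Measurable.indicator ?_ hT) (hh.comp measurable_snd)
    exact (ENNReal.measurable_ofReal.comp ((hlam.comp measurable_fst).pow_const d)).inv
  calc _ = ∫⁻ x in X, ∫⁻ y, T.indicator (fun q => (ENNReal.ofReal (lam q.1 ^ d))⁻¹) (x, y) * h y := by
        refine lintegral_congr fun x => ?_
        rw [← lintegral_const_mul _ hh, ← lintegral_indicator (hTx x)]
        refine lintegral_congr fun y => ?_
        by_cases hxy : (x, y) ∈ T
        · rw [indicator_of_mem (s := {y | (x, y) ∈ T}) hxy, indicator_of_mem hxy]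
        · rw [indicator_of_notMem (s := {y | (x, y) ∈ T}) hxy, indicator_of_notMem hxy, zero_mul]
    _ = ∫⁻ y, ∫⁻ x in X, T.indicator (fun q => (ENNReal.ofReal (lam q.1 ^ d))⁻¹) (x, y) * h y :=
        lintegral_lintegral_swap hm.aemeasurable
    _ ≤ ∫⁻ y, ENNReal.ofReal (meanC d R) * h y := by
        refine lintegral_mono fun y => ?_
        obtain ⟨r, hr, hk⟩ := hker y
        have hmy : Measurable fun x => T.indicator (fun q => (ENNReal.ofReal (lam q.1 ^ d))⁻¹) (x, y) := by
          refine Measurable.comp (g := T.indicator (fun q => (ENNReal.ofReal (lam q.1 ^ d))⁻¹))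
            (Measurable.indicator ?_ hT) measurable_prodMk_right
          exact (ENNReal.measurable_ofReal.comp ((hlam.comp measurable_fst).pow_const d)).inv
        simp only
        rw [lintegral_mul_const _ hmy]
        gcongr
        refine le_trans (le_of_eq ?_) (lintegral_kernel_le (T := T) hX hR hr hk)
        refine lintegral_congr fun x => ?_
        by_cases hxy : (x, y) ∈ T
        · rw [indicator_of_mem hxy, indicator_of_mem hxy]
        · rw [indicator_of_notMem hxy, indicator_of_notMem hxy]
    _ = _ := lintegral_const_mul _ hh

/-- The local `p`-means of an `L^p` function are dominated by an `L^p` function. -/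
theorem exists_mean_dominating {U X : Set (Vec d)} {T : Set (Vec d × Vec d)} {lam : Vec d → ℝ} {R : ℝ}
    (hX : MeasurableSet X) (hT : MeasurableSet T) (hU : MeasurableSet U)
    (hTU : ∀ x y, (x, y) ∈ T → y ∈ U) (hlam : Measurable lam) (hpos : ∀ x ∈ X, 0 < lam x) (hR : 0 ≤ R)
    (hker : ∀ y, ∃ r > 0, ∀ x ∈ X, (x, y) ∈ T → r ≤ lam x ∧ dist x y ≤ R * r)
    {F : Vec d → E} {p : ℝ≥0∞} (hp : 1 ≤ p) (hF : MemLp F p (volume.restrict U)) :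
    ∃ Φ : Vec d → ℝ, Measurable Φ ∧ (∀ x, 0 ≤ Φ x) ∧
      eLpNorm Φ p (volume.restrict X) ≤ ENNReal.ofReal (meanC d R) * eLpNorm F p (volume.restrict U) ∧
      ∀ x ∈ X, eLpNorm F p (volume.restrict {y | (x, y) ∈ T}) ≤
        ENNReal.ofReal (lam x ^ d) ^ (1 / p.toReal) * ENNReal.ofReal (Φ x) := by
  have hmono : ∀ x, eLpNorm F p (volume.restrict {y | (x, y) ∈ T}) ≤ eLpNorm F p (volume.restrict U) :=
    fun x => eLpNorm_mono_measure _ (Measure.restrict_mono (fun y hy => hTU x y hy) le_rfl)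
  have hC1 : (1 : ℝ≥0∞) ≤ ENNReal.ofReal (meanC d R) := by
    rw [← ENNReal.ofReal_one]; exact ENNReal.ofReal_le_ofReal (one_le_meanC d R)
  rcases eq_or_ne p ∞ with rfl | hptop
  -- For `p = ∞` no averaging is needed: a constant dominates.
  · refine ⟨fun _ => (eLpNorm F ∞ (volume.restrict U)).toReal, measurable_const,
      fun _ => ENNReal.toReal_nonneg, ?_, fun x _ => ?_⟩
    · refine (eLpNorm_le_of_ae_enorm_bound (C := eLpNorm F ∞ (volume.restrict U))
        (Eventually.of_forall fun x => ?_)).trans ?_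
      · rw [Real.enorm_eq_ofReal ENNReal.toReal_nonneg, ENNReal.ofReal_toReal hF.2.ne]
      · simp only [ENNReal.toReal_top, inv_zero, ENNReal.rpow_zero, smul_eq_mul]
        rw [mul_one]; exact le_mul_of_one_le_left zero_le hC1
    · simp only [ENNReal.toReal_top, div_zero, ENNReal.rpow_zero, one_mul]
      rw [ENNReal.ofReal_toReal hF.2.ne]
      exact hmono x
  · have hp0 : p ≠ 0 := (zero_lt_one.trans_le hp).ne'
    have hpr : 0 < p.toReal := ENNReal.toReal_pos hp0 hptop
    obtain ⟨F0, hF0m, hF0⟩ := hF.1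
    have hF0' : Measurable fun y => ‖F0 y‖ₑ := hF0m.enorm
    set h : Vec d → ℝ≥0∞ := U.indicator fun y => ‖F0 y‖ₑ ^ p.toReal with hh
    have hhm : Measurable h := (hF0'.pow_const _).indicator hU
    have hTx : ∀ x, MeasurableSet {y | (x, y) ∈ T} := fun x => measurable_prodMk_left hT
    -- The local average of `|F| ^ p`; its integral is bounded by Tonelli, and its `p`-th root is
    -- the dominating function.
    set Ψ : Vec d → ℝ≥0∞ := fun x => (ENNReal.ofReal (lam x ^ d))⁻¹ * ∫⁻ y in {y | (x, y) ∈ T}, h y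
      with hΨ
    have hΨm : Measurable Ψ := by
      refine ((ENNReal.measurable_ofReal.comp (hlam.pow_const d)).inv).mul ?_
      have : Measurable fun x => ∫⁻ y, T.indicator (fun q => h q.2) (x, y) :=
        Measurable.lintegral_prod_right' ((hhm.comp measurable_snd).indicator hT)
      have e : (fun x => ∫⁻ y in {y | (x, y) ∈ T}, h y) =
          fun x => ∫⁻ y, T.indicator (fun q => h q.2) (x, y) := by
        ext1 x
        rw [← lintegral_indicator (hTx x)]
        rfl
      rw [e]
      exact this
    have hFT : ∀ x, eLpNorm F p (volume.restrict {y | (x, y) ∈ T}) =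
        (∫⁻ y in {y | (x, y) ∈ T}, h y) ^ (1 / p.toReal) := by
      intro x
      have hsub : {y | (x, y) ∈ T} ⊆ U := fun y hy => hTU x y hy
      rw [eLpNorm_congr_ae (ae_mono (Measure.restrict_mono hsub le_rfl) hF0),
        eLpNorm_eq_lintegral_rpow_enorm_toReal hp0 hptop]
      congr 1
      refine setLIntegral_congr_fun (hTx x) fun y hy => ?_
      rw [hh, indicator_of_mem (hsub hy)]
    have hFU : eLpNorm F p (volume.restrict U) = (∫⁻ y, h y) ^ (1 / p.toReal) := by
      rw [eLpNorm_congr_ae hF0, eLpNorm_eq_lintegral_rpow_enorm_toReal hp0 hptop,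
        hh, lintegral_indicator hU]
    have hhfin : ∫⁻ y, h y ≠ ⊤ := by
      intro htop
      rw [htop, ENNReal.top_rpow_of_pos (by positivity)] at hFU
      exact hF.2.ne hFU
    have hΨfin : ∀ x ∈ X, Ψ x ≠ ⊤ := fun x hx => by
      refine ENNReal.mul_ne_top (ENNReal.inv_ne_top.2 ?_) ?_
      · have := hpos x hx
        simp only [ne_eq, ENNReal.ofReal_eq_zero, not_le]
        exact pow_pos this d
      · exact ((setLIntegral_le_lintegral _ _).trans_lt hhfin.lt_top).ne
    refine ⟨fun x => (Ψ x ^ (1 / p.toReal)).toReal, (hΨm.pow_const _).ennreal_toReal,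
      fun _ => ENNReal.toReal_nonneg, ?_, fun x hx => ?_⟩
    · rw [eLpNorm_eq_lintegral_rpow_enorm_toReal hp0 hptop]
      have e : ∫⁻ x in X, ‖(Ψ x ^ (1 / p.toReal)).toReal‖ₑ ^ p.toReal = ∫⁻ x in X, Ψ x := by
        refine setLIntegral_congr_fun hX fun x hx => ?_
        rw [Real.enorm_eq_ofReal ENNReal.toReal_nonneg, ENNReal.ofReal_toReal
          (ENNReal.rpow_ne_top_of_nonneg (by positivity) (hΨfin x hx)), ← ENNReal.rpow_mul,
          one_div_mul_cancel hpr.ne', ENNReal.rpow_one]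
      rw [e]
      calc _ ≤ (ENNReal.ofReal (meanC d R) * ∫⁻ y, h y) ^ (1 / p.toReal) := by
            gcongr
            exact lintegral_mean_le hX hT hlam hR hker hhm
        _ = ENNReal.ofReal (meanC d R) ^ (1 / p.toReal) * (∫⁻ y, h y) ^ (1 / p.toReal) :=
            ENNReal.mul_rpow_of_nonneg _ _ (by positivity)
        _ ≤ ENNReal.ofReal (meanC d R) * (∫⁻ y, h y) ^ (1 / p.toReal) := by
            gcongr
            -- Since `meanC` is at least one, dropping the exponent only enlarges it; the constant
            -- thus becomes independent of `p`.
            have h1 : 1 / p.toReal ≤ 1 := by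
              rw [div_le_one hpr, ← ENNReal.toReal_one]
              exact ENNReal.toReal_mono hptop hp
            calc _ ≤ ENNReal.ofReal (meanC d R) ^ (1 : ℝ) := ENNReal.rpow_le_rpow_of_exponent_le hC1 h1
              _ = _ := ENNReal.rpow_one _
        _ = _ := by rw [hFU]
    · have hl := hpos x hx
      have hl0 : ENNReal.ofReal (lam x ^ d) ≠ 0 := (ENNReal.ofReal_pos.2 (pow_pos hl d)).ne'
      rw [hFT x, ENNReal.ofReal_toReal (ENNReal.rpow_ne_top_of_nonneg (by positivity) (hΨfin x hx)),
        ← ENNReal.mul_rpow_of_nonneg _ _ (by positivity)]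
      simp only [hΨ]
      rw [← mul_assoc, ENNReal.mul_inv_cancel hl0 ENNReal.ofReal_ne_top, one_mul]

/-! ### Convergence of local means -/

theorem measurableSet_dist_le (r : ℝ) : MeasurableSet {q : Vec d × Vec d | dist q.2 q.1 ≤ r} :=
  (isClosed_le (continuous_snd.dist continuous_fst) continuous_const).measurableSet

/-- Take `ξ = Ψ x`, where `Ψ` is continuous with compact support and close to `f` in `L^1`. The
local mean of `|f - Ψ x|` is at most that of `|f - Ψ|` plus the small oscillation of `Ψ`, and the
local means of `|f - Ψ|` integrate to at most a multiple of its `L^1` norm. -/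
theorem tendsto_lintegral_sub_of_local_mean {U O' : Set (Vec d)} (hU : MeasurableSet U) {f : Vec d → E}
    [NormedSpace ℝ E]
    (hf : IntegrableOn f U) {l : ℕ → ℝ} (hl : ∀ n, 0 < l n) (hl0 : Tendsto l atTop (𝓝 0))
    {O : ℕ → Set (Vec d)} (hO : ∀ n, MeasurableSet (O n)) (hOO : ∀ n, O n ⊆ O') (hO' : volume O' ≠ ⊤)
    {v : ℕ → Vec d → E} {C C' : ℝ} (hC : 0 ≤ C) (hC' : 0 < C')
    (h : ∀ n, ∀ x ∈ O n, ∀ ξ, ‖v n x - ξ‖ ≤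
      C * ((l n ^ d)⁻¹ * ∫ y in U ∩ Metric.closedBall x (C' * l n), ‖f y - ξ‖)) :
    Tendsto (fun n => ∫⁻ x in O n, ‖v n x - U.indicator f x‖ₑ) atTop (𝓝 0) := by
  rw [ENNReal.tendsto_nhds_zero]
  intro ε hε
  set A : ℝ≥0∞ := ENNReal.ofReal C * ENNReal.ofReal (C' ^ d * meanC d 1) with hA
  -- The final bound is `η * K`: the summands come from the averaged error, the error at `x` itself,
  -- and the oscillation of `Ψ` on a set of finite volume.
  set K : ℝ≥0∞ := A + 1 + A * volume O' with hK
  have hAtop : A ≠ ⊤ := ENNReal.mul_ne_top ENNReal.ofReal_ne_top ENNReal.ofReal_ne_top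
  have hKtop : K ≠ ⊤ := ENNReal.add_ne_top.2
    ⟨ENNReal.add_ne_top.2 ⟨hAtop, ENNReal.one_ne_top⟩, ENNReal.mul_ne_top hAtop hO'⟩
  set η : ℝ≥0∞ := min 1 (ε / K) with hη
  have hη0 : η ≠ 0 := (lt_min one_pos (ENNReal.div_pos hε.ne' hKtop)).ne'
  have hηtop : η ≠ ⊤ := ((min_le_left _ _).trans_lt ENNReal.one_lt_top).ne
  have hK0 : K ≠ 0 := by
    rw [hK]; simp
  have hηK : η * K ≤ ε :=
    (ENNReal.le_div_iff_mul_le (Or.inl hK0) (Or.inl hKtop)).1 (min_le_right _ _)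
  have hfi : Integrable (U.indicator f) := hf.integrable_indicator hU
  obtain ⟨Ψ, hΨc, hΨ, hΨcont, hΨi⟩ := hfi.exists_hasCompactSupport_lintegral_sub_le hη0
  have huc := hΨcont.uniformContinuous_of_tendsto_cocompact
    (hΨc.is_zero_at_infty)
  have hηr : 0 < η.toReal := ENNReal.toReal_pos hη0 hηtop
  obtain ⟨κ, hκ, hunif⟩ := Metric.uniformContinuous_iff.1 huc η.toReal hηr
  have hev : ∀ᶠ n in atTop, C' * l n < κ := by
    have : Tendsto (fun n => C' * l n) atTop (𝓝 0) := by simpa using hl0.const_mul C'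
    exact (tendsto_order.1 this).2 _ hκ
  filter_upwards [hev] with n hn
  have hln := hl n
  set b : Vec d → ℝ≥0∞ := fun y => ‖U.indicator f y - Ψ y‖ₑ with hb
  -- pointwise estimate
  have hpt : ∀ x ∈ O n, ‖v n x - U.indicator f x‖ₑ ≤ ENNReal.ofReal C * ((ENNReal.ofReal (l n ^ d))⁻¹ *
      ∫⁻ y in Metric.closedBall x (C' * l n), b y) + A * η + b x := by
    intro x hx
    have h1 : ‖v n x - Ψ x‖ₑ ≤ ENNReal.ofReal C * ((ENNReal.ofReal (l n ^ d))⁻¹ *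
        ∫⁻ y in U ∩ Metric.closedBall x (C' * l n), ‖f y - Ψ x‖ₑ) := by
      rw [← ofReal_norm]
      refine (ENNReal.ofReal_le_ofReal (h n x hx (Ψ x))).trans ?_
      rw [ENNReal.ofReal_mul hC, ENNReal.ofReal_mul (by positivity), ENNReal.ofReal_inv_of_pos (by positivity)]
      gcongr
      rw [ofReal_integral_eq_lintegral_ofReal]
      · simp only [ofReal_norm]; exact le_rfl
      · exact ((hf.mono_set inter_subset_left).sub (integrableOn_const
          ((measure_mono inter_subset_right).trans_lt measure_closedBall_lt_top).ne)).norm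
      · exact Eventually.of_forall fun _ => norm_nonneg _
    have h2 : ∫⁻ y in U ∩ Metric.closedBall x (C' * l n), ‖f y - Ψ x‖ₑ ≤
        (∫⁻ y in Metric.closedBall x (C' * l n), b y) + η * ENNReal.ofReal ((C' * l n) ^ d * ballVol d) := by
      calc _ ≤ ∫⁻ y in U ∩ Metric.closedBall x (C' * l n), (b y + η) := by
            refine setLIntegral_mono' (hU.inter measurableSet_closedBall) fun y hy => ?_
            have e : f y - Ψ x = (U.indicator f y - Ψ y) + (Ψ y - Ψ x) := by
              rw [indicator_of_mem hy.1]; abel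
            rw [e]
            refine (enorm_add_le _ _).trans ?_
            gcongr
            have := hunif (a := y) (b := x) ((Metric.mem_closedBall.1 hy.2).trans_lt hn)
            rw [dist_eq_norm] at this
            rw [← ofReal_norm, ← ENNReal.ofReal_toReal hηtop]
            exact ENNReal.ofReal_le_ofReal this.le
        _ ≤ ∫⁻ y in Metric.closedBall x (C' * l n), (b y + η) :=
            lintegral_mono_set inter_subset_right
        _ = _ := by
            rw [lintegral_add_right _ measurable_const, setLIntegral_const, volume_closedBall (by positivity)]
    have h3 : (ENNReal.ofReal (l n ^ d))⁻¹ * ENNReal.ofReal ((C' * l n) ^ d * ballVol d) ≤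
        ENNReal.ofReal (C' ^ d * meanC d 1) := by
      rw [← ENNReal.ofReal_inv_of_pos (by positivity), ← ENNReal.ofReal_mul (by positivity)]
      refine ENNReal.ofReal_le_ofReal ?_
      have : ballVol d ≤ meanC d 1 := by
        have := le_max_right 1 (1 ^ d * ballVol d)
        rw [one_pow, one_mul] at this
        rwa [meanC, one_pow, one_mul]
      calc _ = C' ^ d * ballVol d := by rw [mul_pow]; field_simp
        _ ≤ _ := by gcongr
    calc ‖v n x - U.indicator f x‖ₑ ≤ ‖v n x - Ψ x‖ₑ + b x := by
          have e : v n x - U.indicator f x = (v n x - Ψ x) - (U.indicator f x - Ψ x) := by abel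
          rw [e]; exact enorm_sub_le
      _ ≤ _ := by
          gcongr
          refine h1.trans ?_
          calc _ ≤ ENNReal.ofReal C * ((ENNReal.ofReal (l n ^ d))⁻¹ *
                ((∫⁻ y in Metric.closedBall x (C' * l n), b y) +
                  η * ENNReal.ofReal ((C' * l n) ^ d * ballVol d))) := by gcongr
            _ = ENNReal.ofReal C * ((ENNReal.ofReal (l n ^ d))⁻¹ *
                ∫⁻ y in Metric.closedBall x (C' * l n), b y) + ENNReal.ofReal C *
                  ((ENNReal.ofReal (l n ^ d))⁻¹ * ENNReal.ofReal ((C' * l n) ^ d * ballVol d)) * η := by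
                ring
            _ ≤ _ := by rw [hA]; gcongr
  have hbae : AEMeasurable b := (hfi.sub hΨi).1.enorm
  have hbae' : AEMeasurable b (volume.restrict (O n)) := hbae.restrict
  have hbm : ∫⁻ y, b y ≤ η := hΨ
  obtain ⟨b', hb'm, hbb'⟩ := hbae
  have hmean : ∫⁻ x in O n, (ENNReal.ofReal (l n ^ d))⁻¹ * ∫⁻ y in Metric.closedBall x (C' * l n), b y ≤
      ENNReal.ofReal (C' ^ d * meanC d 1) * η := by
    have := lintegral_mean_le (X := O n) (T := {q : Vec d × Vec d | dist q.2 q.1 ≤ C' * l n})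
      (lam := fun _ => C' * l n) (R := 1)
      (hO n) (measurableSet_dist_le _) measurable_const zero_le_one
      (fun y => ⟨C' * l n, by positivity, fun x _ hxy => ⟨le_rfl, by rw [one_mul, dist_comm]; exact hxy⟩⟩) hb'm
    have e : ∀ x : Vec d, ∫⁻ y in Metric.closedBall x (C' * l n), b y =
        ∫⁻ y in {y | (x, y) ∈ {q : Vec d × Vec d | dist q.2 q.1 ≤ C' * l n}}, b' y := fun x =>
      lintegral_congr_ae (ae_restrict_of_ae hbb')
    simp only [e]
    have e2 : (ENNReal.ofReal (l n ^ d))⁻¹ = ENNReal.ofReal (C' ^ d) * (ENNReal.ofReal ((C' * l n) ^ d))⁻¹ := by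
      rw [← ENNReal.ofReal_inv_of_pos (by positivity), ← ENNReal.ofReal_inv_of_pos (by positivity),
        ← ENNReal.ofReal_mul (by positivity)]
      congr 1
      rw [mul_pow]; field_simp
    simp only [e2, mul_assoc]
    rw [lintegral_const_mul' _ _ ENNReal.ofReal_ne_top, ENNReal.ofReal_mul (by positivity), mul_assoc]
    gcongr
    refine this.trans ?_
    gcongr
    rw [← lintegral_congr_ae hbb']
    exact hbm
  calc ∫⁻ x in O n, ‖v n x - U.indicator f x‖ₑ ≤ ∫⁻ x in O n, (ENNReal.ofReal C * ((ENNReal.ofReal (l n ^ d))⁻¹ *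
      ∫⁻ y in Metric.closedBall x (C' * l n), b y) + A * η + b x) := setLIntegral_mono' (hO n) hpt
    _ = ENNReal.ofReal C * (∫⁻ x in O n, (ENNReal.ofReal (l n ^ d))⁻¹ *
      ∫⁻ y in Metric.closedBall x (C' * l n), b y) + A * η * volume (O n) + ∫⁻ x in O n, b x := by
        rw [lintegral_add_right' _ hbae', lintegral_add_right _ measurable_const,
          setLIntegral_const, lintegral_const_mul' _ _ ENNReal.ofReal_ne_top]
    _ ≤ ENNReal.ofReal C * (ENNReal.ofReal (C' ^ d * meanC d 1) * η) + A * η * volume O' + η := by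
        gcongr
        · exact hOO n
        · exact (setLIntegral_le_lintegral _ _).trans hbm
    _ = η * K := by rw [hK, hA]; ring
    _ ≤ ε := hηK

end means

/-! ### Normalised local means and Hölder's inequality -/

section localmeans

variable {d : ℕ} {E : Type*} [NormedAddCommGroup E] {F : Vec d → E} {p : ℝ≥0∞} {T T' : Set (Vec d)}
  {t s a K R : ℝ} {x : Vec d}

/-- The `p`-mean of `F` on `T`, normalised by the volume `t ^ d`, is at most `a`. -/
def MeanLe (F : Vec d → E) (p : ℝ≥0∞) (T : Set (Vec d)) (t a : ℝ) : Prop :=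
  eLpNorm F p (volume.restrict T) ≤ ENNReal.ofReal (t ^ d) ^ (1 / p.toReal) * ENNReal.ofReal a

theorem one_div_toReal_le_one (hp : 1 ≤ p) : 1 / p.toReal ≤ 1 := by
  rcases eq_or_ne p ⊤ with rfl | hpt
  · simp
  · have h1 : 1 ≤ p.toReal := by
      rw [← ENNReal.toReal_one]; exact ENNReal.toReal_mono hpt hp
    rw [div_le_one (by linarith)]; exact h1

theorem ofReal_rpow_le_self (hK : 1 ≤ K) {σ : ℝ} (hσ : σ ≤ 1) : ENNReal.ofReal K ^ σ ≤ ENNReal.ofReal K := by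
  have h1 : (1 : ℝ≥0∞) ≤ ENNReal.ofReal K := by
    rw [← ENNReal.ofReal_one]; exact ENNReal.ofReal_le_ofReal hK
  calc _ ≤ ENNReal.ofReal K ^ (1 : ℝ) := ENNReal.rpow_le_rpow_of_exponent_le h1 hσ
    _ = _ := ENNReal.rpow_one _

theorem MeanLe.mono (h : MeanLe F p T t a) (hT : T' ⊆ T) : MeanLe F p T' t a :=
  (eLpNorm_mono_measure _ (Measure.restrict_mono hT le_rfl)).trans h

/-- Changing the normalisation costs `K ^ (d / p)`, which is at most `K ^ d` for every `p`. -/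
theorem MeanLe.rescale (h : MeanLe F p T t a) (hp : 1 ≤ p) (ht : 0 ≤ t) (hK : 1 ≤ K)
    (hts : t ≤ K * s) : MeanLe F p T s (K ^ d * a) := by
  have hσ := one_div_toReal_le_one hp
  have hσ0 : 0 ≤ 1 / p.toReal := by positivity
  have hK0 : 0 ≤ K := by linarith
  refine h.trans ?_
  calc _ ≤ (ENNReal.ofReal (K ^ d) * ENNReal.ofReal (s ^ d)) ^ (1 / p.toReal) * ENNReal.ofReal a := by
        gcongr
        rw [← ENNReal.ofReal_mul (by positivity), ← mul_pow]
        gcongr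
    _ = ENNReal.ofReal (K ^ d) ^ (1 / p.toReal) * (ENNReal.ofReal (s ^ d) ^ (1 / p.toReal) * ENNReal.ofReal a) := by
        rw [ENNReal.mul_rpow_of_nonneg _ _ hσ0, mul_assoc]
    _ ≤ ENNReal.ofReal (K ^ d) * (ENNReal.ofReal (s ^ d) ^ (1 / p.toReal) * ENNReal.ofReal a) := by
        gcongr
        exact ofReal_rpow_le_self (one_le_pow₀ hK) hσ
    _ = _ := by rw [ENNReal.ofReal_mul (by positivity)]; ring

/-- Hölder's inequality for local means. -/
theorem MeanLe.integral_le (h : MeanLe F p T t a) (hp : 1 ≤ p) (ha : 0 ≤ a) (ht : 0 < t) (hR : 0 ≤ R)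
    (hF : AEStronglyMeasurable F (volume.restrict T)) (hT : T ⊆ Metric.closedBall x (R * t)) :
    IntegrableOn F T ∧ ∫ y in T, ‖F y‖ ≤ t ^ d * (meanC d R * a) := by
  have hσ := one_div_toReal_le_one hp
  have hσ0 : 0 ≤ 1 / p.toReal := by positivity
  have hm := one_le_meanC d R
  have htd : 0 < t ^ d := by positivity
  have hvol : volume T ≤ ENNReal.ofReal (t ^ d) * ENNReal.ofReal (meanC d R) := by
    refine (measure_mono hT).trans ?_
    rw [volume_closedBall (by positivity), ← ENNReal.ofReal_mul (by positivity)]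
    refine ENNReal.ofReal_le_ofReal ?_
    rw [mul_pow, mul_comm (R ^ d), mul_assoc]
    gcongr
    exact le_max_right _ _
  have key : eLpNorm F 1 (volume.restrict T) ≤ ENNReal.ofReal (t ^ d * (meanC d R * a)) := by
    refine (eLpNorm_le_eLpNorm_mul_rpow_measure_univ hp hF).trans ?_
    rw [Measure.restrict_apply_univ, ENNReal.toReal_one, div_one]
    have h1 : 0 ≤ 1 - 1 / p.toReal := by linarith
    calc _ ≤ ENNReal.ofReal (t ^ d) ^ (1 / p.toReal) * ENNReal.ofReal a *
          (ENNReal.ofReal (t ^ d) * ENNReal.ofReal (meanC d R)) ^ (1 - 1 / p.toReal) := by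
          gcongr; exact h
      _ = (ENNReal.ofReal (t ^ d) ^ (1 / p.toReal) * ENNReal.ofReal (t ^ d) ^ (1 - 1 / p.toReal)) *
          (ENNReal.ofReal (meanC d R) ^ (1 - 1 / p.toReal) * ENNReal.ofReal a) := by
          rw [ENNReal.mul_rpow_of_nonneg _ _ h1]; ring
      _ ≤ ENNReal.ofReal (t ^ d) * (ENNReal.ofReal (meanC d R) * ENNReal.ofReal a) := by
          rw [← ENNReal.rpow_add _ _ (ENNReal.ofReal_pos.2 htd).ne' ENNReal.ofReal_ne_top,
            add_sub_cancel, ENNReal.rpow_one]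
          gcongr
          exact ofReal_rpow_le_self hm (by linarith)
      _ = _ := by rw [ENNReal.ofReal_mul htd.le, ENNReal.ofReal_mul (by linarith)]
  refine ⟨memLp_one_iff_integrable.1 ⟨hF, key.trans_lt ENNReal.ofReal_lt_top⟩, ?_⟩
  rw [integral_norm_eq_lintegral_enorm hF, ← eLpNorm_one_eq_lintegral_enorm]
  exact ENNReal.toReal_le_of_le_ofReal (by positivity) key

end localmeans

/-! ### Averages near exterior points, dominated by functions in `L^p` -/

section exterior

variable {d : ℕ} {U : Set (Vec d)} {e δ : ℝ} {f u : Vec d → Vec d} {g : Vec d → Mat d}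
  {𝒜 : Set (Mat d)} {x : Vec d} {n m N : ℕ} {β : ℝ} {p q : ℝ≥0∞}

/-- Points of `U` at distance comparable to `dist (x, U)` from `x` and from the boundary. -/
def extNear (U : Set (Vec d)) (e : ℝ) (x : Vec d) : Set (Vec d) :=
  {w | w ∈ U ∧ dist w x ≤ 50 * Metric.infDist x U / e ∧
    e ^ 3 / 131072 * Metric.infDist x U ≤ Metric.infDist w (frontier U)}

/-- The constant in the averaging estimates. -/
noncomputable def avgC (d : ℕ) (e : ℝ) : ℝ := meanC d (2500 * 131072 / e ^ 5)

theorem one_le_avgC : 1 ≤ avgC d e := one_le_meanC _ _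

/-- `extNear` depends on the point alone and contains `nearSet` for every scale comparable to the
distance. The bounds on `l` turn `25` into `50` and `32768` into `131072`. -/
theorem nearSet_subset_extNear (he : 0 < e) {l : ℝ} (h1 : l ≤ 2 * Metric.infDist x U)
    (h2 : Metric.infDist x U ≤ 4 * l) : nearSet U e l x ⊆ extNear U e x := by
  rintro w ⟨hw, hd, hb⟩
  refine ⟨hw, hd.trans ?_, le_trans ?_ hb⟩
  · gcongr ?_ / e; linarith
  · have : 0 < e ^ 3 := by positivity
    nlinarith

theorem measurableSet_extNear_pairs (hU : MeasurableSet U) (s : ℝ) :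
    MeasurableSet {q : Vec d × Vec d | s < Metric.infDist q.1 U ∧ q.2 ∈ extNear U e q.1} := by
  have c1 : Continuous fun q : Vec d × Vec d => Metric.infDist q.1 U :=
    (Metric.continuous_infDist_pt U).comp continuous_fst
  have c2 : Continuous fun q : Vec d × Vec d => Metric.infDist q.2 (frontier U) :=
    (Metric.continuous_infDist_pt _).comp continuous_snd
  refine ((isOpen_lt continuous_const c1).measurableSet).inter ((measurable_snd hU).inter
    (MeasurableSet.inter ?_ ?_))
  · exact (isClosed_le (continuous_snd.dist continuous_fst) ((continuous_const.mul c1).div_const _)).measurableSet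
  · exact (isClosed_le (continuous_const.mul c1) c2).measurableSet

theorem measurableSet_lt_infDist (s : ℝ) : MeasurableSet {x : Vec d | s < Metric.infDist x U} :=
  (isOpen_lt continuous_const (Metric.continuous_infDist_pt _)).measurableSet

theorem measurableSet_infDist_le (s : ℝ) : MeasurableSet {x : Vec d | Metric.infDist x U ≤ s} :=
  (isClosed_le (Metric.continuous_infDist_pt _) continuous_const).measurableSet

namespace IsExtensionDomain

variable {E : Type*} [NormedAddCommGroup E]

theorem measurableSet_innerPart (hU : IsExtensionDomain U e δ) (s : ℝ) : MeasurableSet (innerPart U s) :=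
  hU.isOpen.measurableSet.inter
    (isClosed_le continuous_const (Metric.continuous_infDist_pt _)).measurableSet

/-- A positive `s` restricts attention to exterior points far from `U`, for which `extNear` stays
inside `innerPart`; this localizes the lower order term. The value `s = 0` gives the whole of `U`.
-/
theorem exists_exterior_mean (hU : IsExtensionDomain U e δ) {s : ℝ} (hs : 0 ≤ s) {F : Vec d → E}
    (hp : 1 ≤ p) (hF : MemLp F p (volume.restrict (innerPart U (e ^ 3 / 131072 * s)))) :
    ∃ Φ : Vec d → ℝ, Measurable Φ ∧ (∀ x, 0 ≤ Φ x) ∧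
      eLpNorm Φ p (volume.restrict {x | s < Metric.infDist x U}) ≤
        ENNReal.ofReal (avgC d e) * eLpNorm F p (volume.restrict (innerPart U (e ^ 3 / 131072 * s))) ∧
      ∀ x, s < Metric.infDist x U → MeanLe F p (extNear U e x) (Metric.infDist x U) (Φ x) := by
  have he := hU.jones.e_pos
  have he3 : 0 < e ^ 3 := by positivity
  obtain ⟨Φ, h1, h2, h3, h4⟩ := exists_mean_dominating (X := {x | s < Metric.infDist x U})
    (T := {q : Vec d × Vec d | s < Metric.infDist q.1 U ∧ q.2 ∈ extNear U e q.1})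
    (lam := fun x => Metric.infDist x U) (R := 2500 * 131072 / e ^ 5)
    (measurableSet_lt_infDist s) (measurableSet_extNear_pairs hU.isOpen.measurableSet s)
    (hU.measurableSet_innerPart _) (fun x y hxy => ⟨hxy.2.1, le_trans (by
      have := hxy.1
      gcongr) hxy.2.2.2⟩)
    (Metric.continuous_infDist_pt U).measurable (fun x hx => hs.trans_lt hx) (by positivity)
    (fun y => by
      by_cases hy : 0 < Metric.infDist y (frontier U)
      -- Seen from `y`, all exterior points that average over it have distance from `U` comparable
      -- to the distance of `y` from the frontier. Multiplying the two comparison constants gives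
      -- `2500 * 131072 / e ^ 5`.
      · refine ⟨e / 50 * Metric.infDist y (frontier U), by positivity, fun x hx hxy => ?_⟩
        obtain ⟨-, hyU, hd, hb⟩ := hxy
        have hx0 : 0 < Metric.infDist x U := hs.trans_lt hx
        have hxU : x ∉ U := fun h => hx0.ne' (Metric.infDist_zero_of_mem h)
        have h1 := (infDist_frontier_le_dist hyU hxU).trans hd
        simp only at hd hb h1 ⊢
        constructor
        · rw [le_div_iff₀ he] at h1
          linarith
        · rw [dist_comm]
          refine hd.trans ?_
          rw [div_mul_eq_mul_div, div_le_iff₀ (by norm_num)] at hb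
          rw [div_mul_eq_mul_div, le_div_iff₀ (by positivity)]
          calc 50 * Metric.infDist x U / e * e ^ 5 = 50 * e * (e ^ 3 * Metric.infDist x U) := by
                field_simp
            _ ≤ 50 * e * (Metric.infDist y (frontier U) * 131072) := by gcongr
            _ = _ := by ring
      · refine ⟨1, one_pos, fun x hx hxy => (hy ?_).elim⟩
        have hx0 : 0 < Metric.infDist x U := hs.trans_lt hx
        exact lt_of_lt_of_le (by positivity) hxy.2.2.2) hp hF
  refine ⟨Φ, h1, h2, h3, fun x hx => ?_⟩
  have := h4 x hx
  have e1 : {y | (x, y) ∈ {q : Vec d × Vec d | s < Metric.infDist q.1 U ∧ q.2 ∈ extNear U e q.1}} =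
      extNear U e x := by
    ext y; exact ⟨fun h => h.2, fun h => ⟨hx, h⟩⟩
  rw [e1] at this
  exact this

theorem _root_.innerPart_zero : innerPart U (e ^ 3 / 131072 * 0) = U := by
  ext x; simp [innerPart, Metric.infDist_nonneg]

theorem measurableSet_nearSet_pairs (hU : IsExtensionDomain U e δ) (l : ℝ) :
    MeasurableSet {q : Vec d × Vec d | q.2 ∈ nearSet U e l q.1} := by
  have c2 : Continuous fun q : Vec d × Vec d => Metric.infDist q.2 (frontier U) :=
    (Metric.continuous_infDist_pt _).comp continuous_snd
  refine (measurable_snd hU.isOpen.measurableSet).inter (MeasurableSet.inter ?_ ?_)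
  · exact (isClosed_le (continuous_snd.dist continuous_fst) continuous_const).measurableSet
  · exact (isClosed_le continuous_const c2).measurableSet

theorem _root_.meanC_mono {R R' : ℝ} (hR : 0 ≤ R) (h : R ≤ R') : meanC d R ≤ meanC d R' := by
  have : 0 ≤ ballVol d := ENNReal.toReal_nonneg
  unfold meanC
  gcongr

/-- The counterpart at a fixed scale, valid also at points of `U`; it is needed for the differences
of consecutive approximations. -/
theorem exists_scale_mean (hU : IsExtensionDomain U e δ) {l : ℝ} (hl : 0 < l) {F : Vec d → E}
    (hp : 1 ≤ p) (hF : MemLp F p (volume.restrict U)) :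
    ∃ Φ : Vec d → ℝ, Measurable Φ ∧ (∀ x, 0 ≤ Φ x) ∧
      eLpNorm Φ p volume ≤ ENNReal.ofReal (avgC d e) * eLpNorm F p (volume.restrict U) ∧
      ∀ x, MeanLe F p (nearSet U e l x) l (Φ x) := by
  have he := hU.jones.e_pos
  have he1 := hU.jones.e_le_one
  obtain ⟨Φ, h1, h2, h3, h4⟩ := exists_mean_dominating (X := univ)
    (T := {q : Vec d × Vec d | q.2 ∈ nearSet U e l q.1})
    (lam := fun x => l) (R := 25 / e) MeasurableSet.univ (hU.measurableSet_nearSet_pairs l)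
    hU.isOpen.measurableSet (fun x y hxy => hxy.1) measurable_const (fun x _ => hl) (by positivity)
    (fun y => ⟨l, hl, fun x _ hxy => ⟨le_rfl, by
      rw [dist_comm, div_mul_eq_mul_div]; exact hxy.2.1⟩⟩) hp hF
  refine ⟨Φ, h1, h2, ?_, fun x => h4 x (mem_univ x)⟩
  rw [Measure.restrict_univ] at h3
  refine h3.trans ?_
  gcongr
  refine meanC_mono (by positivity) ?_
  have : e ^ 5 ≤ e := pow_le_of_le_one he.le he1 (by norm_num)
  calc 25 / e ≤ 25 / e ^ 5 := by gcongr
    _ ≤ _ := by gcongr; norm_num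

end IsExtensionDomain

end exterior

/-! ### Pointwise bounds for the extension by local means -/

section control

variable {d : ℕ} {U : Set (Vec d)} {e δ : ℝ} {f u : Vec d → Vec d} {g : Vec d → Mat d}
  {𝒜 : Set (Mat d)} {x z : Vec d} {n m N : ℕ} {β : ℝ} {p q r : ℝ≥0∞} {F G : Vec d → ℝ} {C a b c l : ℝ}

/-- Local means of `F` and `G` control the oscillation of `g` and its distance from `𝒜`. -/
def OscControl (U : Set (Vec d)) (g : Vec d → Mat d) (𝒜 : Set (Mat d)) (p q : ℝ≥0∞)
    (F G : Vec d → ℝ) (C : ℝ) : Prop :=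
  ∀ (z : Vec d) (t a b : ℝ), 0 < t → 0 ≤ a → 0 ≤ b → Metric.closedBall z (3 * (d + 1) * t) ⊆ U →
    MeanLe F p (Metric.closedBall z (3 * (d + 1) * t)) t a →
    MeanLe G q (Metric.closedBall z (3 * (d + 1) * t)) t b → OscAt g 𝒜 t z (C * (a + b))

/-- With `{0}` as target and `M = 0` no rigidity is needed. This makes the boundedness of the
operator on `W^{1,1}` a case of the general gradient estimate. -/
theorem oscControl_zero (hg : IntegrableOn g U) :
    OscControl U g {0} 1 1 (fun y => ‖g y‖) (fun _ => 0) (meanC d (3 * (d + 1))) := by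
  intro z t a b ht ha hb hz hF _
  have hm := one_le_meanC d (3 * (d + 1))
  have h := (hF.integral_le le_rfl ha ht (by positivity) (hg.mono_set hz).norm.1 Subset.rfl).2
  refine ⟨0, ?_, ?_⟩
  · simp only [norm_norm] at h
    simp only [sub_zero]
    refine (setIntegral_mono_set (hg.mono_set hz).norm
      (Eventually.of_forall fun _ => norm_nonneg _)
      (LE.le.eventuallyLE (Metric.closedBall_subset_closedBall ?_))).trans (h.trans ?_)
    · have : (0 : ℝ) ≤ d := Nat.cast_nonneg d
      nlinarith
    · gcongr; linarith
  · rw [Metric.infDist_singleton, dist_self]; positivity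

theorem scaleRatio_le_one (he : 0 < e) (he1 : e ≤ 1) : scaleRatio d e ≤ 1 := by
  have h := scaleRatio_le d he
  have : e ^ 3 ≤ 1 := pow_le_one₀ he.le he1
  linarith

/-- The constant of the passage from averages at a scale to averages at the reduced scale. -/
noncomputable def ratioC (d : ℕ) (e : ℝ) : ℝ := (scaleRatio d e)⁻¹ ^ d

theorem ratioC_pos (he : 0 < e) : 0 < ratioC d e := pow_pos (inv_pos.2 (scaleRatio_pos d he)) d

theorem OscControl.oscAt (h : OscControl U g 𝒜 p q F G C) (hp : 1 ≤ p) (hq : 1 ≤ q) (he : 0 < e)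
    (he1 : e ≤ 1) (hl : 0 < l) (ha : 0 ≤ a) (hb : 0 ≤ b) (hF : MeanLe F p (nearSet U e l x) l a)
    (hG : MeanLe G q (nearSet U e l x) l b) (hz : Admissible U e l x z) :
    OscAt g 𝒜 (scaleRatio d e * l) z (C * ratioC d e * (a + b)) := by
  have hτ := scaleRatio_pos d he
  have hsub := hz.closedBall_subset he he1 hl le_rfl
  have h1 : 1 ≤ (scaleRatio d e)⁻¹ := (one_le_inv₀ hτ).2 (scaleRatio_le_one he he1)
  have h2 : l ≤ (scaleRatio d e)⁻¹ * (scaleRatio d e * l) := by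
    rw [inv_mul_cancel_left₀ hτ.ne']
  have hr := (ratioC_pos (d := d) he).le
  have := h z (scaleRatio d e * l) (ratioC d e * a) (ratioC d e * b) (by positivity) (by positivity)
    (by positivity) (hsub.trans nearSet_subset) ((hF.mono hsub).rescale hp hl.le h1 h2)
    ((hG.mono hsub).rescale hq hl.le h1 h2)
  rwa [← mul_add, ← mul_assoc] at this

namespace IsExtensionDomain

theorem meanLe_nearSet {E : Type*} [NormedAddCommGroup E] {F : Vec d → E}
    (hU : IsExtensionDomain U e δ) (hp : 1 ≤ p) (h1 : l ≤ 2 * Metric.infDist x U)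
    (h2 : Metric.infDist x U ≤ 4 * l) (hF : MeanLe F p (extNear U e x) (Metric.infDist x U) a) :
    MeanLe F p (nearSet U e l x) l (4 ^ d * a) :=
  (hF.mono (nearSet_subset_extNear hU.jones.e_pos h1 h2)).rescale hp Metric.infDist_nonneg
    (by norm_num) h2

/-- Constant of the exterior gradient estimate. -/
noncomputable def _root_.ringC (d : ℕ) (e : ℝ) : ℝ := extGradC d e * (ratioC d e * 4 ^ d)

theorem _root_.extGradC_pos (he : 0 < e) : 0 < extGradC d e := by
  have hm := one_le_matC d
  have hs := supC_nonneg d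
  have hr := roughC_pos d he
  unfold extGradC; positivity

theorem _root_.extLowC_nonneg (he : 0 < e) : 0 ≤ extLowC d e := by
  have hm := one_le_matC d
  have hs := supC_nonneg d
  have hr := crudeC_pos d he
  unfold extLowC; positivity

theorem _root_.ringC_pos (he : 0 < e) : 0 < ringC d e := by
  have := extGradC_pos (d := d) he
  have := ratioC_pos (d := d) he
  unfold ringC; positivity

theorem infDist_extGrad_le_mean (hU : IsExtensionDomain U e δ) (hg : IsWeakGradient U u g)
    (hui : IntegrableOn u U) (hgi : IntegrableOn g U) (hO : OscControl U g 𝒜 p q F G C) (hC : 0 ≤ C)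
    (hp : 1 ≤ p) (hq : 1 ≤ q) (h0 : 0 < Metric.infDist x U) (h2 : Metric.infDist x U ≤ 2 * scl U δ 0)
    (ha : 0 ≤ a) (hb : 0 ≤ b) (hF : MeanLe F p (extNear U e x) (Metric.infDist x U) a)
    (hG : MeanLe G q (extNear U e x) (Metric.infDist x U) b) :
    Metric.infDist (extGrad U e δ u g x) 𝒜 ≤ ringC d e * C * (a + b) := by
  have he := hU.jones.e_pos
  obtain ⟨n, hn1, hn2⟩ := exists_scale h0 h2
  have hl := hU.scl_pos n
  have hr := ratioC_pos (d := d) he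
  have hF' := hU.meanLe_nearSet (l := scl U δ n) hp (by linarith) (by linarith) hF
  have hG' := hU.meanLe_nearSet (l := scl U δ n) hq (by linarith) (by linarith) hG
  refine (hU.infDist_extGrad_le hg hui hgi (β := C * ratioC d e * (4 ^ d * a + 4 ^ d * b))
    (by positivity) hn1 hn2 fun z hz =>
      hO.oscAt hp hq he hU.jones.e_le_one hl (by positivity) (by positivity) hF' hG' hz).trans (le_of_eq ?_)
  rw [ringC]; ring

/-- Constant of the lower order term in the exterior gradient estimate. -/
noncomputable def _root_.lowC (d : ℕ) (e : ℝ) : ℝ := extLowC d e * (meanC d (25 / e) * 4 ^ d)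

theorem _root_.lowC_nonneg (he : 0 < e) : 0 ≤ lowC d e := by
  have := extLowC_nonneg (d := d) he
  have := one_le_meanC d (25 / e)
  unfold lowC; positivity

theorem _root_.nearSet_subset_closedBall : nearSet U e l x ⊆ Metric.closedBall x (25 / e * l) :=
  fun _ hw => by rw [Metric.mem_closedBall, div_mul_eq_mul_div]; exact hw.2.1

theorem integral_nearSet_le (hU : IsExtensionDomain U e δ) (hui : IntegrableOn u U) (hr : 1 ≤ r)
    (hl : 0 < l) (h1 : l ≤ 2 * Metric.infDist x U) (h2 : Metric.infDist x U ≤ 4 * l) (hc : 0 ≤ c)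
    (hu : MeanLe u r (extNear U e x) (Metric.infDist x U) c) :
    (l ^ d)⁻¹ * ∫ w in nearSet U e l x, ‖u w‖ ≤ meanC d (25 / e) * 4 ^ d * c := by
  have he := hU.jones.e_pos
  have h := ((hU.meanLe_nearSet hr h1 h2 hu).integral_le hr (by positivity) hl
    (by positivity) (hui.mono_set nearSet_subset).1 nearSet_subset_closedBall).2
  rw [inv_mul_le_iff₀ (by positivity)]
  refine h.trans (le_of_eq ?_)
  ring

theorem infDist_extGrad_le_mean_of_far (hU : IsExtensionDomain U e δ) (hg : IsWeakGradient U u g)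
    (hui : IntegrableOn u U) (hgi : IntegrableOn g U) (hO : OscControl U g 𝒜 p q F G C) (hC : 0 ≤ C)
    (hp : 1 ≤ p) (hq : 1 ≤ q) (hr : 1 ≤ r) (h1 : 2 * scl U δ 0 < Metric.infDist x U)
    (h2 : Metric.infDist x U ≤ 4 * scl U δ 0)
    (ha : 0 ≤ a) (hb : 0 ≤ b) (hc : 0 ≤ c) (hF : MeanLe F p (extNear U e x) (Metric.infDist x U) a)
    (hG : MeanLe G q (extNear U e x) (Metric.infDist x U) b)
    (hu : MeanLe u r (extNear U e x) (Metric.infDist x U) c) :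
    Metric.infDist (extGrad U e δ u g x) 𝒜 ≤ ringC d e * C * (a + b) +
      lowC d e * (scl U δ 0)⁻¹ * c := by
  have he := hU.jones.e_pos
  have hl := hU.scl_pos 0
  have hr' := ratioC_pos (d := d) he
  have hF' := hU.meanLe_nearSet (l := scl U δ 0) hp (by linarith) (by linarith) hF
  have hG' := hU.meanLe_nearSet (l := scl U δ 0) hq (by linarith) (by linarith) hG
  refine (hU.infDist_extGrad_le_of_far hg hui hgi (β := C * ratioC d e * (4 ^ d * a + 4 ^ d * b))
    (by positivity) h1 h2 fun z hz =>
      hO.oscAt hp hq he hU.jones.e_le_one hl (by positivity) (by positivity) hF' hG' hz).trans ?_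
  have h3 := hU.integral_nearSet_le hui hr hl (by linarith) h2 hc hu
  have h4 := extLowC_nonneg (d := d) he
  refine add_le_add (le_of_eq (by rw [ringC]; ring)) ?_
  calc _ ≤ extLowC d e * ((scl U δ 0)⁻¹ * (meanC d (25 / e) * 4 ^ d * c)) := by gcongr
    _ = _ := by rw [lowC]; ring

/-- Constant of the exterior estimate for the extension itself. -/
noncomputable def _root_.extFnC (d : ℕ) (e : ℝ) : ℝ :=
  (1 + 2 * supC d) * (supC d * (crudeC d e * (meanC d (25 / e) * 4 ^ d)))

theorem _root_.extFnC_nonneg (he : 0 < e) : 0 ≤ extFnC d e := by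
  have := one_le_meanC d (25 / e)
  have hs := supC_nonneg d
  have hr := crudeC_pos d he
  unfold extFnC; positivity

/-- No gradient is involved: each active `scaleExt` is bounded by the local mean of `u`, by the
crude bound for Taylor polynomials. There are at most two active scales. -/
theorem norm_extFn_le_mean (hU : IsExtensionDomain U e δ)
    (hui : IntegrableOn u U) (hr : 1 ≤ r) (h0 : 0 < Metric.infDist x U) (hc : 0 ≤ c)
    (hu : MeanLe u r (extNear U e x) (Metric.infDist x U) c) :
    ‖extFn U e δ u x‖ ≤ extFnC d e * c := by
  have he := hU.jones.e_pos
  have hint : Integrable (U.indicator u) := hui.integrable_indicator hU.isOpen.measurableSet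
  have hs := supC_nonneg d
  have hcr := crudeC_pos d he
  have hm := one_le_meanC d (25 / e)
  set A := supC d * (crudeC d e * (meanC d (25 / e) * 4 ^ d * c)) with hA
  have hA0 : 0 ≤ A := by positivity
  have key : ∀ n, scl U δ n ≤ 2 * Metric.infDist x U → Metric.infDist x U ≤ 4 * scl U δ n →
      ‖scaleExt U e δ n (U.indicator u) x‖ ≤ A := by
    intro n h1 h2
    have hl := hU.scl_pos n
    have k := (hU.norm_scaleExt_sub_const_le hint h2 0 (by simpa using hint.integrableOn)).1
    have hI : ∫ w in nearSet U e (scl U δ n) x, ‖U.indicator u w - 0‖ =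
        ∫ w in nearSet U e (scl U δ n) x, ‖u w‖ :=
      setIntegral_congr_fun (measurableSet_nearSet hU.isOpen.measurableSet) fun y hy => by
        simp [nearSet_subset hy]
    rw [hI, sub_zero, mul_assoc (crudeC d e)] at k
    refine k.trans ?_
    have := hU.integral_nearSet_le hui hr hl h1 h2 hc hu
    rw [hA]
    gcongr
  have hE : extFnC d e * c = (1 + 2 * supC d) * A := by rw [extFnC, hA]; ring
  rw [hE]
  by_cases h4 : Metric.infDist x U ≤ 4 * scl U δ 0
  · by_cases h2 : Metric.infDist x U ≤ 2 * scl U δ 0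
    · obtain ⟨n, hn1, hn2⟩ := exists_scale h0 h2
      have hl := hU.scl_pos n
      rw [(hU.extFn_eq (g := fun _ => 0) (N := n + 1) (by rw [scl_succ]; linarith)).1, hU.approxExt_succ_eq (by linarith)]
      have k1 := key n (by linarith) (by linarith)
      have k2 := key (n + 1) (by rw [scl_succ]; linarith) (by rw [scl_succ]; linarith)
      have k3 := (hU.norm_cutoff_le (n + 1) x).1
      calc _ ≤ A + supC d * (A + A) := by
            refine (norm_add_le _ _).trans ?_
            rw [norm_smul]
            gcongr
            exact (norm_sub_le _ _).trans (by gcongr)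
        _ = _ := by ring
    · have hl := hU.scl_pos 0
      rw [(hU.extFn_eq (g := fun _ => 0) (N := 0) (by linarith)).1]
      have k1 := key 0 (by linarith) h4
      have k3 := (hU.norm_cutoff_le 0 x).1
      simp only [approxExt, Finset.range_zero, Finset.sum_empty, add_zero]
      rw [norm_smul]
      calc _ ≤ supC d * A := by gcongr
        _ ≤ _ := by nlinarith [mul_nonneg hs hA0]
  · rw [(hU.extGrad_eq_zero (g := fun _ => 0) (not_le.1 h4)).1, norm_zero]
    positivity

/-- Constant of the estimate for consecutive approximations. -/
noncomputable def _root_.stepC (d : ℕ) (e : ℝ) : ℝ := supC d * (2 * (supC d * (roughC d e * ratioC d e)))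

theorem _root_.stepC_nonneg (he : 0 < e) : 0 ≤ stepC d e := by
  have hs := supC_nonneg d
  have hr := roughC_pos d he
  have := ratioC_pos (d := d) he
  unfold stepC; positivity

/-- The gain is the factor `scl U δ n`: summed over `n`, the errors form a geometric series. -/
theorem norm_approxExt_succ_sub_le (hU : IsExtensionDomain U e δ) (hg : IsWeakGradient U u g)
    (hui : IntegrableOn u U) (hgi : IntegrableOn g U) (hO : OscControl U g 𝒜 p q F G C) (hC : 0 ≤ C)
    (hp : 1 ≤ p) (hq : 1 ≤ q) (ha : 0 ≤ a) (hb : 0 ≤ b)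
    (hF : MeanLe F p (nearSet U e (scl U δ n) x) (scl U δ n) a)
    (hG : MeanLe G q (nearSet U e (scl U δ n) x) (scl U δ n) b) :
    ‖approxExt U e δ (n + 1) (U.indicator u) x - approxExt U e δ n (U.indicator u) x‖ ≤
      stepC d e * C * scl U δ n * (a + b) := by
  have he := hU.jones.e_pos
  have hl := hU.scl_pos n
  have hs := supC_nonneg d
  have hr := roughC_pos d he
  have hr' := ratioC_pos (d := d) he
  have e1 : approxExt U e δ (n + 1) (U.indicator u) x - approxExt U e δ n (U.indicator u) x =
      cutoff U δ (n + 1) x •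
        (scaleExt U e δ (n + 1) (U.indicator u) x - scaleExt U e δ n (U.indicator u) x) := by
    rw [approxExt, approxExt, Finset.sum_range_succ]; abel
  rw [e1, norm_smul]
  by_cases hx : Metric.infDist x U ≤ 2 * scl U δ n
  · obtain ⟨M, -, -, h2⟩ := hU.exists_gradient_approx hg hui hgi (by linarith) fun z hz =>
      hO.oscAt hp hq he hU.jones.e_le_one hl ha hb hF hG hz
    have h3 := (h2 hx).2
    have k3 := (hU.norm_cutoff_le (n + 1) x).1
    calc _ ≤ supC d * (2 * (supC d * (roughC d e * scl U δ n * (C * ratioC d e * (a + b))))) := by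
          gcongr
      _ = _ := by rw [stepC]; ring
  · rw [hU.cutoff_eq_zero (by rw [scl_succ]; linarith), norm_zero, zero_mul]
    have := stepC_nonneg (d := d) he
    positivity

end IsExtensionDomain

end control

/-! ### Convergence in `W^{1,1}` of the approximations, and the null boundary -/

section convergence

variable {d : ℕ} {U : Set (Vec d)} {e δ : ℝ} {f u : Vec d → Vec d} {g : Vec d → Mat d}
  {𝒜 : Set (Mat d)} {x z : Vec d} {n m N : ℕ} {p q r : ℝ≥0∞}

theorem exists_infDist_le_subset_closedBall (hb : Bornology.IsBounded U) (hne : U.Nonempty) (s : ℝ) :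
    ∃ y R, {x : Vec d | Metric.infDist x U ≤ s} ⊆ Metric.closedBall y R := by
  obtain ⟨y, hy⟩ := hne
  obtain ⟨R, hR⟩ := hb.subset_closedBall y
  refine ⟨y, s + 1 + R, fun x hx => ?_⟩
  obtain ⟨w, hw, hxw⟩ := (Metric.infDist_lt_iff ⟨y, hy⟩).1
    (lt_of_le_of_lt hx (lt_add_one s))
  have h1 := Metric.mem_closedBall.1 (hR hw)
  rw [Metric.mem_closedBall]
  linarith [dist_triangle x w y]

theorem volume_infDist_le_lt_top (hb : Bornology.IsBounded U) (hne : U.Nonempty) (s : ℝ) :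
    volume {x : Vec d | Metric.infDist x U ≤ s} < ⊤ := by
  obtain ⟨y, R, h⟩ := exists_infDist_le_subset_closedBall hb hne s
  exact (measure_mono h).trans_lt measure_closedBall_lt_top

theorem ballVol_pos (d : ℕ) : 0 < ballVol d :=
  ENNReal.toReal_pos (Metric.measure_closedBall_pos _ _ one_pos).ne' measure_closedBall_lt_top.ne

namespace IsExtensionDomain

/-- The strip around `U` has finite volume, and `nearSet` lies in a ball of radius proportional to
the scale, so convergence of local means applies. -/
theorem tendsto_lintegral_strip {E : Type*} [NormedAddCommGroup E] [NormedSpace ℝ E]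
    (hU : IsExtensionDomain U e δ) {f : Vec d → E} (hf : IntegrableOn f U) {v : ℕ → Vec d → E} {C : ℝ}
    (hC : 0 ≤ C) (h : ∀ n x, Metric.infDist x U ≤ 4 * scl U δ n → ∀ ξ, ‖v n x - ξ‖ ≤
      C * ((scl U δ n ^ d)⁻¹ * ∫ y in nearSet U e (scl U δ n) x, ‖f y - ξ‖)) :
    Tendsto (fun n => ∫⁻ x in {x | Metric.infDist x U ≤ 4 * scl U δ n}, ‖v n x - U.indicator f x‖ₑ)
      atTop (𝓝 0) := by
  have he := hU.jones.e_pos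
  refine tendsto_lintegral_sub_of_local_mean (O' := {x | Metric.infDist x U ≤ 4 * scl U δ 0})
    (C := C) (C' := 25 / e)
    hU.isOpen.measurableSet hf hU.scl_pos tendsto_scl (fun n => measurableSet_infDist_le _)
    (fun n x hx => ?_) (volume_infDist_le_lt_top hU.isBounded hU.nonempty _).ne hC (by positivity)
    fun n x hx ξ => (h n x hx ξ).trans ?_
  · have := hU.scl_antitone (Nat.zero_le n)
    simp only [mem_ofPred_eq] at hx ⊢
    linarith
  · have hl := hU.scl_pos n
    refine mul_le_mul_of_nonneg_left (mul_le_mul_of_nonneg_left ?_ (by positivity)) hC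
    refine setIntegral_mono_set (f := fun y => ‖f y - ξ‖) ?_ (Eventually.of_forall fun _ => norm_nonneg _)
      (LE.le.eventuallyLE ?_)
    · exact ((hf.mono_set inter_subset_left).sub (integrableOn_const
        ((measure_mono inter_subset_right).trans_lt measure_closedBall_lt_top).ne)).norm
    · exact subset_inter nearSet_subset nearSet_subset_closedBall

theorem integrableOn_sub_const {E : Type*} [NormedAddCommGroup E]
    {f : Vec d → E} (hf : IntegrableOn f U) {l : ℝ} (ξ : E) :
    IntegrableOn (fun y => f y - ξ) (nearSet U e l x) :=
  (hf.mono_set nearSet_subset).sub (integrableOn_const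
    ((measure_mono nearSet_subset_closedBall).trans_lt measure_closedBall_lt_top).ne)

/-- The closure of an extension domain differs from the domain by a null set. -/
theorem ae_mem_or_pos (hU : IsExtensionDomain U e δ) :
    ∀ᵐ x, x ∈ U ∨ 0 < Metric.infDist x U := by
  have he := hU.jones.e_pos
  have hτ := scaleRatio_pos d he
  have hb := ballVol_pos d
  -- Apply the strip convergence to the constant one. Its hypothesis says that `nearSet` has volume
  -- at least a multiple of `l ^ d`, which holds because it contains a ball around a reflection. On
  -- the boundary the integrand is one at every scale, so the boundary is null.
  have h1 := hU.tendsto_lintegral_strip (f := fun _ => (1 : ℝ)) (v := fun _ _ => 1)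
    (C := (scaleRatio d e ^ d * ballVol d)⁻¹)
    (integrableOn_const hU.isBounded.measure_lt_top.ne) (by positivity) (by
      intro n x hx ξ
      have hl := hU.scl_pos n
      obtain ⟨z, hzU, hzx, hzf⟩ := hU.jones.exists_reflection hU.nonempty hU.le_diam hl (hU.scl_lt' n)
        (by linarith : Metric.infDist x U ≤ 5 * scl U δ n)
      have ha := Admissible.of_near he hU.jones.e_le_one hl hzU (hzx.le.trans (by linarith) : dist z x ≤ 8 * scl U δ n)
        (by have := mul_pos he hl; linarith)
      have hsub := ha.closedBall_subset he hU.jones.e_le_one hl (r := scaleRatio d e * scl U δ n) (by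
        have : (0 : ℝ) ≤ d := Nat.cast_nonneg d
        have := mul_pos hτ hl
        nlinarith)
      rw [setIntegral_const, smul_eq_mul]
      have hv : (scaleRatio d e * scl U δ n) ^ d * ballVol d ≤ volume.real (nearSet U e (scl U δ n) x) := by
        rw [← ENNReal.ofReal_le_ofReal_iff measureReal_nonneg, ofReal_measureReal
          ((measure_mono nearSet_subset_closedBall).trans_lt measure_closedBall_lt_top).ne,
          ← volume_closedBall (by positivity) z]
        exact measure_mono hsub
      have hl' : 0 < scl U δ n ^ d := by positivity
      calc ‖(1 : ℝ) - ξ‖ = (scaleRatio d e ^ d * ballVol d)⁻¹ * ((scl U δ n ^ d)⁻¹ *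
            ((scaleRatio d e * scl U δ n) ^ d * ballVol d * ‖(1 : ℝ) - ξ‖)) := by
            rw [mul_pow]; field_simp
        _ ≤ _ := by gcongr)
  have h2 : ∀ n, volume {x : Vec d | x ∉ U ∧ Metric.infDist x U ≤ 0} ≤
      ∫⁻ x in {x | Metric.infDist x U ≤ 4 * scl U δ n}, ‖(1 : ℝ) - U.indicator (fun _ => (1 : ℝ)) x‖ₑ := by
    intro n
    have hm : MeasurableSet {x : Vec d | x ∉ U ∧ Metric.infDist x U ≤ 0} :=
      hU.isOpen.measurableSet.compl.inter (measurableSet_infDist_le 0)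
    rw [← setLIntegral_one]
    calc ∫⁻ x in {x : Vec d | x ∉ U ∧ Metric.infDist x U ≤ 0}, 1 =
        ∫⁻ x in {x : Vec d | x ∉ U ∧ Metric.infDist x U ≤ 0}, ‖(1 : ℝ) - U.indicator (fun _ => (1 : ℝ)) x‖ₑ := by
          refine setLIntegral_congr_fun hm fun x hx => ?_
          simp [indicator_of_notMem hx.1]
      _ ≤ _ := lintegral_mono_set fun x hx => by
          have := hU.scl_pos n
          have := hx.2
          simp only [mem_ofPred_eq]
          linarith
  have h3 : volume {x : Vec d | x ∉ U ∧ Metric.infDist x U ≤ 0} = 0 :=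
    le_antisymm (ge_of_tendsto' h1 h2) zero_le
  rw [ae_iff]
  refine measure_mono_null (fun x hx => ?_) h3
  simpa [not_or] using hx

theorem restrict_union (hU : IsExtensionDomain U e δ) :
    (volume : Measure (Vec d)).restrict (U ∪ {x | 0 < Metric.infDist x U}) = volume :=
  Measure.restrict_eq_self_of_ae_mem hU.ae_mem_or_pos

theorem disjoint_exterior : Disjoint U {x | 0 < Metric.infDist x U} :=
  disjoint_left.2 fun x hx h => (show 0 < Metric.infDist x U from h).ne' (Metric.infDist_zero_of_mem hx)

theorem lintegral_eq_add (hU : IsExtensionDomain U e δ) (h : Vec d → ℝ≥0∞) :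
    ∫⁻ x, h x = (∫⁻ x in U, h x) + ∫⁻ x in {x | 0 < Metric.infDist x U}, h x := by
  conv_lhs => rw [← hU.restrict_union]
  exact lintegral_union (measurableSet_lt_infDist 0) disjoint_exterior

theorem aestronglyMeasurable_of_restrict {E : Type*} [TopologicalSpace E]
    [TopologicalSpace.PseudoMetrizableSpace E] (hU : IsExtensionDomain U e δ)
    {f : Vec d → E} (h1 : AEStronglyMeasurable f (volume.restrict U))
    (h2 : AEStronglyMeasurable f (volume.restrict {x | 0 < Metric.infDist x U})) :
    AEStronglyMeasurable f volume := by
  rw [← hU.restrict_union]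
  exact aestronglyMeasurable_union_iff.2 ⟨h1, h2⟩

theorem eventually_extFn_eq (hU : IsExtensionDomain U e δ) (hx : 0 < Metric.infDist x U) :
    ∀ᶠ N in atTop, approxExt U e δ N (U.indicator f) x = extFn U e δ f x ∧
      toMat (fderiv ℝ (approxExt U e δ N (U.indicator f)) x) = extGrad U e δ f g x := by
  have : Tendsto (fun N => 7 / 4 * scl U δ N) atTop (𝓝 0) := by
    simpa using (tendsto_scl (U := U) (δ := δ)).const_mul (7 / 4)
  filter_upwards [(tendsto_order.1 this).2 _ hx] with N hN
  obtain ⟨h1, h2⟩ := hU.extFn_eq (f := f) (g := g) hN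
  exact ⟨h1.symm, h2.symm⟩

theorem aestronglyMeasurable_ext (hU : IsExtensionDomain U e δ) (hui : IntegrableOn u U)
    (hgi : IntegrableOn g U) :
    AEStronglyMeasurable (extFn U e δ u) volume ∧ AEStronglyMeasurable (extGrad U e δ u g) volume := by
  have hint : Integrable (U.indicator u) := hui.integrable_indicator hU.isOpen.measurableSet
  have hX : ∀ᵐ x ∂volume.restrict {x | 0 < Metric.infDist x U}, 0 < Metric.infDist x U :=
    ae_restrict_mem (measurableSet_lt_infDist 0)
  constructor
  · refine hU.aestronglyMeasurable_of_restrict (hui.1.congr ?_) ?_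
    · filter_upwards [ae_restrict_mem hU.isOpen.measurableSet] with x hx
      rw [extFn_of_mem hx]
    · refine aestronglyMeasurable_of_tendsto_ae atTop
        (fun N => (hU.contDiff_approxExt hint N).continuous.aestronglyMeasurable) ?_
      filter_upwards [hX] with x hx
      exact tendsto_const_nhds.congr' ((hU.eventually_extFn_eq (g := g) hx).mono fun N h => h.1.symm)
  · refine hU.aestronglyMeasurable_of_restrict (hgi.1.congr ?_) ?_
    · filter_upwards [ae_restrict_mem hU.isOpen.measurableSet] with x hx
      rw [extGrad_of_mem hx]
    · refine aestronglyMeasurable_of_tendsto_ae atTop (fun N => (toMat.continuous.comp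
        ((hU.contDiff_approxExt hint N).continuous_fderiv (by simp))).aestronglyMeasurable) ?_
      filter_upwards [hX] with x hx
      exact tendsto_const_nhds.congr' ((hU.eventually_extFn_eq (g := g) hx).mono fun N h => h.2.symm)

/-- The bound for the gradient is the estimate of its distance from `{0}`, with `F` the norm of `g`
and `G = 0`. -/
theorem lintegral_exterior_le (hU : IsExtensionDomain U e δ) (hg : IsWeakGradient U u g)
    (hui : IntegrableOn u U) (hgi : IntegrableOn g U) :
    (∫⁻ x in {x | 0 < Metric.infDist x U}, ‖extFn U e δ u x‖ₑ ≤
      ENNReal.ofReal (extFnC d e * avgC d e) * ∫⁻ x in U, ‖u x‖ₑ) ∧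
    ∫⁻ x in {x | 0 < Metric.infDist x U}, ‖extGrad U e δ u g x‖ₑ ≤
      ENNReal.ofReal (ringC d e * meanC d (3 * (d + 1)) * avgC d e) * (∫⁻ x in U, ‖g x‖ₑ) +
        ENNReal.ofReal (lowC d e * (scl U δ 0)⁻¹ * avgC d e) * ∫⁻ x in U, ‖u x‖ₑ := by
  have he := hU.jones.e_pos
  have h1 := extFnC_nonneg (d := d) he
  have h2 := one_le_avgC (d := d) (e := e)
  have h3 := ringC_pos (d := d) he
  have h4 := one_le_meanC d (3 * (d + 1))
  have h5 := lowC_nonneg (d := d) he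
  have hl := hU.scl_pos 0
  have hm := measurableSet_lt_infDist (U := U) 0
  obtain ⟨Φ, Φm, Φ0, hΦ, hΦx⟩ := hU.exists_exterior_mean le_rfl (F := u) le_rfl
    (by rw [innerPart_zero]; exact memLp_one_iff_integrable.2 hui)
  obtain ⟨Γ, Γm, Γ0, hΓ, hΓx⟩ := hU.exists_exterior_mean le_rfl (F := fun y => ‖g y‖) le_rfl
    (by rw [innerPart_zero]; exact memLp_one_iff_integrable.2 hgi.norm)
  rw [innerPart_zero, eLpNorm_one_eq_lintegral_enorm, eLpNorm_one_eq_lintegral_enorm] at hΦ hΓ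
  have hΦe : ∀ x, ‖Φ x‖ₑ = ENNReal.ofReal (Φ x) := fun x => Real.enorm_eq_ofReal (Φ0 x)
  have hΓe : ∀ x, ‖Γ x‖ₑ = ENNReal.ofReal (Γ x) := fun x => Real.enorm_eq_ofReal (Γ0 x)
  simp only [hΦe] at hΦ
  simp only [hΓe, enorm_norm] at hΓ
  constructor
  · calc _ ≤ ∫⁻ x in {x | 0 < Metric.infDist x U}, ENNReal.ofReal (extFnC d e) * ENNReal.ofReal (Φ x) := by
          refine setLIntegral_mono' hm fun x hx => ?_
          rw [← ofReal_norm, ← ENNReal.ofReal_mul h1]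
          exact ENNReal.ofReal_le_ofReal (hU.norm_extFn_le_mean hui le_rfl hx (Φ0 x) (hΦx x hx))
      _ ≤ ENNReal.ofReal (extFnC d e) * (ENNReal.ofReal (avgC d e) * ∫⁻ x in U, ‖u x‖ₑ) := by
          rw [lintegral_const_mul' _ _ ENNReal.ofReal_ne_top]
          gcongr
      _ = _ := by rw [ENNReal.ofReal_mul h1, mul_assoc]
  · set A := ringC d e * meanC d (3 * (d + 1)) with hA
    set B := lowC d e * (scl U δ 0)⁻¹ with hB
    have hA0 : 0 ≤ A := by positivity
    have hB0 : 0 ≤ B := by positivity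
    have hO := oscControl_zero hgi
    calc _ ≤ ∫⁻ x in {x | 0 < Metric.infDist x U}, (ENNReal.ofReal A * ENNReal.ofReal (Γ x) +
          ENNReal.ofReal B * ENNReal.ofReal (Φ x)) := by
          refine setLIntegral_mono' hm fun x hx => ?_
          have hx : 0 < Metric.infDist x U := hx
          rw [← ofReal_norm, ← ENNReal.ofReal_mul hA0, ← ENNReal.ofReal_mul hB0,
            ← ENNReal.ofReal_add (mul_nonneg hA0 (Γ0 x)) (mul_nonneg hB0 (Φ0 x))]
          refine ENNReal.ofReal_le_ofReal ?_
          have hz : MeanLe (fun _ : Vec d => (0 : ℝ)) 1 (extNear U e x) (Metric.infDist x U) 0 := by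
            simp [MeanLe]
          have hA1 := mul_nonneg hA0 (Γ0 x)
          have hB1 := mul_nonneg hB0 (Φ0 x)
          have hd0 : ‖extGrad U e δ u g x‖ = Metric.infDist (extGrad U e δ u g x) {0} := by
            rw [Metric.infDist_singleton, dist_zero_right]
          rw [hd0]
          by_cases hx2 : Metric.infDist x U ≤ 2 * scl U δ 0
          · have := hU.infDist_extGrad_le_mean hg hui hgi hO (by linarith) le_rfl le_rfl hx hx2 (Γ0 x) le_rfl
              (hΓx x hx) hz
            rw [add_zero] at this
            linarith
          · by_cases hx4 : Metric.infDist x U ≤ 4 * scl U δ 0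
            · have := hU.infDist_extGrad_le_mean_of_far hg hui hgi hO (by linarith) le_rfl le_rfl le_rfl
                (not_le.1 hx2) hx4 (Γ0 x) le_rfl (Φ0 x) (hΓx x hx) hz (hΦx x hx)
              rwa [add_zero] at this
            · rw [(hU.extGrad_eq_zero (not_le.1 hx4)).2, Metric.infDist_singleton, dist_self]
              linarith
      _ ≤ ENNReal.ofReal A * (ENNReal.ofReal (avgC d e) * ∫⁻ x in U, ‖g x‖ₑ) +
          ENNReal.ofReal B * (ENNReal.ofReal (avgC d e) * ∫⁻ x in U, ‖u x‖ₑ) := by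
          rw [lintegral_add_left (Γm.ennreal_ofReal.const_mul _),
            lintegral_const_mul' _ _ ENNReal.ofReal_ne_top, lintegral_const_mul' _ _ ENNReal.ofReal_ne_top]
          gcongr
      _ = _ := by rw [ENNReal.ofReal_mul hA0, ENNReal.ofReal_mul hB0, mul_assoc, mul_assoc]

theorem integrable_ext (hU : IsExtensionDomain U e δ) (hg : IsWeakGradient U u g)
    (hui : IntegrableOn u U) (hgi : IntegrableOn g U) :
    Integrable (extFn U e δ u) ∧ Integrable (extGrad U e δ u g) := by
  obtain ⟨m1, m2⟩ := hU.aestronglyMeasurable_ext hui hgi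
  obtain ⟨l1, l2⟩ := hU.lintegral_exterior_le hg hui hgi
  have hu : ∫⁻ x in U, ‖u x‖ₑ < ⊤ := hui.2
  have hg' : ∫⁻ x in U, ‖g x‖ₑ < ⊤ := hgi.2
  have hm := hU.isOpen.measurableSet
  refine ⟨⟨m1, ?_⟩, ⟨m2, ?_⟩⟩
  · rw [HasFiniteIntegral, hU.lintegral_eq_add,
      setLIntegral_congr_fun (g := fun x => ‖u x‖ₑ) hm fun x hx => by rw [extFn_of_mem hx]]
    exact ENNReal.add_lt_top.2 ⟨hu, l1.trans_lt (ENNReal.mul_lt_top ENNReal.ofReal_lt_top hu)⟩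
  · rw [HasFiniteIntegral, hU.lintegral_eq_add,
      setLIntegral_congr_fun (g := fun x => ‖g x‖ₑ) hm fun x hx => by rw [extGrad_of_mem hx]]
    exact ENNReal.add_lt_top.2 ⟨hg', l2.trans_lt (ENNReal.add_lt_top.2
      ⟨ENNReal.mul_lt_top ENNReal.ofReal_lt_top hg', ENNReal.mul_lt_top ENNReal.ofReal_lt_top hu⟩)⟩

/-- Convergence of approximations that agree with the limit away from the boundary. -/
theorem tendsto_of_strip {E : Type*} [NormedAddCommGroup E] (hU : IsExtensionDomain U e δ)
    {v s : ℕ → Vec d → E} {w f : Vec d → E} (hw : Integrable w)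
    (h1 : ∀ n x, 2 * scl U δ n < Metric.infDist x U → v n x = w x)
    (h2 : ∀ n x, Metric.infDist x U ≤ 2 * scl U δ n → v n x = s n x)
    (h3 : ∀ x ∈ U, w x = f x)
    (hs : Tendsto (fun n => ∫⁻ x in {x | Metric.infDist x U ≤ 4 * scl U δ n}, ‖s n x - U.indicator f x‖ₑ)
      atTop (𝓝 0)) :
    Tendsto (fun n => ∫⁻ x, ‖v n x - w x‖ₑ) atTop (𝓝 0) := by
  set X := {x : Vec d | 0 < Metric.infDist x U} with hX
  set S : ℕ → Set (Vec d) := fun n => {x | Metric.infDist x U ≤ 2 * scl U δ n} ∩ X with hS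
  have hSm : ∀ n, MeasurableSet (S n) := fun n => (measurableSet_infDist_le _).inter (measurableSet_lt_infDist 0)
  -- The exterior parts of the strips decrease to the empty set, so the limit function has small
  -- integral on them.
  have hvol : Tendsto (volume ∘ S) atTop (𝓝 0) := by
    have hi : ⋂ n, S n = ∅ := by
      refine eq_empty_of_forall_notMem fun x hx => ?_
      have hx := mem_iInter.1 hx
      have h0 : 0 < Metric.infDist x U := (hx 0).2
      have ht : Tendsto (fun n => 2 * scl U δ n) atTop (𝓝 0) := by
        simpa using (tendsto_scl (U := U) (δ := δ)).const_mul 2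
      obtain ⟨n, hn⟩ := ((tendsto_order.1 ht).2 _ h0).exists
      exact absurd (hx n).1 (not_le.2 hn)
    have := tendsto_measure_iInter_atTop (μ := volume) (s := S) (fun n => (hSm n).nullMeasurableSet)
      (fun a b hab x hx => ⟨by
        have := hU.scl_antitone hab
        have h' : Metric.infDist x U ≤ 2 * scl U δ b := hx.1
        show Metric.infDist x U ≤ 2 * scl U δ a
        linarith, hx.2⟩) ⟨0, ((measure_mono inter_subset_left).trans_lt
          (volume_infDist_le_lt_top hU.isBounded hU.nonempty _)).ne⟩
    rwa [hi, measure_empty] at this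
  have hlim := tendsto_setLIntegral_zero (μ := volume) (f := fun x => ‖w x‖ₑ) hw.2.ne hvol
  have hsum := hs.add hlim
  rw [add_zero] at hsum
  refine tendsto_of_tendsto_of_tendsto_of_le_of_le tendsto_const_nhds hsum (fun _ => zero_le) fun n => ?_
  have hn := hU.scl_pos n
  have hAm := measurableSet_infDist_le (U := U) (2 * scl U δ n)
  calc ∫⁻ x, ‖v n x - w x‖ₑ ≤ ∫⁻ x, ({x | Metric.infDist x U ≤ 4 * scl U δ n}.indicator
        (fun x => ‖s n x - U.indicator f x‖ₑ) x + (S n).indicator (fun x => ‖w x‖ₑ) x) := by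
        refine lintegral_mono_ae ?_
        filter_upwards [hU.ae_mem_or_pos] with x hx
        by_cases hx2 : Metric.infDist x U ≤ 2 * scl U δ n
        · have hx4 : x ∈ {x | Metric.infDist x U ≤ 4 * scl U δ n} := by
            show Metric.infDist x U ≤ 4 * scl U δ n
            linarith
          rw [h2 n x hx2, indicator_of_mem hx4]
          rcases hx with hx | hx
          · rw [indicator_of_mem hx, h3 x hx]; exact le_self_add
          · have hxU : x ∉ U := fun h => hx.ne' (Metric.infDist_zero_of_mem h)
            rw [indicator_of_notMem hxU, indicator_of_mem (show x ∈ S n from ⟨hx2, hx⟩), sub_zero]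
            exact enorm_sub_le
        · rw [h1 n x (not_le.1 hx2), sub_self, enorm_zero]; exact zero_le
    _ = _ := by
        rw [lintegral_add_right' _ ((hw.1.enorm).indicator (hSm n)), lintegral_indicator (measurableSet_infDist_le _),
          lintegral_indicator (hSm n)]

/-- Away from a thin strip the approximation already equals the extension. In the strip it is a
single `scaleExt`, whose distance from any constant is bounded by a local mean of the distance of
the data from that constant. -/
theorem tendsto_approxExt (hU : IsExtensionDomain U e δ) (hg : IsWeakGradient U u g)
    (hui : IntegrableOn u U) (hgi : IntegrableOn g U) :
    Tendsto (fun n => ∫⁻ x, ‖approxExt U e δ n (U.indicator u) x - extFn U e δ u x‖ₑ) atTop (𝓝 0) ∧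
    Tendsto (fun n => ∫⁻ x, ‖toMat (fderiv ℝ (approxExt U e δ n (U.indicator u)) x) -
      extGrad U e δ u g x‖ₑ) atTop (𝓝 0) := by
  have he := hU.jones.e_pos
  have hτ := scaleRatio_pos d he
  have hint : Integrable (U.indicator u) := hui.integrable_indicator hU.isOpen.measurableSet
  have hm := hU.isOpen.measurableSet
  have hsc := supC_nonneg d
  have hcr := crudeC_pos d he
  have hec := extGradC_pos (d := d) he
  obtain ⟨i1, i2⟩ := hU.integrable_ext hg hui hgi
  constructor
  · refine hU.tendsto_of_strip (s := fun n => scaleExt U e δ n (U.indicator u)) (f := u) i1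
      (fun n x hx => ((hU.extFn_eq (g := g) (by linarith [hU.scl_pos n])).1).symm)
      (fun n x hx => hU.approxExt_eq_scaleExt (by linarith [hU.scl_pos n]))
      (fun x hx => extFn_of_mem hx) ?_
    refine hU.tendsto_lintegral_strip hui (C := supC d * crudeC d e) (by positivity) fun n x hx ξ => ?_
    have hS : IntegrableOn (fun w => U.indicator u w - ξ) (nearSet U e (scl U δ n) x) :=
      (integrableOn_sub_const (e := e) (x := x) hui ξ).congr_fun
        (fun y hy => by simp only [indicator_of_mem (nearSet_subset hy)]) (measurableSet_nearSet hm)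
    refine (hU.norm_scaleExt_sub_const_le hint hx ξ hS).1.trans (le_of_eq ?_)
    rw [setIntegral_congr_fun (g := fun w => ‖u w - ξ‖) (measurableSet_nearSet hm)
      fun y hy => by simp only [indicator_of_mem (nearSet_subset hy)]]
    ring
  · refine hU.tendsto_of_strip (s := fun n x => toMat (fderiv ℝ (scaleExt U e δ n (U.indicator u)) x)) (f := g) i2
      (fun n x hx => ((hU.extFn_eq (g := g) (by linarith [hU.scl_pos n])).2).symm)
      (fun n x hx => ?_)
      (fun x hx => extGrad_of_mem hx) ?_
    · congr 1
      refine EventuallyEq.fderiv_eq ?_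
      filter_upwards [eventually_infDist_lt (by linarith [hU.scl_pos n] : Metric.infDist x U < 5 / 2 * scl U δ n)]
        with y hy
      exact hU.approxExt_eq_scaleExt hy
    · refine hU.tendsto_lintegral_strip hgi (C := extGradC d e * (scaleRatio d e ^ d)⁻¹) (by positivity)
        fun n x hx ξ => ?_
      have hl := hU.scl_pos n
      have hi := integrableOn_sub_const (e := e) (x := x) (l := scl U δ n) hgi ξ
      have hI : 0 ≤ ∫ y in nearSet U e (scl U δ n) x, ‖g y - ξ‖ := integral_nonneg fun _ => norm_nonneg _
      -- With a singleton as target, the gradient estimate measures the distance from `ξ`, and `M =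
      -- ξ` gives the oscillation condition by definition of `β`.
      have := hU.infDist_fderiv_scaleExt_le hg hui hgi (𝒜 := {ξ})
        (β := (scaleRatio d e ^ d)⁻¹ * ((scl U δ n ^ d)⁻¹ * ∫ y in nearSet U e (scl U δ n) x, ‖g y - ξ‖))
        (by positivity) hx fun z hz => ⟨ξ, ?_, ?_⟩
      · rw [Metric.infDist_singleton, dist_eq_norm] at this
        refine this.trans (le_of_eq ?_)
        ring
      · have e1 : (scaleRatio d e * scl U δ n) ^ d * ((scaleRatio d e ^ d)⁻¹ * ((scl U δ n ^ d)⁻¹ *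
            ∫ y in nearSet U e (scl U δ n) x, ‖g y - ξ‖)) = ∫ y in nearSet U e (scl U δ n) x, ‖g y - ξ‖ := by
          rw [mul_pow]; field_simp
        rw [e1]
        refine setIntegral_mono_set hi.norm (Eventually.of_forall fun _ => norm_nonneg _) (LE.le.eventuallyLE ?_)
        refine hz.closedBall_subset he hU.jones.e_le_one hl ?_
        have : (0 : ℝ) ≤ d := Nat.cast_nonneg d
        have := mul_pos hτ hl
        nlinarith
      · rw [Metric.infDist_singleton, dist_self]; positivity

theorem isWeakGradient_ext (hU : IsExtensionDomain U e δ) (hg : IsWeakGradient U u g)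
    (hui : IntegrableOn u U) (hgi : IntegrableOn g U) :
    IsWeakGradient univ (extFn U e δ u) (extGrad U e δ u g) := by
  have hint : Integrable (U.indicator u) := hui.integrable_indicator hU.isOpen.measurableSet
  obtain ⟨i1, i2⟩ := hU.integrable_ext hg hui hgi
  obtain ⟨t1, t2⟩ := hU.tendsto_approxExt hg hui hgi
  exact isWeakGradient_of_tendsto_L1 (fun n => (hU.contDiff_approxExt hint n).of_le (by simp)) i1 i2 t1 t2

end IsExtensionDomain

end convergence

/-! ### Linearity and the extension operator on equivalence classes -/

section operator

variable {d : ℕ} {U : Set (Vec d)} {e δ : ℝ} {f f' u v : Vec d → Vec d} {g h : Vec d → Mat d}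
  {x : Vec d} {n N : ℕ} {t l c : ℝ}

theorem taylor_add (ht : 0 < t) (hf : LocallyIntegrable f) (hf' : LocallyIntegrable f') (z x : Vec d) :
    taylor t (f + f') z x = taylor t f z x + taylor t f' z x := by
  have e1 : mollify t (f + f') = mollify t f + mollify t f' := mollify_add ht hf hf'
  rw [taylor, e1, fderiv_add (differentiable_mollify ht hf z) (differentiable_mollify ht hf' z)]
  simp only [taylor, Pi.add_apply, _root_.add_apply]
  abel

theorem taylor_const_smul (ht : 0 < t) (hf : LocallyIntegrable f) (c : ℝ) (z x : Vec d) :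
    taylor t (c • f) z x = c • taylor t f z x := by
  have e1 : mollify t (c • f) = c • mollify t f := mollify_const_smul c
  rw [taylor, e1, fderiv_const_smul (differentiable_mollify ht hf z)]
  simp only [taylor, Pi.smul_apply, _root_.smul_apply, smul_add]

theorem rough_add (hl : 0 < l) (he : 0 < e) (hf : LocallyIntegrable f) (hf' : LocallyIntegrable f') :
    rough U e l (f + f') = rough U e l f + rough U e l f' := by
  ext1 y
  simp only [rough, Pi.add_apply]
  split_ifs
  · exact taylor_add (mul_pos (scaleRatio_pos d he) hl) hf hf' _ _
  · simp

theorem rough_const_smul (hl : 0 < l) (he : 0 < e) (hf : LocallyIntegrable f) (c : ℝ) :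
    rough U e l (c • f) = c • rough U e l f := by
  ext1 y
  simp only [rough, Pi.smul_apply]
  split_ifs
  · exact taylor_const_smul (mul_pos (scaleRatio_pos d he) hl) hf c _ _
  · simp

theorem approxExt_congr_ae (h : f =ᵐ[volume] f') : approxExt U e δ N f = approxExt U e δ N f' := by
  have h1 : ∀ n, scaleExt U e δ n f = scaleExt U e δ n f' := fun n => by
    have : rough U e (scl U δ n) f = rough U e (scl U δ n) f' := by
      ext1 y
      have hm : ∀ t, mollify t f = mollify t f' := fun t => mollify_congr_ae h
      simp only [rough, taylor, hm]
    rw [scaleExt, scaleExt, this]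
  ext1 x
  simp only [approxExt, h1]

namespace IsExtensionDomain

theorem scaleExt_add (hU : IsExtensionDomain U e δ) (hf : Integrable f) (hf' : Integrable f') (n : ℕ) :
    scaleExt U e δ n (f + f') = scaleExt U e δ n f + scaleExt U e δ n f' := by
  rw [scaleExt, rough_add (hU.scl_pos n) hU.jones.e_pos hf.locallyIntegrable hf'.locallyIntegrable]
  exact mollify_add (hU.scl_pos n) (hU.locallyIntegrable_rough hf n) (hU.locallyIntegrable_rough hf' n)

theorem scaleExt_const_smul (hU : IsExtensionDomain U e δ) (hf : Integrable f) (c : ℝ) (n : ℕ) :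
    scaleExt U e δ n (c • f) = c • scaleExt U e δ n f := by
  rw [scaleExt, rough_const_smul (hU.scl_pos n) hU.jones.e_pos hf.locallyIntegrable]
  exact mollify_const_smul c

theorem approxExt_add (hU : IsExtensionDomain U e δ) (hf : Integrable f) (hf' : Integrable f') (N : ℕ)
    (x : Vec d) :
    approxExt U e δ N (f + f') x = approxExt U e δ N f x + approxExt U e δ N f' x := by
  simp only [approxExt, hU.scaleExt_add hf hf', Pi.add_apply]
  rw [add_add_add_comm, ← smul_add, ← Finset.sum_add_distrib]
  congr 1
  refine Finset.sum_congr rfl fun n _ => ?_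
  rw [← smul_add]
  congr 1
  abel

theorem approxExt_const_smul (hU : IsExtensionDomain U e δ) (hf : Integrable f) (c : ℝ) (N : ℕ)
    (x : Vec d) : approxExt U e δ N (c • f) x = c • approxExt U e δ N f x := by
  simp only [approxExt, hU.scaleExt_const_smul hf, Pi.smul_apply]
  rw [smul_add, smul_comm, Finset.smul_sum]
  congr 1
  refine Finset.sum_congr rfl fun n _ => ?_
  rw [← smul_sub, smul_comm]

/-- Sobolev functions are classes, so sums of representatives agree with representatives of sums
only almost everywhere; linearity of the operator needs this invariance. -/
theorem extFn_congr_ae (hU : IsExtensionDomain U e δ) (h : f =ᵐ[volume.restrict U] f') :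
    extFn U e δ f =ᵐ[volume] extFn U e δ f' := by
  have h1 := (ae_restrict_iff' hU.isOpen.measurableSet).1 h
  have h2 : U.indicator f =ᵐ[volume] U.indicator f' := by
    filter_upwards [h1] with x hx
    by_cases hxU : x ∈ U
    · rw [indicator_of_mem hxU, indicator_of_mem hxU, hx hxU]
    · rw [indicator_of_notMem hxU, indicator_of_notMem hxU]
  filter_upwards [h1] with x hx
  by_cases hxU : x ∈ U
  · rw [extFn_of_mem hxU, extFn_of_mem hxU, hx hxU]
  · simp only [extFn, if_neg hxU, approxExt_congr_ae h2]

theorem extFn_add (hU : IsExtensionDomain U e δ) (hf : IntegrableOn f U) (hf' : IntegrableOn f' U) :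
    extFn U e δ (f + f') = extFn U e δ f + extFn U e δ f' := by
  have hm := hU.isOpen.measurableSet
  ext1 x
  simp only [extFn, Pi.add_apply]
  split_ifs
  · rfl
  · simp
  · rw [indicator_add', hU.approxExt_add (hf.integrable_indicator hm) (hf'.integrable_indicator hm)]

theorem extFn_const_smul (hU : IsExtensionDomain U e δ) (hf : IntegrableOn f U) (c : ℝ) :
    extFn U e δ (c • f) = c • extFn U e δ f := by
  have hm := hU.isOpen.measurableSet
  ext1 x
  simp only [extFn, Pi.smul_apply]
  split_ifs
  · rfl
  · simp
  · have : U.indicator (c • f) = c • U.indicator f := indicator_const_smul U c f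
    rw [this, hU.approxExt_const_smul (hf.integrable_indicator hm)]

theorem aestronglyMeasurable_extFn (hU : IsExtensionDomain U e δ) (w : W11 U) :
    AEStronglyMeasurable (extFn U e δ (sobFn w)) volume :=
  (hU.aestronglyMeasurable_ext (sobGrad_spec w).2.1 (sobGrad_spec w).2.2).1

/-- The extension operator. -/
noncomputable def extOp (hU : IsExtensionDomain U e δ) : W11 U →ₗ[ℝ] W11loc d where
  toFun w := ⟨AEEqFun.mk (extFn U e δ (sobFn w)) (hU.aestronglyMeasurable_extFn w),
    extGrad U e δ (sobFn w) (sobGrad w), by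
      obtain ⟨h1, h2, h3⟩ := sobGrad_spec w
      exact (hU.isWeakGradient_ext h1 h2 h3).congr_ae
        (ae_mono Measure.restrict_le_self (AEEqFun.coeFn_mk _ _).symm)⟩
  map_add' v w := by
    refine Subtype.ext ?_
    show AEEqFun.mk _ _ = AEEqFun.mk _ _ + AEEqFun.mk _ _
    rw [AEEqFun.mk_add_mk, AEEqFun.mk_eq_mk]
    rw [← hU.extFn_add (sobGrad_spec v).2.1 (sobGrad_spec w).2.1]
    exact hU.extFn_congr_ae (AEEqFun.coeFn_add _ _)
  map_smul' c w := by
    refine Subtype.ext ?_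
    show AEEqFun.mk _ _ = c • AEEqFun.mk _ _
    rw [AEEqFun.smul_mk, AEEqFun.mk_eq_mk, ← hU.extFn_const_smul (sobGrad_spec w).2.1]
    exact hU.extFn_congr_ae (AEEqFun.coeFn_smul _ _)

theorem locFn_extOp (hU : IsExtensionDomain U e δ) (w : W11 U) :
    locFn (hU.extOp w) =ᵐ[volume] extFn U e δ (sobFn w) :=
  AEEqFun.coeFn_mk _ _

theorem locGrad_extOp (hU : IsExtensionDomain U e δ) (w : W11 U) :
    locGrad (hU.extOp w) =ᵐ[volume] extGrad U e δ (sobFn w) (sobGrad w) := by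
  obtain ⟨h1, h2, h3⟩ := sobGrad_spec w
  have k1 := locGrad_spec (hU.extOp w)
  have k2 := (hU.isWeakGradient_ext h1 h2 h3).congr_ae
    (ae_mono Measure.restrict_le_self (hU.locFn_extOp w).symm)
  have := IsWeakGradient.ae_unique isOpen_univ k1 k2
  rwa [Measure.restrict_univ] at this

theorem exists_bound_extOp (hU : IsExtensionDomain U e δ) : ∃ C : ℝ≥0, ∀ w : W11 U,
    eLpNorm (locFn (hU.extOp w)) 1 volume + eLpNorm (locGrad (hU.extOp w)) 1 volume ≤
      C * (eLpNorm (sobFn w) 1 (volume.restrict U) + eLpNorm (sobGrad w) 1 (volume.restrict U)) := by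
  set A := (extFnC d e * avgC d e).toNNReal with hA
  set B := (ringC d e * meanC d (3 * (d + 1)) * avgC d e).toNNReal with hB
  set D := (lowC d e * (scl U δ 0)⁻¹ * avgC d e).toNNReal with hD
  refine ⟨1 + A + B + D, fun w => ?_⟩
  obtain ⟨h1, h2, h3⟩ := sobGrad_spec w
  obtain ⟨l1, l2⟩ := hU.lintegral_exterior_le h1 h2 h3
  have hm := hU.isOpen.measurableSet
  rw [eLpNorm_congr_ae (hU.locFn_extOp w), eLpNorm_congr_ae (hU.locGrad_extOp w)]
  simp only [eLpNorm_one_eq_lintegral_enorm]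
  rw [hU.lintegral_eq_add, hU.lintegral_eq_add (fun x => ‖extGrad _ _ _ _ _ x‖ₑ),
    setLIntegral_congr_fun (f := fun x => ‖extFn U e δ (sobFn w) x‖ₑ) (g := fun x => ‖sobFn w x‖ₑ) hm
      fun x hx => by simp only [extFn_of_mem hx],
    setLIntegral_congr_fun (f := fun x => ‖extGrad U e δ (sobFn w) (sobGrad w) x‖ₑ)
      (g := fun x => ‖sobGrad w x‖ₑ) hm fun x hx => by simp only [extGrad_of_mem hx]]
  set I := ∫⁻ x in U, ‖sobFn w x‖ₑ
  set J := ∫⁻ x in U, ‖sobGrad w x‖ₑ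
  calc _ ≤ (I + A * I) + (J + (B * J + D * I)) := add_le_add (add_le_add le_rfl l1) (add_le_add le_rfl l2)
    _ ≤ (I + A * I) + (J + (B * J + D * I)) + (B * I + (A * J + D * J)) := le_self_add
    _ = _ := by push_cast; ring

theorem extOp_eq_of_mem (hU : IsExtensionDomain U e δ) (w : W11 U) :
    ∀ᵐ x ∂(volume.restrict U), locFn (hU.extOp w) x = sobFn w x := by
  filter_upwards [ae_restrict_of_ae (hU.locFn_extOp w), ae_restrict_mem hU.isOpen.measurableSet] with x hx hxU
  rw [hx, extFn_of_mem hxU]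

theorem extOp_eq_zero (hU : IsExtensionDomain U e δ) (w : W11 U) :
    ∀ᵐ x ∂volume, x ∉ outerNhd U (jonesRadius U δ * (1 / 8)) → locFn (hU.extOp w) x = 0 := by
  filter_upwards [hU.locFn_extOp w] with x hx hxU
  rw [hx]
  refine (hU.extGrad_eq_zero (g := fun _ => 0) ?_).1
  rw [scl_zero_eq]
  have : jonesRadius U δ * (1 / 8) < Metric.infDist x U := not_le.1 hxU
  linarith

end IsExtensionDomain

end operator

/-! ### Rescaling, and rigidity at all scales -/

section scaling

variable {d : ℕ} {U Ω : Set (Vec d)} {u : Vec d → Vec d} {g : Vec d → Mat d}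
  {𝒜 : Set (Mat d)} {x z : Vec d} {t l : ℝ} {p q : ℝ≥0∞}

/-- The affine map `y ↦ z + t y`. -/
noncomputable def scaleMap (z : Vec d) (ht : t ≠ 0) : Vec d ≃ₜ Vec d :=
  (Homeomorph.smulOfNeZero t ht).trans (Homeomorph.addLeft z)

theorem scaleMap_apply (ht : t ≠ 0) (y : Vec d) : scaleMap z ht y = z + t • y := rfl

theorem scaleMap_symm_apply (ht : t ≠ 0) (y : Vec d) : (scaleMap z ht).symm y = t⁻¹ • (y - z) := by
  rw [Homeomorph.symm_apply_eq, scaleMap_apply, smul_smul, mul_inv_cancel₀ ht, one_smul]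
  abel

theorem map_scaleMap (ht : t ≠ 0) :
    Measure.map (scaleMap z ht) volume = ENNReal.ofReal |(t ^ d)⁻¹| • (volume : Measure (Vec d)) := by
  have e : (scaleMap z ht : Vec d → Vec d) = (fun y => z + y) ∘ fun y => t • y := rfl
  rw [e, ← Measure.map_map (measurable_const_add z) (measurable_const_smul t),
    Measure.map_addHaar_smul volume ht, Measure.map_smul, map_add_left_eq_self]
  simp

theorem map_restrict_scaleMap (ht : t ≠ 0) (S : Set (Vec d)) :
    Measure.map (scaleMap z ht) (volume.restrict S) =
      ENNReal.ofReal |(t ^ d)⁻¹| • volume.restrict (scaleMap z ht '' S) := by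
  have h := (scaleMap z ht).measurableEmbedding.restrict_map volume (scaleMap z ht '' S)
  rw [preimage_image_eq _ (scaleMap z ht).injective, map_scaleMap] at h
  rw [← h, Measure.restrict_smul]

theorem ae_scaleMap (ht : t ≠ 0) {S : Set (Vec d)} {P : Vec d → Prop}
    (h : ∀ᵐ x ∂volume.restrict (scaleMap z ht '' S), P x) :
    ∀ᵐ y ∂volume.restrict S, P (scaleMap z ht y) := by
  refine ae_of_ae_map (scaleMap z ht).measurable.aemeasurable ?_
  rw [map_restrict_scaleMap]
  exact Measure.ae_smul_measure h _

theorem setIntegral_scaleMap {E : Type*} [NormedAddCommGroup E] [NormedSpace ℝ E] (ht : t ≠ 0)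
    (S : Set (Vec d)) (f : Vec d → E) :
    ∫ y in S, f (scaleMap z ht y) = |(t ^ d)⁻¹| • ∫ x in scaleMap z ht '' S, f x := by
  rw [← (scaleMap z ht).measurableEmbedding.integral_map, map_restrict_scaleMap, integral_smul_measure,
    ENNReal.toReal_ofReal (abs_nonneg _)]

theorem aestronglyMeasurable_scaleMap {E : Type*} [NormedAddCommGroup E] (ht : t ≠ 0) {S : Set (Vec d)}
    {f : Vec d → E} (hf : AEStronglyMeasurable f (volume.restrict (scaleMap z ht '' S))) :
    AEStronglyMeasurable (fun y => f (scaleMap z ht y)) (volume.restrict S) := by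
  refine AEStronglyMeasurable.comp_measurable (g := f) ?_ (scaleMap z ht).measurable
  rw [map_restrict_scaleMap]
  exact hf.smul_measure _

theorem eLpNorm_scaleMap {E : Type*} [NormedAddCommGroup E] (ht : 0 < t) {S : Set (Vec d)}
    {f : Vec d → E} (hf : AEStronglyMeasurable f (volume.restrict (scaleMap z ht.ne' '' S))) :
    eLpNorm (fun y => f (scaleMap z ht.ne' y)) p (volume.restrict S) =
      ENNReal.ofReal ((t ^ d)⁻¹) ^ (1 / p.toReal) *
        eLpNorm f p (volume.restrict (scaleMap z ht.ne' '' S)) := by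
  have hpos : 0 < (t ^ d)⁻¹ := by positivity
  have e := (eLpNorm_map_measure (p := p) (μ := volume.restrict S) (f := scaleMap z ht.ne') (g := f)
    (by rw [map_restrict_scaleMap]; exact hf.smul_measure _) (scaleMap z ht.ne').measurable.aemeasurable)
  rw [map_restrict_scaleMap, abs_of_pos hpos, eLpNorm_smul_measure_of_ne_zero
    (ENNReal.ofReal_pos.2 hpos).ne', smul_eq_mul,
    show (1 / p).toReal = 1 / p.toReal by rw [one_div, ENNReal.toReal_inv, one_div]] at e
  exact e.symm

theorem integrableOn_scaleMap {E : Type*} [NormedAddCommGroup E] (ht : 0 < t) {S : Set (Vec d)}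
    {f : Vec d → E} (hf : IntegrableOn f (scaleMap z ht.ne' '' S)) :
    IntegrableOn (fun y => f (scaleMap z ht.ne' y)) S := by
  refine memLp_one_iff_integrable.1 ⟨aestronglyMeasurable_scaleMap ht.ne' hf.1, ?_⟩
  rw [eLpNorm_scaleMap ht hf.1]
  refine ENNReal.mul_lt_top (ENNReal.rpow_lt_top_of_nonneg (by positivity) ENNReal.ofReal_ne_top)
    (memLp_one_iff_integrable.2 hf).2

/-- Weak gradients of rescaled functions. -/
theorem IsWeakGradient.scale (ht : 0 < t) {S : Set (Vec d)}
    (hg : IsWeakGradient (scaleMap z ht.ne' '' S) u g)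
    (hui : IntegrableOn u (scaleMap z ht.ne' '' S)) (hgi : IntegrableOn g (scaleMap z ht.ne' '' S)) :
    IsWeakGradient S (fun y => t⁻¹ • u (scaleMap z ht.ne' y)) (fun y => g (scaleMap z ht.ne' y)) := by
  refine ⟨IntegrableOn.locallyIntegrableOn (Integrable.smul t⁻¹ (integrableOn_scaleMap ht hui)),
    (integrableOn_scaleMap ht hgi).locallyIntegrableOn, fun φ hφ hc hs i j => ?_⟩
  set σ := scaleMap z ht.ne' with hσ
  set ψ : Vec d → ℝ := fun x => φ (t⁻¹ • (x - z)) with hψ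
  have hψσ : ψ = φ ∘ σ.symm := by
    ext1 x; simp only [hψ, Function.comp, hσ, scaleMap_symm_apply]
  have hψd : ContDiff ℝ ∞ ψ := hφ.comp ((contDiff_id.sub contDiff_const).const_smul t⁻¹)
  have hts : tsupport ψ = σ '' tsupport φ := by
    rw [hψσ, tsupport_comp_eq_preimage]
    exact (σ.toEquiv.image_eq_preimage_symm _).symm
  have hψc : HasCompactSupport ψ := by
    rw [HasCompactSupport, hts]
    exact hc.isCompact.image σ.continuous
  have key := hg.2.2 ψ hψd hψc (by rw [hts]; exact image_mono hs) i j
  have hfd : ∀ y, fderiv ℝ φ y (EuclideanSpace.single j 1) =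
      t * fderiv ℝ ψ (σ y) (EuclideanSpace.single j 1) := by
    intro y
    have e1 : φ = fun y => ψ (z + t • y) := by
      ext1 y
      simp only [hψ, add_sub_cancel_left, smul_smul, inv_mul_cancel₀ ht.ne', one_smul]
    have h1 : HasFDerivAt (fun y : Vec d => z + t • y) (t • ContinuousLinearMap.id ℝ (Vec d)) y :=
      ((hasFDerivAt_id y).const_smul t).const_add z
    have h2 : HasFDerivAt ψ (fderiv ℝ ψ (σ y)) (z + t • y) :=
      (hψd.differentiable (by simp) _).hasFDerivAt
    have h3 := (h2.comp y h1).fderiv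
    have e2 : fderiv ℝ φ y = (fderiv ℝ ψ (σ y)).comp (t • ContinuousLinearMap.id ℝ (Vec d)) := by
      rw [← h3]; congr 1
    rw [e2]
    simp
  have e1 : ∀ y, (t⁻¹ • u (σ y)) i * fderiv ℝ φ y (EuclideanSpace.single j 1) =
      (fun x => u x i * fderiv ℝ ψ x (EuclideanSpace.single j 1)) (σ y) := by
    intro y
    simp only [PiLp.smul_apply, smul_eq_mul, hfd]
    field_simp
  have e2 : ∀ y, g (σ y) (i, j) * φ y = (fun x => g x (i, j) * ψ x) (σ y) := by
    intro y
    simp only [hψσ, Function.comp, Homeomorph.symm_apply_apply]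
  simp only [e1, e2]
  have k1 := setIntegral_scaleMap (z := z) ht.ne' S
    fun x => u x i * fderiv ℝ ψ x (EuclideanSpace.single j 1)
  have k2 := setIntegral_scaleMap (z := z) ht.ne' S fun x => g x (i, j) * ψ x
  rw [← hσ] at k1 k2
  rw [k1, k2, key, smul_neg]

theorem isOpen_openCube (a : Vec d) (l : ℝ) : IsOpen (openCube a l) := by
  have : openCube a l = ⋂ i, {x : Vec d | |x i - a i| < l / 2} := by
    ext x; simp [openCube]
  rw [this]
  refine isOpen_iInter_of_finite fun i => isOpen_lt ?_ continuous_const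
  exact (((EuclideanSpace.proj (𝕜 := ℝ) i).continuous).sub continuous_const).abs

theorem openCube_subset_closedBall (hl : l / 2 ≤ 3) :
    openCube (0 : Vec d) l ⊆ Metric.closedBall 0 (3 * (d + 1)) := by
  intro x hx
  rw [mem_closedBall_zero_iff, EuclideanSpace.norm_eq]
  refine Real.sqrt_le_iff.2 ⟨by positivity, ?_⟩
  have hd : (0 : ℝ) ≤ d := Nat.cast_nonneg d
  calc ∑ i, ‖x i‖ ^ 2 ≤ ∑ _i : Fin d, (9 : ℝ) := Finset.sum_le_sum fun i _ => by
        have h := hx i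
        rw [PiLp.zero_apply, sub_zero, ← Real.norm_eq_abs] at h
        have h0 := norm_nonneg (x i)
        nlinarith
    _ = d * 9 := by simp
    _ ≤ _ := by nlinarith

theorem closedBall_subset_openCube {s : ℝ} (hs : s < l / 2) :
    Metric.closedBall (0 : Vec d) s ⊆ openCube 0 l := by
  intro x hx i
  rw [mem_closedBall_zero_iff] at hx
  rw [PiLp.zero_apply, sub_zero, ← Real.norm_eq_abs]
  exact ((PiLp.norm_apply_le x i).trans hx).trans_lt hs

theorem image_scaleMap_closedBall (ht : 0 < t) (s : ℝ) :
    scaleMap z ht.ne' '' Metric.closedBall 0 s = Metric.closedBall z (s * t) := by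
  ext x
  constructor
  · rintro ⟨y, hy, rfl⟩
    rw [mem_closedBall_zero_iff] at hy
    rw [Metric.mem_closedBall, dist_eq_norm, scaleMap_apply, add_sub_cancel_left, norm_smul,
      Real.norm_of_nonneg ht.le, mul_comm]
    gcongr
  · intro hx
    refine ⟨(scaleMap z ht.ne').symm x, ?_, (scaleMap z ht.ne').apply_symm_apply x⟩
    rw [Metric.mem_closedBall, dist_eq_norm] at hx
    rw [mem_closedBall_zero_iff, scaleMap_symm_apply, norm_smul, norm_inv, Real.norm_of_nonneg ht.le,
      inv_mul_le_iff₀ ht, mul_comm]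
    exact hx

/-- Rigidity on a fixed cube controls the oscillation of the gradient at all scales. -/
theorem RigidityOnCubes.exists_oscControl (hR : RigidityOnCubes 𝒜 p q) (hp : 1 ≤ p) (hq : 1 ≤ q) :
    ∃ C : ℝ, 0 ≤ C ∧ ∀ (U : Set (Vec d)) (u : Vec d → Vec d) (g : Vec d → Mat d),
      IsWeakGradient U u g → IntegrableOn u U → IntegrableOn g U → ∀ F G : Vec d → ℝ,
        IsDecomp₂ (volume.restrict U) p q (distTo g 𝒜) F G → OscControl U g 𝒜 p q F G C := by
  -- Edge length `5` makes the cube contain the ball of radius `2` from `OscAt`, while the enlarged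
  -- cube has half-edge below `3` and fits into the ball of radius `3 * (d + 1)`. A single cube
  -- provides a constant independent of `z`, `t` and `U`.
  obtain ⟨c, hc, hrig⟩ := hR 0 5 (by norm_num)
  set K : ℝ := meanC d (3 * (d + 1)) with hK
  have hK1 : 1 ≤ K := one_le_meanC _ _
  have hb := ballVol_pos d
  refine ⟨(1 + (ballVol d)⁻¹) * (K * (1 + c)), by positivity, ?_⟩
  intro U u g hg hui hgi F G hdec z t a b ht ha hb' hball hFa hGb
  set σ := scaleMap z ht.ne' with hσ
  set Qp : Set (Vec d) := openCube 0 (33 / 32 * 5) with hQp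
  set Q : Set (Vec d) := openCube 0 5 with hQ
  have hQpb : Qp ⊆ Metric.closedBall 0 (3 * (d + 1)) := openCube_subset_closedBall (by norm_num)
  have hQQp : Q ⊆ Qp := fun x hx i => (hx i).trans (by norm_num)
  have hQb : Q ⊆ Metric.closedBall 0 (3 * (d + 1) * 1) := by rw [mul_one]; exact hQQp.trans hQpb
  have him : σ '' Qp ⊆ Metric.closedBall z (3 * (d + 1) * t) := by
    rw [← image_scaleMap_closedBall ht]; exact image_mono hQpb
  have himU : σ '' Qp ⊆ U := him.trans hball
  have hres : ∀ {P : Vec d → Prop}, (∀ᵐ x ∂volume.restrict U, P x) → ∀ᵐ y ∂volume.restrict Qp, P (σ y) :=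
    fun h => ae_scaleMap ht.ne' (ae_mono (Measure.restrict_mono himU le_rfl) h)
  have hwg := IsWeakGradient.scale ht (hg.mono himU) (hui.mono_set himU) (hgi.mono_set himU)
  set u' : Vec d → Vec d := fun y => t⁻¹ • u (σ y) with hu'
  set g' : Vec d → Mat d := fun y => g (σ y) with hg'
  have hui' : IntegrableOn u' Qp := (integrableOn_scaleMap ht (hui.mono_set himU)).smul t⁻¹
  have hgi' : IntegrableOn g' Qp := integrableOn_scaleMap ht (hgi.mono_set himU)
  have hcoe : (AEEqFun.mk u' hui'.1 : Vec d →ₘ[volume.restrict Qp] Vec d) =ᵐ[volume.restrict Qp] u' :=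
    AEEqFun.coeFn_mk _ _
  -- Dividing the values by `t` leaves the gradient, and so its distance from `𝒜`, unchanged under
  -- rescaling.
  set w : W11 Qp := ⟨AEEqFun.mk u' hui'.1, g', hwg.congr_ae hcoe.symm, hui'.congr hcoe.symm, hgi'⟩ with hw
  have hgrad : sobGrad w =ᵐ[volume.restrict Qp] g' :=
    IsWeakGradient.ae_unique (isOpen_openCube _ _) (sobGrad_spec w).1 (hwg.congr_ae hcoe.symm)
  have hF' : MemLp F p (volume.restrict (σ '' Qp)) := hdec.memLp_left.mono_measure (Measure.restrict_mono himU le_rfl)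
  have hG' : MemLp G q (volume.restrict (σ '' Qp)) := hdec.memLp_right.mono_measure (Measure.restrict_mono himU le_rfl)
  have hnorm : ∀ {r : ℝ≥0∞} {f : Vec d → ℝ} {m : ℝ}, AEStronglyMeasurable f (volume.restrict (σ '' Qp)) →
      MeanLe f r (Metric.closedBall z (3 * (d + 1) * t)) t m →
      eLpNorm (fun y => f (σ y)) r (volume.restrict Qp) ≤ ENNReal.ofReal m := by
    intro r f m hf hm
    rw [hσ, eLpNorm_scaleMap ht hf]
    calc _ ≤ ENNReal.ofReal ((t ^ d)⁻¹) ^ (1 / r.toReal) *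
          (ENNReal.ofReal (t ^ d) ^ (1 / r.toReal) * ENNReal.ofReal m) := by
          gcongr
          exact hm.mono him
      _ = ENNReal.ofReal m := by
          rw [← mul_assoc, ← ENNReal.mul_rpow_of_nonneg _ _ (by positivity),
            ← ENNReal.ofReal_mul (by positivity), inv_mul_cancel₀ (by positivity), ENNReal.ofReal_one,
            ENNReal.one_rpow, one_mul]
  have nF := hnorm hF'.1 hFa
  have nG := hnorm hG'.1 hGb
  have mF := aestronglyMeasurable_scaleMap ht.ne' hF'.1
  have mG := aestronglyMeasurable_scaleMap ht.ne' hG'.1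
  obtain ⟨M, F1, G1, hd1, n1, n2⟩ := hrig w (fun y => F (σ y)) (fun y => G (σ y))
    ⟨by
      filter_upwards [hgrad, hres hdec.eq_add] with y h1 h2
      rw [← h2]; simp only [distTo, h1, hg'], ⟨mF, nF.trans_lt ENNReal.ofReal_lt_top⟩,
      ⟨mG, nG.trans_lt ENNReal.ofReal_lt_top⟩⟩
  have hle : ∀ {r : ℝ≥0∞} {E : Type} [NormedAddCommGroup E] {f : Vec d → E} {m : ℝ}, 1 ≤ r → 0 ≤ m →
      AEStronglyMeasurable f (volume.restrict Q) → eLpNorm f r (volume.restrict Q) ≤ ENNReal.ofReal m →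
      IntegrableOn f Q ∧ ∫ y in Q, ‖f y‖ ≤ K * m := by
    intro r E _ f m hr hm hf hfm
    have := MeanLe.integral_le (F := f) (p := r) (T := Q) (t := 1) (a := m) (R := 3 * (d + 1)) (x := 0)
      (by simpa [MeanLe] using hfm) hr hm one_pos (by positivity) hf hQb
    simpa using this
  have hcm : ∀ m : ℝ, (c : ℝ≥0∞) * ENNReal.ofReal m = ENNReal.ofReal (c * m) := fun m => by
    rw [ENNReal.ofReal_mul c.coe_nonneg, ENNReal.ofReal_coe_nnreal]
  have hQle : (volume : Measure (Vec d)).restrict Q ≤ volume.restrict Qp := Measure.restrict_mono hQQp le_rfl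
  obtain ⟨iF1, bF1⟩ := hle hp (by positivity) hd1.memLp_left.1 (n1.trans ((by gcongr : _ ≤ (c : ℝ≥0∞) * ENNReal.ofReal a).trans_eq (hcm a)))
  obtain ⟨iG1, bG1⟩ := hle hq (by positivity) hd1.memLp_right.1 (n2.trans ((by gcongr : _ ≤ (c : ℝ≥0∞) * ENNReal.ofReal b).trans_eq (hcm b)))
  obtain ⟨iF, bF⟩ := hle hp ha (mF.mono_measure hQle) ((eLpNorm_mono_measure _ hQle).trans nF)
  obtain ⟨iG, bG⟩ := hle hq hb' (mG.mono_measure hQle) ((eLpNorm_mono_measure _ hQle).trans nG)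
  have hgQ : ∀ᵐ y ∂volume.restrict Q, g' y - M = F1 y + G1 y := by
    filter_upwards [hd1.eq_add, ae_mono hQle hgrad] with y h1 h2
    rw [← h1, h2]
  have hdQ : ∀ᵐ y ∂volume.restrict Q, Metric.infDist (g' y) 𝒜 = F (σ y) + G (σ y) :=
    ae_mono hQle (hres hdec.eq_add)
  refine ⟨M, ?_, ?_⟩
  · have h2 : Metric.closedBall (0 : Vec d) 2 ⊆ Q := closedBall_subset_openCube (by norm_num)
    have e1 : ∫ y in Metric.closedBall z (2 * t), ‖g y - M‖ =
        t ^ d * ∫ y in Metric.closedBall (0 : Vec d) 2, ‖g' y - M‖ := by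
      have := setIntegral_scaleMap (z := z) ht.ne' (Metric.closedBall 0 2) fun x => ‖g x - M‖
      rw [image_scaleMap_closedBall ht, abs_of_pos (by positivity : 0 < (t ^ d)⁻¹), smul_eq_mul] at this
      rw [hg', hσ, this, mul_inv_cancel_left₀ (by positivity)]
    rw [e1]
    have hsum : IntegrableOn (fun y => ‖F1 y‖ + ‖G1 y‖) Q := iF1.norm.add iG1.norm
    have h3 : ∫ y in Metric.closedBall (0 : Vec d) 2, ‖g' y - M‖ ≤ ∫ y in Q, (‖F1 y‖ + ‖G1 y‖) := by
      calc _ ≤ ∫ y in Metric.closedBall (0 : Vec d) 2, (‖F1 y‖ + ‖G1 y‖) := by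
            refine integral_mono_of_nonneg (Eventually.of_forall fun _ => norm_nonneg _) (hsum.mono_set h2) ?_
            filter_upwards [ae_mono (Measure.restrict_mono h2 le_rfl) hgQ] with y hy
            rw [hy]; exact norm_add_le _ _
        _ ≤ _ := setIntegral_mono_set hsum (Eventually.of_forall fun _ => by positivity) (LE.le.eventuallyLE h2)
    rw [integral_add iF1.norm iG1.norm] at h3
    gcongr
    have h4 : 0 ≤ K * (a + b) + (ballVol d)⁻¹ * (K * (1 + c)) * (a + b) := by positivity
    linarith
  · have h2 : Metric.closedBall (0 : Vec d) 1 ⊆ Q := closedBall_subset_openCube (by norm_num)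
    have hsum : IntegrableOn (fun y => ‖F1 y‖ + ‖G1 y‖ + (‖F (σ y)‖ + ‖G (σ y)‖)) Q :=
      (iF1.norm.add iG1.norm).add (iF.norm.add iG.norm)
    -- The distance of the constant `M` from `𝒜` is at most that of `g'` plus the norm of `g' - M`;
    -- averaging over the unit ball bounds it by the means.
    have h3 : ballVol d * Metric.infDist M 𝒜 ≤ ∫ y in Q, (‖F1 y‖ + ‖G1 y‖ + (‖F (σ y)‖ + ‖G (σ y)‖)) := by
      calc ballVol d * Metric.infDist M 𝒜 = ∫ _y in Metric.closedBall (0 : Vec d) 1, Metric.infDist M 𝒜 := by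
            rw [setIntegral_const, smul_eq_mul, ballVol]
        _ ≤ ∫ y in Metric.closedBall (0 : Vec d) 1, (‖F1 y‖ + ‖G1 y‖ + (‖F (σ y)‖ + ‖G (σ y)‖)) := by
            refine integral_mono_of_nonneg (Eventually.of_forall fun _ => Metric.infDist_nonneg)
              (hsum.mono_set h2) ?_
            filter_upwards [ae_mono (Measure.restrict_mono h2 le_rfl) hgQ,
              ae_mono (Measure.restrict_mono h2 le_rfl) hdQ] with y h5 h6
            have h7 := Metric.infDist_le_infDist_add_dist (s := 𝒜) (x := M) (y := g' y)
            rw [dist_comm, dist_eq_norm, h5, h6] at h7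
            have h8 := norm_add_le (F1 y) (G1 y)
            have h9 := Real.le_norm_self (F (σ y))
            have h10 := Real.le_norm_self (G (σ y))
            linarith
        _ ≤ _ := setIntegral_mono_set hsum (Eventually.of_forall fun _ => by positivity) (LE.le.eventuallyLE h2)
    rw [integral_add (f := fun y => ‖F1 y‖ + ‖G1 y‖) (g := fun y => ‖F (σ y)‖ + ‖G (σ y)‖)
      (iF1.norm.add iG1.norm) (iF.norm.add iG.norm),
      integral_add iF1.norm iG1.norm, integral_add iF.norm iG.norm] at h3
    have h4 : Metric.infDist M 𝒜 ≤ (ballVol d)⁻¹ * (K * (1 + c) * (a + b)) := by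
      rw [le_inv_mul_iff₀ hb]
      linarith
    have h5 : 0 ≤ K * (1 + c) * (a + b) := by positivity
    linarith

end scaling

/-! ### Series in `L^p` and splitting of vector fields -/

section splitting

variable {α : Type*} [MeasurableSpace α] {μ : Measure α} {p : ℝ≥0∞}

/-- A convergent series of nonnegative functions in `L^p` dominates its partial sums. -/
theorem exists_memLp_ge_partial_sums (hp : 1 ≤ p) {f : ℕ → α → ℝ} (hf : ∀ n, AEStronglyMeasurable (f n) μ)
    (hf0 : ∀ n x, 0 ≤ f n x) {b : ℕ → ℝ} (hb : Summable b) (hb0 : ∀ n, 0 ≤ b n) {B : ℝ≥0∞} (hB : B ≠ ⊤)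
    (hfb : ∀ n, eLpNorm (f n) p μ ≤ ENNReal.ofReal (b n) * B) :
    ∃ S : α → ℝ, MemLp S p μ ∧ eLpNorm S p μ ≤ ENNReal.ofReal (∑' n, b n) * B ∧
      ∀ᵐ x ∂μ, ∀ m, ∑ n ∈ Finset.range m, f n x ≤ S x := by
  have : Fact (1 ≤ p) := ⟨hp⟩
  have hm : ∀ n, MemLp (f n) p μ := fun n =>
    ⟨hf n, (hfb n).trans_lt (ENNReal.mul_lt_top ENNReal.ofReal_lt_top hB.lt_top)⟩
  set Fn : ℕ → Lp ℝ p μ := fun n => (hm n).toLp (f n) with hFn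
  have hnorm : ∀ n, ‖Fn n‖ ≤ b n * B.toReal := fun n => by
    rw [hFn, Lp.norm_toLp]
    refine ENNReal.toReal_le_of_le_ofReal (mul_nonneg (hb0 n) ENNReal.toReal_nonneg) ?_
    rw [ENNReal.ofReal_mul (hb0 n), ENNReal.ofReal_toReal hB]
    exact hfb n
  have hsb : Summable fun n => b n * B.toReal := hb.mul_right _
  have hs : Summable Fn := Summable.of_norm_bounded hsb hnorm
  have h0 : ∀ n, 0 ≤ Fn n := fun n => by
    rw [← Lp.coeFn_le]
    filter_upwards [Lp.coeFn_zero ℝ p μ, (hm n).coeFn_toLp] with x h1 h2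
    rw [h1, h2]; exact hf0 n x
  refine ⟨(∑' n, Fn n : Lp ℝ p μ), Lp.memLp _, ?_, ?_⟩
  · have h1 : ‖∑' n, Fn n‖ ≤ (∑' n, b n) * B.toReal := by
      rw [← tsum_mul_right]
      exact tsum_of_norm_bounded hsb.hasSum hnorm
    rw [Lp.norm_def] at h1
    rw [← ENNReal.ofReal_toReal (Lp.eLpNorm_ne_top (∑' n, Fn n)), ← ENNReal.ofReal_toReal hB,
      ← ENNReal.ofReal_mul (tsum_nonneg hb0)]
    exact ENNReal.ofReal_le_ofReal h1
  · rw [ae_all_iff]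
    intro m
    have h1 : ∑ n ∈ Finset.range m, Fn n ≤ ∑' n, Fn n := hs.sum_le_tsum _ fun n _ => h0 n
    have h2 : (∑ n ∈ Finset.range m, Fn n : Lp ℝ p μ) =ᵐ[μ] fun x => ∑ n ∈ Finset.range m, f n x := by
      have h3 : ∀ᵐ x ∂μ, ∀ n, Fn n x = f n x := ae_all_iff.2 fun n => (hm n).coeFn_toLp
      filter_upwards [Lp.coeFn_finsetSum (Finset.range m) Fn, h3] with x h4 h5
      rw [h4, Finset.sum_apply]
      exact Finset.sum_congr rfl fun n _ => h5 n
    filter_upwards [(Lp.coeFn_le _ _).2 h1, h2] with x h3 h4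
    rw [← h4]; exact h3

/-- A vector field bounded by `a + b` splits into parts bounded by `a` and by `b`. -/
theorem exists_vector_splitting {E : Type*} [NormedAddCommGroup E] [NormedSpace ℝ E] {W : α → E}
    {a b : α → ℝ} (hW : AEStronglyMeasurable W μ) (ha : AEStronglyMeasurable a μ) (ha0 : ∀ᵐ x ∂μ, 0 ≤ a x)
    (h : ∀ᵐ x ∂μ, ‖W x‖ ≤ a x + b x) (hb0 : ∀ᵐ x ∂μ, 0 ≤ b x) :
    ∃ F G : α → E, AEStronglyMeasurable F μ ∧ AEStronglyMeasurable G μ ∧ (∀ x, W x = F x + G x) ∧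
      (∀ᵐ x ∂μ, ‖F x‖ ≤ a x) ∧ ∀ᵐ x ∂μ, ‖G x‖ ≤ b x := by
  -- The first part is `W` shortened to length at most `a`; the remainder points in the same
  -- direction and has length at most `b`.
  have hF : AEStronglyMeasurable (fun x => (min ‖W x‖ (a x) / ‖W x‖) • W x) μ :=
    AEStronglyMeasurable.smul
      ((hW.norm.aemeasurable.min ha.aemeasurable).div hW.norm.aemeasurable).aestronglyMeasurable hW
  refine ⟨_, fun x => W x - (min ‖W x‖ (a x) / ‖W x‖) • W x, hF, hW.sub hF,
    fun x => (add_sub_cancel _ _).symm, ?_, ?_⟩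
  · filter_upwards [ha0] with x hx
    rcases eq_or_ne (W x) 0 with h0 | h0
    · simpa [h0] using hx
    · have hn := norm_pos_iff.2 h0
      have hm : 0 ≤ min ‖W x‖ (a x) := le_min hn.le hx
      rw [norm_smul, Real.norm_of_nonneg (by positivity), div_mul_cancel₀ _ hn.ne']
      exact min_le_right _ _
  · filter_upwards [ha0, h, hb0] with x hx hxs hxb
    rcases eq_or_ne (W x) 0 with h0 | h0
    · simpa [h0] using hxb
    · have hn := norm_pos_iff.2 h0
      have hm : 0 ≤ min ‖W x‖ (a x) := le_min hn.le hx
      have e1 : W x - (min ‖W x‖ (a x) / ‖W x‖) • W x = (1 - min ‖W x‖ (a x) / ‖W x‖) • W x := by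
        rw [sub_smul, one_smul]
      have h1 : min ‖W x‖ (a x) / ‖W x‖ ≤ 1 := (div_le_one hn).2 (min_le_left _ _)
      rw [e1, norm_smul, Real.norm_of_nonneg (by linarith), sub_mul, one_mul, div_mul_cancel₀ _ hn.ne']
      rcases min_cases ‖W x‖ (a x) with ⟨h2, _⟩ | ⟨h2, _⟩ <;> rw [h2] <;> linarith

end splitting

/-! ### Decomposition of the extension -/

namespace IsExtensionDomain

variable {d : ℕ} {U : Set (Vec d)} {e δ : ℝ} {f u : Vec d → Vec d} {g : Vec d → Mat d}
  {𝒜 : Set (Mat d)} {p q r : ℝ≥0∞} {F G : Vec d → ℝ} {C : ℝ}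

theorem eLpNorm_le_add {E : Type*} [NormedAddCommGroup E] (hU : IsExtensionDomain U e δ) (hp : 1 ≤ p)
    {f : Vec d → E} (hf : AEStronglyMeasurable f volume) :
    eLpNorm f p volume ≤ eLpNorm f p (volume.restrict U) +
      eLpNorm f p (volume.restrict {x | 0 < Metric.infDist x U}) := by
  have hm := hU.isOpen.measurableSet
  have hX := measurableSet_lt_infDist (U := U) 0
  have e1 : f =ᵐ[volume] U.indicator f + {x | 0 < Metric.infDist x U}.indicator f := by
    filter_upwards [hU.ae_mem_or_pos] with x hx
    rw [Pi.add_apply]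
    by_cases hxU : x ∈ U
    · rw [indicator_of_mem hxU, indicator_of_notMem (disjoint_left.1 disjoint_exterior hxU), add_zero]
    · rw [indicator_of_notMem hxU, zero_add,
        indicator_of_mem (show x ∈ {x | 0 < Metric.infDist x U} from hx.resolve_left hxU)]
  rw [eLpNorm_congr_ae e1, ← eLpNorm_indicator_eq_eLpNorm_restrict hm,
    ← eLpNorm_indicator_eq_eLpNorm_restrict hX]
  exact eLpNorm_add_le (hf.indicator hm) (hf.indicator hX) hp

theorem hasCompactSupport_approxExt (hU : IsExtensionDomain U e δ) (N : ℕ) :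
    HasCompactSupport (approxExt U e δ N f) := by
  obtain ⟨y, R, h⟩ := exists_infDist_le_subset_closedBall hU.isBounded hU.nonempty (7 / 2 * scl U δ 0)
  refine HasCompactSupport.intro (isCompact_closedBall y R) fun x hx => ?_
  refine hU.approxExt_eq_zero (not_le.1 fun h' => hx (h h')) N

theorem summable_scl : Summable (scl U δ) := by
  have : scl U δ = fun n => jonesRadius U δ / 32 * (1 / 2) ^ n := by
    ext n; simp [scl, div_eq_mul_inv]
  rw [this]
  exact summable_geometric_two.mul_left _

theorem eLpNorm_extFn_le (hU : IsExtensionDomain U e δ) (hui : IntegrableOn u U) (hgi : IntegrableOn g U)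
    (hr : 1 ≤ r) (hu : MemLp u r (volume.restrict U)) :
    eLpNorm (extFn U e δ u) r volume ≤
      ENNReal.ofReal (1 + extFnC d e * avgC d e) * eLpNorm u r (volume.restrict U) := by
  have hE := extFnC_nonneg (d := d) hU.jones.e_pos
  have hA := one_le_avgC (d := d) (e := e)
  obtain ⟨Φ, Φm, Φ0, hΦ, hΦx⟩ := hU.exists_exterior_mean le_rfl (F := u) hr (by rwa [innerPart_zero])
  rw [innerPart_zero] at hΦ
  refine (hU.eLpNorm_le_add hr (hU.aestronglyMeasurable_ext hui hgi).1).trans ?_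
  rw [ENNReal.ofReal_add zero_le_one (by positivity), ENNReal.ofReal_one, add_mul, one_mul]
  refine add_le_add (le_of_eq (eLpNorm_congr_ae ?_)) ?_
  · filter_upwards [ae_restrict_mem hU.isOpen.measurableSet] with x hx
    rw [extFn_of_mem hx]
  · calc _ ≤ ENNReal.ofReal (extFnC d e) * eLpNorm Φ r (volume.restrict {x | 0 < Metric.infDist x U}) := by
          refine eLpNorm_le_mul_eLpNorm_of_ae_le_mul ?_ r
          filter_upwards [ae_restrict_mem (measurableSet_lt_infDist 0)] with x hx
          rw [Real.norm_of_nonneg (Φ0 x)]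
          exact hU.norm_extFn_le_mean hui hr hx (Φ0 x) (hΦx x hx)
      _ ≤ ENNReal.ofReal (extFnC d e) * (ENNReal.ofReal (avgC d e) * eLpNorm u r (volume.restrict U)) := by
          gcongr
      _ = _ := by rw [ENNReal.ofReal_mul hE, mul_assoc]

/-- The decomposition of the extension. -/
theorem exists_extFn_decomp (hU : IsExtensionDomain U e δ) (hg : IsWeakGradient U u g)
    (hui : IntegrableOn u U) (hgi : IntegrableOn g U) (hF : MemLp F p (volume.restrict U))
    (hG : MemLp G q (volume.restrict U)) (hO : OscControl U g 𝒜 p q F G C) (hC : 0 ≤ C)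
    (hp : 1 ≤ p) (hq : 1 ≤ q) (hr : 1 ≤ r) :
    ∃ F' G' H' : Vec d → Vec d, IsDecomp₃ volume p q r (extFn U e δ u) F' G' H' ∧
      eLpNorm F' p volume ≤ eLpNorm F p (volume.restrict U) ∧
      eLpNorm G' q volume ≤ eLpNorm G q (volume.restrict U) ∧
      eLpNorm H' r volume ≤ ENNReal.ofReal (1 + extFnC d e * avgC d e) * eLpNorm u r (volume.restrict U) := by
  have hE := extFnC_nonneg (d := d) hU.jones.e_pos
  have hA := one_le_avgC (d := d) (e := e)
  have hS := stepC_nonneg (d := d) hU.jones.e_pos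
  have hint : Integrable (U.indicator u) := hui.integrable_indicator hU.isOpen.measurableSet
  have hm := (hU.aestronglyMeasurable_ext hui hgi).1
  -- If `u` is in `L^r`, the extension itself is the third part and the other two vanish.
  by_cases hu : MemLp u r (volume.restrict U)
  · have hle := hU.eLpNorm_extFn_le hui hgi hr hu
    refine ⟨0, 0, extFn U e δ u, ⟨Eventually.of_forall fun x => by simp, MemLp.zero, MemLp.zero, hm, ?_⟩,
      by simp, by simp, hle⟩
    exact hle.trans_lt (ENNReal.mul_lt_top ENNReal.ofReal_lt_top hu.2)
  have hutop : eLpNorm u r (volume.restrict U) = ⊤ := by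
    by_contra h
    exact hu ⟨hui.1, lt_top_iff_ne_top.2 h⟩
  set K := stepC d e * C with hK
  have hK0 : 0 ≤ K := mul_nonneg hS hC
  set b : ℕ → ℝ := fun n => K * avgC d e * scl U δ n with hb
  have hbs : Summable b := summable_scl.mul_left _
  have hb0 : ∀ n, 0 ≤ b n := fun n => by have := hU.scl_pos n; positivity
  -- Otherwise the bound for the third part is void, and only membership in `L^r` matters: a smooth
  -- approximation with compact support will do. Its index is taken so large that the remaining
  -- series has sum at most one, so the constants for the other two parts do not depend on the
  -- domain.
  obtain ⟨N, hN⟩ : ∃ N, ∑' k, b (k + N) ≤ 1 :=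
    ((tendsto_order.1 (tendsto_sum_nat_add b)).2 1 one_pos).exists.imp fun _ h => h.le
  have key : ∀ {s : ℝ≥0∞} {f : Vec d → ℝ}, 1 ≤ s → MemLp f s (volume.restrict U) →
      ∃ (Φ : ℕ → Vec d → ℝ) (S : Vec d → ℝ), (∀ n x, 0 ≤ Φ n x) ∧
        (∀ n x, MeanLe f s (nearSet U e (scl U δ n) x) (scl U δ n) (Φ n x)) ∧ MemLp S s volume ∧
        eLpNorm S s volume ≤ eLpNorm f s (volume.restrict U) ∧
        ∀ᵐ x, ∀ m, ∑ k ∈ Finset.range m, K * scl U δ (k + N) * Φ (k + N) x ≤ S x := by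
    intro s f hs hf
    choose Φ Φm Φ0 hΦ hΦx using fun n => hU.exists_scale_mean (hU.scl_pos n) hs hf
    obtain ⟨S, S1, S2, S3⟩ := exists_memLp_ge_partial_sums (μ := volume) hs
      (f := fun k x => K * scl U δ (k + N) * Φ (k + N) x) (b := fun k => b (k + N))
      (fun k => ((Φm (k + N)).const_mul _).aestronglyMeasurable)
      (fun k x => mul_nonneg (mul_nonneg hK0 (hU.scl_pos _).le) (Φ0 _ x))
      ((summable_nat_add_iff N).2 hbs) (fun k => hb0 _) hf.2.ne (fun k => by
        have hl := hU.scl_pos (k + N)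
        have e1 : eLpNorm (fun x => K * scl U δ (k + N) * Φ (k + N) x) s volume =
            ENNReal.ofReal (K * scl U δ (k + N)) * eLpNorm (Φ (k + N)) s volume := by
          have := eLpNorm_const_smul (K * scl U δ (k + N)) (Φ (k + N)) s (volume : Measure (Vec d))
          rw [Real.enorm_eq_ofReal (by positivity)] at this
          exact this
        rw [e1]
        calc _ ≤ ENNReal.ofReal (K * scl U δ (k + N)) *
              (ENNReal.ofReal (avgC d e) * eLpNorm f s (volume.restrict U)) := by
              gcongr; exact hΦ _
          _ = _ := by
              rw [← mul_assoc, ← ENNReal.ofReal_mul (by positivity)]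
              congr 2
              simp only [hb]; ring)
    refine ⟨Φ, S, Φ0, hΦx, S1, S2.trans ?_, S3⟩
    calc _ ≤ ENNReal.ofReal 1 * eLpNorm f s (volume.restrict U) := by gcongr
      _ = _ := by rw [ENNReal.ofReal_one, one_mul]
  obtain ⟨Φ, S, Φ0, hΦ, S1, S2, S3⟩ := key hp hF
  obtain ⟨Γ, R, Γ0, hΓ, R1, R2, R3⟩ := key hq hG
  have hstep : ∀ m x, ‖approxExt U e δ (m + N) (U.indicator u) x - approxExt U e δ N (U.indicator u) x‖ ≤
      ∑ k ∈ Finset.range m, K * scl U δ (k + N) * Φ (k + N) x +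
        ∑ k ∈ Finset.range m, K * scl U δ (k + N) * Γ (k + N) x := by
    intro m x
    induction m with
    | zero => simp
    | succ m ih =>
      have h1 := hU.norm_approxExt_succ_sub_le hg hui hgi hO hC hp hq (Φ0 (m + N) x) (Γ0 (m + N) x)
        (hΦ (m + N) x) (hΓ (m + N) x)
      rw [Finset.sum_range_succ, Finset.sum_range_succ, add_right_comm m 1 N]
      have h2 := norm_sub_le_norm_sub_add_norm_sub (approxExt U e δ (m + N + 1) (U.indicator u) x)
        (approxExt U e δ (m + N) (U.indicator u) x) (approxExt U e δ N (U.indicator u) x)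
      linarith
  have hlim := (hU.tendsto_approxExt hg hui hgi).1
  have hmeas : TendstoInMeasure volume (fun n => approxExt U e δ n (U.indicator u)) atTop (extFn U e δ u) := by
    refine tendstoInMeasure_of_tendsto_eLpNorm one_ne_zero
      (fun n => (hU.contDiff_approxExt hint n).continuous.aestronglyMeasurable) hm ?_
    simpa only [eLpNorm_one_eq_lintegral_enorm, Pi.sub_apply] using hlim
  -- A subsequence converges almost everywhere, also in `U`, where the approximations do not become
  -- stationary; this carries the bound on partial sums to the limit.
  obtain ⟨ns, hns, hae⟩ := hmeas.exists_seq_tendsto_ae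
  have hbound : ∀ᵐ x, ‖extFn U e δ u x - approxExt U e δ N (U.indicator u) x‖ ≤ S x + R x := by
    filter_upwards [hae, S3, R3] with x h1 h2 h3
    refine le_of_tendsto (h1.sub_const _).norm ?_
    filter_upwards [hns.tendsto_atTop.eventually_ge_atTop N] with i hi
    obtain ⟨m, hm'⟩ := Nat.exists_eq_add_of_le' hi
    rw [hm']
    exact (hstep m x).trans (add_le_add (h2 m) (h3 m))
  have hEN := hU.contDiff_approxExt hint N
  have hENm : AEStronglyMeasurable (approxExt U e δ N (U.indicator u)) volume := hEN.continuous.aestronglyMeasurable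
  obtain ⟨F', G', mF, mG, hFG, bF, bG⟩ := exists_vector_splitting (hm.sub hENm) S1.1
    (by filter_upwards [S3] with x h; simpa using h 0) hbound (by filter_upwards [R3] with x h; simpa using h 0)
  have nF : eLpNorm F' p volume ≤ eLpNorm S p volume := eLpNorm_mono_ae_real bF
  have nG : eLpNorm G' q volume ≤ eLpNorm R q volume := eLpNorm_mono_ae_real bG
  refine ⟨F', G', approxExt U e δ N (U.indicator u), ⟨Eventually.of_forall fun x => ?_,
    ⟨mF, nF.trans_lt S1.2⟩, ⟨mG, nG.trans_lt R1.2⟩,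
    hEN.continuous.memLp_of_hasCompactSupport (hU.hasCompactSupport_approxExt N)⟩,
    nF.trans S2, nG.trans R2, ?_⟩
  · rw [← hFG, Pi.sub_apply, sub_add_cancel]
  · rw [hutop, ENNReal.mul_top (ENNReal.ofReal_pos.2 (by positivity)).ne']
    exact le_top

end IsExtensionDomain

/-! ### Decomposition of the distance of the gradient from `𝒜` -/

namespace IsExtensionDomain

variable {d : ℕ} {U V : Set (Vec d)} {e δ : ℝ} {f u : Vec d → Vec d} {g : Vec d → Mat d}
  {𝒜 : Set (Mat d)} {p q r : ℝ≥0∞} {F G : Vec d → ℝ} {C : ℝ}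

theorem eLpNorm_indicator_add_le {X : Set (Vec d)} (hUm : MeasurableSet U) (hX : MeasurableSet X)
    (hp : 1 ≤ p) {f h : Vec d → ℝ} (hf : AEStronglyMeasurable f (volume.restrict U))
    (hh : AEStronglyMeasurable h volume) :
    AEStronglyMeasurable (U.indicator f + X.indicator h) volume ∧
      eLpNorm (U.indicator f + X.indicator h) p (volume.restrict V) ≤
        eLpNorm f p (volume.restrict U) + eLpNorm h p (volume.restrict X) := by
  have h1 : AEStronglyMeasurable (U.indicator f) volume := (aestronglyMeasurable_indicator_iff hUm).2 hf
  have h2 := hh.indicator hX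
  refine ⟨h1.add h2, (eLpNorm_mono_measure _ Measure.restrict_le_self).trans ?_⟩
  rw [← eLpNorm_indicator_eq_eLpNorm_restrict hUm, ← eLpNorm_indicator_eq_eLpNorm_restrict hX]
  exact eLpNorm_add_le h1 h2 hp

/-- Constant of the decomposition of the gradient of the extension. -/
noncomputable def _root_.gradDecompC (d : ℕ) (e C : ℝ) : ℝ := 1 + ringC d e * C * avgC d e

theorem memLp_of_bound_of_far (hU : IsExtensionDomain U e δ) {h : Vec d → ℝ} {B : ℝ}
    (hm : AEStronglyMeasurable h volume) (hB : ∀ x, |h x| ≤ B)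
    (h0 : ∀ x, 4 * scl U δ 0 < Metric.infDist x U → h x = 0) : MemLp h r volume := by
  refine MemLp.mono' (memLp_indicator_const r (measurableSet_infDist_le (U := U) (4 * scl U δ 0)) B
    (Or.inr (volume_infDist_le_lt_top hU.isBounded hU.nonempty _).ne)) hm
    (Eventually.of_forall fun x => ?_)
  by_cases hx : Metric.infDist x U ≤ 4 * scl U δ 0
  · rw [indicator_of_mem (show x ∈ {x | Metric.infDist x U ≤ 4 * scl U δ 0} from hx)]
    exact hB x
  · rw [h0 x (not_le.1 hx), norm_zero]
    exact indicator_nonneg (fun _ _ => (abs_nonneg _).trans (hB x)) x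

/-- Far from `U` the mean of `u` with exponent one is bounded uniformly in `x`. Hence the remainder
is bounded and lies in every `L^r`, even if `u` does not. -/
theorem meanLe_of_far (hU : IsExtensionDomain U e δ) (hui : IntegrableOn u U) {x : Vec d}
    (hx : 2 * scl U δ 0 < Metric.infDist x U) :
    MeanLe u 1 (extNear U e x) (Metric.infDist x U)
      (((2 * scl U δ 0) ^ d)⁻¹ * (eLpNorm u 1 (volume.restrict U)).toReal) := by
  have hl := hU.scl_pos 0
  have hfin : eLpNorm u 1 (volume.restrict U) ≠ ⊤ := (memLp_one_iff_integrable.2 hui).2.ne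
  unfold MeanLe
  rw [ENNReal.toReal_one, div_one, ENNReal.rpow_one,
    ← ENNReal.ofReal_mul (pow_nonneg Metric.infDist_nonneg d)]
  calc eLpNorm u 1 (volume.restrict (extNear U e x)) ≤ eLpNorm u 1 (volume.restrict U) :=
        eLpNorm_mono_measure _ (Measure.restrict_mono (fun y hy => hy.1) le_rfl)
    _ = ENNReal.ofReal (eLpNorm u 1 (volume.restrict U)).toReal := (ENNReal.ofReal_toReal hfin).symm
    _ ≤ _ := by
        refine ENNReal.ofReal_le_ofReal ?_
        rw [← mul_assoc]
        refine le_mul_of_one_le_left ENNReal.toReal_nonneg ?_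
        rw [← div_eq_mul_inv, one_le_div (by positivity)]
        gcongr

/-- The decomposition of the distance of the gradient of the extension. -/
theorem exists_extGrad_decomp (hU : IsExtensionDomain U e δ) (hg : IsWeakGradient U u g)
    (hui : IntegrableOn u U) (hgi : IntegrableOn g U)
    (hdec : IsDecomp₂ (volume.restrict U) p q (distTo g 𝒜) F G) (hO : OscControl U g 𝒜 p q F G C)
    (hC : 0 ≤ C) (hp : 1 ≤ p) (hq : 1 ≤ q) (hr : 1 ≤ r) (hVm : MeasurableSet V)
    (hV : ∀ x ∈ V, 4 * scl U δ 0 < Metric.infDist x U → Metric.infDist (0 : Mat d) 𝒜 = 0) :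
    ∃ F' G' H' : Vec d → ℝ,
      IsDecomp₃ (volume.restrict V) p q r (distTo (extGrad U e δ u g) 𝒜) F' G' H' ∧
      (∀ x, Metric.infDist x U ≤ 2 * scl U δ 0 → H' x = 0) ∧
      eLpNorm F' p (volume.restrict V) ≤
        ENNReal.ofReal (gradDecompC d e C) * eLpNorm F p (volume.restrict U) ∧
      eLpNorm G' q (volume.restrict V) ≤
        ENNReal.ofReal (gradDecompC d e C) * eLpNorm G q (volume.restrict U) ∧
      eLpNorm H' r (volume.restrict V) ≤ ENNReal.ofReal (lowC d e * (scl U δ 0)⁻¹ * avgC d e) *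
        eLpNorm u r (volume.restrict (innerPart U (e ^ 3 / 131072 * scl U δ 0))) := by
  have he := hU.jones.e_pos
  have hA := one_le_avgC (d := d) (e := e)
  have hl := hU.scl_pos 0
  set K := ringC d e * C with hK
  have hK0 : 0 ≤ K := mul_nonneg (ringC_pos he).le hC
  set L := lowC d e * (scl U δ 0)⁻¹ with hL
  have hL0 : 0 ≤ L := mul_nonneg (lowC_nonneg he) (inv_pos.2 hl).le
  -- The intersection with `V` matters: far away the gradient is zero, and its distance from `𝒜`
  -- need not vanish outside `V`.
  set X : Set (Vec d) := {x | 0 < Metric.infDist x U} ∩ V with hX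
  have hXm : MeasurableSet X := (measurableSet_lt_infDist 0).inter hVm
  have hUm := hU.isOpen.measurableSet
  set T : Vec d → ℝ := distTo (extGrad U e δ u g) 𝒜 with hT
  have hT0 : ∀ x, 0 ≤ T x := fun x => Metric.infDist_nonneg
  have hTm : AEStronglyMeasurable T volume :=
    (Metric.continuous_infDist_pt 𝒜).comp_aestronglyMeasurable (hU.aestronglyMeasurable_ext hui hgi).2
  obtain ⟨Φ, Φm, Φ0, hΦ, hΦx⟩ := hU.exists_exterior_mean le_rfl (F := F) hp
    (by rw [innerPart_zero]; exact hdec.memLp_left)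
  obtain ⟨Γ, Γm, Γ0, hΓ, hΓx⟩ := hU.exists_exterior_mean le_rfl (F := G) hq
    (by rw [innerPart_zero]; exact hdec.memLp_right)
  rw [innerPart_zero] at hΦ hΓ
  have hnear : ∀ x, 0 < Metric.infDist x U → Metric.infDist x U ≤ 2 * scl U δ 0 →
      T x ≤ K * Φ x + K * Γ x := fun x hx hx2 => by
    have := hU.infDist_extGrad_le_mean hg hui hgi hO hC hp hq hx hx2 (Φ0 x) (Γ0 x) (hΦx x hx) (hΓx x hx)
    rwa [mul_add] at this
  have hfar : ∀ {s : ℝ≥0∞} {c : ℝ} {x : Vec d}, 1 ≤ s → 0 ≤ c → x ∈ V → 2 * scl U δ 0 < Metric.infDist x U →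
      MeanLe u s (extNear U e x) (Metric.infDist x U) c → T x ≤ K * Φ x + K * Γ x + L * c := by
    intro s c x hs hc hxV hx2 hm
    have hx : 0 < Metric.infDist x U := by linarith
    by_cases hx4 : Metric.infDist x U ≤ 4 * scl U δ 0
    · have := hU.infDist_extGrad_le_mean_of_far hg hui hgi hO hC hp hq hs hx2 hx4 (Φ0 x) (Γ0 x) hc
        (hΦx x hx) (hΓx x hx) hm
      rwa [mul_add] at this
    · have h0 : T x = 0 := by
        rw [hT, distTo, (hU.extGrad_eq_zero (not_le.1 hx4)).2, hV x hxV (not_le.1 hx4)]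
      have := Φ0 x
      have := Γ0 x
      rw [h0]; positivity
  -- The function `T` is truncated first against the means of `F`, then what remains against those
  -- of `G`. The leftover is at most the lower order term, so it vanishes wherever the pure gradient
  -- estimate holds.
  have hPm : AEStronglyMeasurable (fun x => min (T x) (K * Φ x)) volume :=
    (hTm.aemeasurable.min (Φm.const_mul K).aemeasurable).aestronglyMeasurable
  have hRm : AEStronglyMeasurable (fun x => min (T x - min (T x) (K * Φ x)) (K * Γ x)) volume :=
    ((hTm.sub hPm).aemeasurable.min (Γm.const_mul K).aemeasurable).aestronglyMeasurable
  set P : Vec d → ℝ := fun x => min (T x) (K * Φ x) with hP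
  set R : Vec d → ℝ := fun x => min (T x - P x) (K * Γ x) with hR
  set H : Vec d → ℝ := X.indicator fun x => T x - P x - R x with hH
  have hHm : AEStronglyMeasurable H volume := ((hTm.sub hPm).sub hRm).indicator hXm
  have hP0 : ∀ x, 0 ≤ P x := fun x => le_min (hT0 x) (mul_nonneg hK0 (Φ0 x))
  have hPT : ∀ x, P x ≤ T x := fun x => min_le_left _ _
  have hR0 : ∀ x, 0 ≤ R x := fun x => le_min (sub_nonneg.2 (hPT x)) (mul_nonneg hK0 (Γ0 x))
  have hH0 : ∀ x, 0 ≤ H x := fun x => indicator_nonneg (fun x _ => sub_nonneg.2 (min_le_left _ _)) x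
  -- the remainder after removing the two minima
  have hrem : ∀ x c, 0 ≤ c → T x ≤ K * Φ x + K * Γ x + c → T x - P x - R x ≤ c := by
    intro x c hc h
    simp only [hP, hR]
    rcases min_cases (T x) (K * Φ x) with ⟨h1, _⟩ | ⟨h1, _⟩ <;> rw [h1] <;>
      rcases min_cases (T x - _) (K * Γ x) with ⟨h2, _⟩ | ⟨h2, _⟩ <;> rw [h2] <;>
      linarith [mul_nonneg hK0 (Γ0 x)]
  have hHnear : ∀ x, Metric.infDist x U ≤ 2 * scl U δ 0 → H x = 0 := by
    intro x hx
    refine le_antisymm ?_ (hH0 x)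
    by_cases hxX : x ∈ X
    · rw [hH, indicator_of_mem hxX]
      exact hrem x 0 le_rfl (by rw [add_zero]; exact hnear x hxX.1 hx)
    · rw [hH, indicator_of_notMem hxX]
  have hHfar : ∀ {s : ℝ≥0∞} {c : ℝ} {x : Vec d}, 1 ≤ s → 0 ≤ c →
      (2 * scl U δ 0 < Metric.infDist x U → MeanLe u s (extNear U e x) (Metric.infDist x U) c) →
      H x ≤ L * c := by
    intro s c x hs hc hm
    by_cases hx2 : Metric.infDist x U ≤ 2 * scl U δ 0
    · rw [hHnear x hx2]; positivity
    · by_cases hxX : x ∈ X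
      · rw [hH, indicator_of_mem hxX]
        exact hrem x _ (by positivity) (hfar hs hc hxX.2 (not_le.1 hx2) (hm (not_le.1 hx2)))
      · rw [hH, indicator_of_notMem hxX]; positivity
  have hHmem : MemLp H r volume := by
    refine hU.memLp_of_bound_of_far hHm (B := L * (((2 * scl U δ 0) ^ d)⁻¹ *
      (eLpNorm u 1 (volume.restrict U)).toReal)) (fun x => ?_) fun x hx => ?_
    · rw [abs_of_nonneg (hH0 x)]
      exact hHfar le_rfl (by positivity) fun h => hU.meanLe_of_far hui h
    · by_cases hxX : x ∈ X
      · have h0 : T x = 0 := by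
          rw [hT, distTo, (hU.extGrad_eq_zero hx).2, hV x hxX.2 hx]
        refine le_antisymm ?_ (hH0 x)
        rw [hH, indicator_of_mem hxX]
        linarith [hP0 x, hR0 x]
      · rw [hH, indicator_of_notMem hxX]
  have hscale : ∀ {s : ℝ≥0∞} {Ψ W : Vec d → ℝ} {f : Vec d → ℝ}, (∀ x, 0 ≤ Ψ x) →
      eLpNorm Ψ s (volume.restrict {x | 0 < Metric.infDist x U}) ≤
        ENNReal.ofReal (avgC d e) * eLpNorm f s (volume.restrict U) → (∀ x, 0 ≤ W x) →
      (∀ x, W x ≤ K * Ψ x) → eLpNorm f s (volume.restrict U) + eLpNorm W s (volume.restrict X) ≤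
        ENNReal.ofReal (gradDecompC d e C) * eLpNorm f s (volume.restrict U) := by
    intro s Ψ W f hΨ0 hΨ hW0 hW
    rw [gradDecompC, ENNReal.ofReal_add zero_le_one (by positivity), ENNReal.ofReal_one, add_mul, one_mul]
    gcongr
    calc eLpNorm W s (volume.restrict X) ≤ eLpNorm W s (volume.restrict {x | 0 < Metric.infDist x U}) :=
          eLpNorm_mono_measure _ (Measure.restrict_mono inter_subset_left le_rfl)
      _ ≤ ENNReal.ofReal K * eLpNorm Ψ s (volume.restrict {x | 0 < Metric.infDist x U}) :=
          eLpNorm_le_mul_eLpNorm_of_ae_le_mul (Eventually.of_forall fun x => by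
            rw [Real.norm_of_nonneg (hΨ0 x), Real.norm_of_nonneg (hW0 x)]; exact hW x) s
      _ ≤ ENNReal.ofReal K * (ENNReal.ofReal (avgC d e) * eLpNorm f s (volume.restrict U)) := by gcongr
      _ = _ := by rw [← mul_assoc, ← ENNReal.ofReal_mul hK0]
  obtain ⟨mF, nF⟩ := eLpNorm_indicator_add_le (V := V) hUm hXm hp hdec.memLp_left.1 hPm
  obtain ⟨mG, nG⟩ := eLpNorm_indicator_add_le (V := V) hUm hXm hq hdec.memLp_right.1 hRm
  have nF' := nF.trans (hscale Φ0 hΦ hP0 fun x => min_le_right _ _)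
  have nG' := nG.trans (hscale Γ0 hΓ hR0 fun x => min_le_right _ _)
  refine ⟨U.indicator F + X.indicator P, U.indicator G + X.indicator R, H, ⟨?_,
    ⟨mF.mono_measure Measure.restrict_le_self, nF'.trans_lt (ENNReal.mul_lt_top ENNReal.ofReal_lt_top hdec.memLp_left.2)⟩,
    ⟨mG.mono_measure Measure.restrict_le_self, nG'.trans_lt (ENNReal.mul_lt_top ENNReal.ofReal_lt_top hdec.memLp_right.2)⟩,
    hHmem.mono_measure Measure.restrict_le_self⟩, hHnear, nF', nG', ?_⟩
  · filter_upwards [ae_restrict_mem hVm, ae_restrict_of_ae hU.ae_mem_or_pos,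
      ae_restrict_of_ae ((ae_restrict_iff' hUm).1 hdec.eq_add)] with x hxV hx hxe
    simp only [Pi.add_apply]
    by_cases hxU : x ∈ U
    · have hxX : x ∉ X := fun h => disjoint_left.1 disjoint_exterior hxU h.1
      rw [hH, indicator_of_mem hxU, indicator_of_mem hxU, indicator_of_notMem hxX,
        indicator_of_notMem hxX, indicator_of_notMem hxX, add_zero, add_zero, add_zero, ← hxe hxU, hT]
      simp only [distTo, extGrad_of_mem hxU]
    · have hxX : x ∈ X := ⟨hx.resolve_left hxU, hxV⟩
      rw [hH, indicator_of_notMem hxU, indicator_of_notMem hxU, indicator_of_mem hxX,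
        indicator_of_mem hxX, indicator_of_mem hxX]
      ring
  · by_cases hu : eLpNorm u r (volume.restrict (innerPart U (e ^ 3 / 131072 * scl U δ 0))) = ⊤
    -- If the constant were zero, the right-hand side would be `0 * ∞ = 0`, so then the remainder
    -- itself must be shown to vanish.
    · rcases eq_or_ne (L * avgC d e) 0 with h0 | h0
      · have hL' : L = 0 := (mul_eq_zero.1 h0).resolve_right (by linarith)
        have : H = 0 := by
          ext1 x
          refine le_antisymm ?_ (hH0 x)
          have := hHfar (x := x) (c := _) le_rfl (by positivity) fun h => hU.meanLe_of_far hui h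
          rwa [hL', zero_mul] at this
        rw [this]; simp
      · rw [hu, ENNReal.mul_top (ENNReal.ofReal_pos.2 (lt_of_le_of_ne (by positivity) h0.symm)).ne']
        exact le_top
    · have hum : MemLp u r (volume.restrict (innerPart U (e ^ 3 / 131072 * scl U δ 0))) :=
        ⟨hui.1.mono_measure (Measure.restrict_mono (fun x hx => hx.1) le_rfl), lt_top_iff_ne_top.2 hu⟩
      obtain ⟨Ψ, Ψm, Ψ0, hΨ, hΨx⟩ := hU.exists_exterior_mean hl.le hr hum
      calc eLpNorm H r (volume.restrict V)
          ≤ eLpNorm H r volume := eLpNorm_mono_measure _ Measure.restrict_le_self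
        -- The remainder lives far from `U`, so the averages can be restricted to the inner part of
        -- `U`.
        _ = eLpNorm H r (volume.restrict {x | scl U δ 0 < Metric.infDist x U}) := by
            rw [← eLpNorm_indicator_eq_eLpNorm_restrict (measurableSet_lt_infDist _), indicator_eq_self.2]
            intro x hx
            by_contra h
            refine hx (hHnear x ?_)
            have : Metric.infDist x U ≤ scl U δ 0 := not_lt.1 h
            linarith
        _ ≤ ENNReal.ofReal L * eLpNorm Ψ r (volume.restrict {x | scl U δ 0 < Metric.infDist x U}) :=
            eLpNorm_le_mul_eLpNorm_of_ae_le_mul (Eventually.of_forall fun x => by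
              rw [Real.norm_of_nonneg (hH0 x), Real.norm_of_nonneg (Ψ0 x)]
              exact hHfar hr (Ψ0 x) fun h => hΨx x (by linarith)) r
        _ ≤ ENNReal.ofReal L * (ENNReal.ofReal (avgC d e) *
              eLpNorm u r (volume.restrict (innerPart U (e ^ 3 / 131072 * scl U δ 0)))) := by gcongr
        _ = _ := by rw [← mul_assoc, ← ENNReal.ofReal_mul hL0]

end IsExtensionDomain

end

/-! ### Constants and the assembly of the theorem -/

/-- The constant of the extension theorem in terms of the rigidity constant. -/
noncomputable def extensionC (d : ℕ) (e C : ℝ) : ℝ :=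
  1 + gradDecompC d e C + lowC d e * 32 * avgC d e + (1 + extFnC d e * avgC d e)

section constants

variable {d : ℕ} {e C : ℝ}

theorem one_le_gradDecompC (he : 0 < e) (hC : 0 ≤ C) : 1 ≤ gradDecompC d e C := by
  have h1 := ringC_pos (d := d) he
  have h2 := one_le_avgC (d := d) (e := e)
  have : 0 ≤ ringC d e * C * avgC d e := by positivity
  unfold gradDecompC
  linarith

theorem le_extensionC (he : 0 < e) (hC : 0 ≤ C) :
    1 ≤ extensionC d e C ∧ gradDecompC d e C ≤ extensionC d e C ∧
      lowC d e * 32 * avgC d e ≤ extensionC d e C ∧ 1 + extFnC d e * avgC d e ≤ extensionC d e C := by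
  have h1 := one_le_gradDecompC (d := d) he hC
  have h2 := one_le_avgC (d := d) (e := e)
  have h3 := lowC_nonneg (d := d) he
  have h4 := extFnC_nonneg (d := d) he
  have h5 : 0 ≤ lowC d e * 32 * avgC d e := by positivity
  have h6 : 0 ≤ extFnC d e * avgC d e := by positivity
  unfold extensionC
  refine ⟨?_, ?_, ?_, ?_⟩ <;> linarith

end constants

namespace IsExtensionDomain

variable {d : ℕ} {U V : Set (Vec d)} {e δ : ℝ} {𝒜 : Set (Mat d)} {p q r : ℝ≥0∞} {F G : Vec d → ℝ} {C : ℝ}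

theorem ofReal_mul_le {a b : ℝ} (h : a ≤ b) (x : ℝ≥0∞) :
    ENNReal.ofReal a * x ≤ (b.toNNReal : ℝ≥0∞) * x :=
  mul_le_mul_left (ENNReal.ofReal_le_ofReal h) x

theorem exists_extOp_decomp (hU : IsExtensionDomain U e δ) (hC : 0 ≤ C) (hp : 1 ≤ p) (hq : 1 ≤ q)
    (hr : 1 ≤ r) (w : W11 U) (hdec : IsDecomp₂ (volume.restrict U) p q (distTo (sobGrad w) 𝒜) F G)
    (hO : OscControl U (sobGrad w) 𝒜 p q F G C) :
    ∃ F' G' H' : Vec d → Vec d, IsDecomp₃ volume p q r (locFn (hU.extOp w)) F' G' H' ∧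
      eLpNorm F' p volume ≤ (extensionC d e C).toNNReal * eLpNorm F p (volume.restrict U) ∧
      eLpNorm G' q volume ≤ (extensionC d e C).toNNReal * eLpNorm G q (volume.restrict U) ∧
      eLpNorm H' r volume ≤ (extensionC d e C).toNNReal * eLpNorm (sobFn w) r (volume.restrict U) := by
  obtain ⟨h1, h2, h3⟩ := sobGrad_spec w
  obtain ⟨c1, -, -, c4⟩ := le_extensionC (d := d) hU.jones.e_pos hC
  obtain ⟨F', G', H', hd, nF, nG, nH⟩ := hU.exists_extFn_decomp h1 h2 h3 hdec.memLp_left hdec.memLp_right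
    hO hC hp hq hr
  have hone : (1 : ℝ≥0∞) ≤ ((extensionC d e C).toNNReal : ℝ≥0∞) := by
    exact_mod_cast (Real.one_le_toNNReal.2 c1)
  refine ⟨F', G', H', ⟨?_, hd.memLp_fst, hd.memLp_snd, hd.memLp_trd⟩,
    nF.trans (le_mul_of_one_le_left zero_le hone), nG.trans (le_mul_of_one_le_left zero_le hone),
    nH.trans (ofReal_mul_le c4 _)⟩
  filter_upwards [hd.eq_add, hU.locFn_extOp w] with x k1 k2
  rw [k2, k1]

theorem exists_extOp_grad_decomp (hU : IsExtensionDomain U e δ) (hC : 0 ≤ C) (hp : 1 ≤ p) (hq : 1 ≤ q)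
    (hr : 1 ≤ r) (w : W11 U) (hdec : IsDecomp₂ (volume.restrict U) p q (distTo (sobGrad w) 𝒜) F G)
    (hO : OscControl U (sobGrad w) 𝒜 p q F G C)
    (hV : V = outerNhd U (jonesRadius U δ * (1 / 8)) ∨ (V = univ ∧ 0 ∈ closure 𝒜)) :
    ∃ F' G' H' : Vec d → ℝ,
      IsDecomp₃ (volume.restrict V) p q r (distTo (locGrad (hU.extOp w)) 𝒜) F' G' H' ∧
      (∀ x ∈ outerNhd U (jonesRadius U δ * (1 / 16)), H' x = 0) ∧
      eLpNorm F' p (volume.restrict V) ≤ (extensionC d e C).toNNReal * eLpNorm F p (volume.restrict U) ∧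
      eLpNorm G' q (volume.restrict V) ≤ (extensionC d e C).toNNReal * eLpNorm G q (volume.restrict U) ∧
      eLpNorm H' r (volume.restrict V) ≤ (extensionC d e C).toNNReal *
        (ENNReal.ofReal (jonesRadius U δ)⁻¹ * eLpNorm (sobFn w) r
          (volume.restrict (innerPart U (jonesRadius U δ * (e ^ 3 / 131072 / 32)))) +
        eLpNorm (sobGrad w) r
          (volume.restrict (innerPart U (jonesRadius U δ * (e ^ 3 / 131072 / 32))))) := by
  have hρ := hU.radius_pos
  obtain ⟨h1, h2, h3⟩ := sobGrad_spec w
  obtain ⟨-, c2, c3, -⟩ := le_extensionC (d := d) hU.jones.e_pos hC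
  have hVm : MeasurableSet V := by
    rcases hV with rfl | ⟨rfl, -⟩
    · exact measurableSet_infDist_le _
    · exact MeasurableSet.univ
  -- The neighbourhood of width `ρ / 8 = 4 * scl U δ 0` has no such points; on the whole space the
  -- assumption on the closure of `𝒜` applies.
  have hV0 : ∀ x ∈ V, 4 * scl U δ 0 < Metric.infDist x U → Metric.infDist (0 : Mat d) 𝒜 = 0 := by
    intro x hx hx4
    rcases hV with rfl | ⟨-, h0⟩
    · have : Metric.infDist x U ≤ jonesRadius U δ * (1 / 8) := hx
      rw [scl_zero_eq] at hx4
      linarith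
    · exact Metric.infDist_zero_of_mem_closure h0
  obtain ⟨F', G', H', hd, hH, nF, nG, nH⟩ := hU.exists_extGrad_decomp h1 h2 h3 hdec hO hC hp hq hr hVm hV0
  refine ⟨F', G', H', ⟨?_, hd.memLp_fst, hd.memLp_snd, hd.memLp_trd⟩, fun x hx => hH x ?_,
    nF.trans (ofReal_mul_le c2 _), nG.trans (ofReal_mul_le c2 _), ?_⟩
  · filter_upwards [hd.eq_add, ae_restrict_of_ae (hU.locGrad_extOp w)] with x k1 k2
    rw [← k1]
    simp only [distTo, k2]
  · have : Metric.infDist x U ≤ jonesRadius U δ * (1 / 16) := hx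
    rw [scl_zero_eq]
    linarith
  · have e1 : e ^ 3 / 131072 * scl U δ 0 = jonesRadius U δ * (e ^ 3 / 131072 / 32) := by
      rw [scl_zero_eq]; ring
    have e2 : lowC d e * (scl U δ 0)⁻¹ * avgC d e = lowC d e * 32 * avgC d e * (jonesRadius U δ)⁻¹ := by
      rw [scl_zero_eq]; field_simp
    rw [e1, e2, ENNReal.ofReal_mul' (inv_nonneg.2 hρ.le), mul_assoc] at nH
    refine nH.trans ((ofReal_mul_le c3 _).trans ?_)
    gcongr
    -- The term with `u` alone suffices; the norm of its gradient is added only to match the claim.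
    exact le_self_add

/-- Apply the decompositions with the whole distance as first part and zero as second. If its norm
is infinite there is nothing to prove, as the constant is positive. -/
theorem extOp_special (hU : IsExtensionDomain U e δ) (hC : 0 ≤ C) (hp : 1 ≤ p) (w : W11 U)
    (hO : ∀ F G : Vec d → ℝ, IsDecomp₂ (volume.restrict U) p p (distTo (sobGrad w) 𝒜) F G →
      OscControl U (sobGrad w) 𝒜 p p F G C) :
    eLpNorm (locFn (hU.extOp w)) p volume ≤ (extensionC d e C).toNNReal *
      (eLpNorm (sobFn w) p (volume.restrict U) + eLpNorm (distTo (sobGrad w) 𝒜) p (volume.restrict U)) ∧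
    eLpNorm (distTo (locGrad (hU.extOp w)) 𝒜) p
        (volume.restrict (outerNhd U (jonesRadius U δ * (1 / 16)))) ≤
      (extensionC d e C).toNNReal * eLpNorm (distTo (sobGrad w) 𝒜) p (volume.restrict U) := by
  have hρ := hU.radius_pos
  obtain ⟨c1, -, -, -⟩ := le_extensionC (d := d) hU.jones.e_pos hC
  have hc0 : ((extensionC d e C).toNNReal : ℝ≥0∞) ≠ 0 := by
    have : (0 : ℝ) < extensionC d e C := by linarith
    exact_mod_cast (Real.toNNReal_pos.2 this).ne'
  by_cases htop : eLpNorm (distTo (sobGrad w) 𝒜) p (volume.restrict U) = ⊤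
  · rw [htop, add_top, ENNReal.mul_top hc0]
    exact ⟨le_top, le_top⟩
  have hm : AEStronglyMeasurable (distTo (sobGrad w) 𝒜) (volume.restrict U) :=
    (Metric.continuous_infDist_pt 𝒜).comp_aestronglyMeasurable (sobGrad_spec w).2.2.1
  have hdec : IsDecomp₂ (volume.restrict U) p p (distTo (sobGrad w) 𝒜) (distTo (sobGrad w) 𝒜) 0 :=
    ⟨Filter.Eventually.of_forall fun x => by simp, ⟨hm, lt_top_iff_ne_top.2 htop⟩, MemLp.zero⟩
  have hO' := hO _ _ hdec
  constructor
  · obtain ⟨F', G', H', hd, nF, nG, nH⟩ := hU.exists_extOp_decomp hC hp hp hp w hdec hO'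
    rw [eLpNorm_zero, mul_zero] at nG
    rw [eLpNorm_congr_ae (g := F' + G' + H') hd.eq_add]
    calc _ ≤ eLpNorm F' p volume + eLpNorm G' p volume + eLpNorm H' p volume :=
          (eLpNorm_add_le (hd.memLp_fst.1.add hd.memLp_snd.1) hd.memLp_trd.1 hp).trans
            (add_le_add_left (eLpNorm_add_le hd.memLp_fst.1 hd.memLp_snd.1 hp) _)
      _ ≤ (extensionC d e C).toNNReal * eLpNorm (distTo (sobGrad w) 𝒜) p (volume.restrict U) + 0 +
          (extensionC d e C).toNNReal * eLpNorm (sobFn w) p (volume.restrict U) := by gcongr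
      _ = _ := by rw [add_zero, ← mul_add, add_comm]
  · obtain ⟨F', G', H', hd, hH, nF, nG, -⟩ := hU.exists_extOp_grad_decomp hC hp hp hp w hdec hO' (Or.inl rfl)
    rw [eLpNorm_zero, mul_zero] at nG
    have hsub : outerNhd U (jonesRadius U δ * (1 / 16)) ⊆ outerNhd U (jonesRadius U δ * (1 / 8)) :=
      fun x hx => le_trans (show Metric.infDist x U ≤ _ from hx) (by linarith)
    have hle := Measure.restrict_mono hsub (le_refl (volume : Measure (Vec d)))
    rw [eLpNorm_congr_ae (g := F' + G')]
    · calc _ ≤ eLpNorm F' p (volume.restrict (outerNhd U (jonesRadius U δ * (1 / 8)))) +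
            eLpNorm G' p (volume.restrict (outerNhd U (jonesRadius U δ * (1 / 8)))) :=
            (eLpNorm_mono_measure _ hle).trans (eLpNorm_add_le hd.memLp_fst.1 hd.memLp_snd.1 hp)
        _ ≤ _ := add_le_add nF nG
        _ = _ := add_zero _
    · filter_upwards [ae_mono hle hd.eq_add, ae_restrict_mem (measurableSet_infDist_le _)] with x k1 k2
      rw [k1, hH x k2, add_zero, Pi.add_apply]

end IsExtensionDomain

theorem theorem5p13 (d : ℕ) (hd : 1 ≤ d) (e : ℝ) (he : 0 < e) (he1 : e ≤ 1) :
    ∃ (α' α α'' : ℝ) (c : ℝ≥0∞ → ℝ≥0∞ → ℝ≥0∞ → Set (Mat d) → ℝ≥0),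
      0 < α' ∧ α' < α ∧ 0 < α'' ∧ (∀ p q r 𝒜, 0 < c p q r 𝒜) ∧
      ∀ (δ : ℝ) (U : Set (Vec d)), IsOpen U → Bornology.IsBounded U → U.Nonempty →
        IsJonesDomain U e δ →
        (∀ x ∈ U, 2 * jonesRadius U δ ≤ Metric.diam (connectedComponentIn U x)) →
        ∃ E : W11 U →ₗ[ℝ] W11loc d,
          -- boundedness
          (∃ C : ℝ≥0, ∀ u : W11 U,
            eLpNorm (locFn (E u)) 1 volume + eLpNorm (locGrad (E u)) 1 volume ≤
              C * (eLpNorm (sobFn u) 1 (volume.restrict U) +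
                eLpNorm (sobGrad u) 1 (volume.restrict U))) ∧
          -- (a) extension
          (∀ u : W11 U, ∀ᵐ x ∂(volume.restrict U), locFn (E u) x = sobFn u x) ∧
          -- (b) support
          (∀ u : W11 U, ∀ᵐ x ∂volume,
            x ∉ outerNhd U (jonesRadius U δ * α) → locFn (E u) x = 0) ∧
          ∀ (r p q : ℝ≥0∞) (𝒜 : Set (Mat d)), 1 ≤ r → 1 ≤ p → p ≤ q → 𝒜.Nonempty →
            RigidityOnCubes 𝒜 p q →
            ∀ u : W11 U,
              (∀ F G : Vec d → ℝ,
                IsDecomp₂ (volume.restrict U) p q (distTo (sobGrad u) 𝒜) F G →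
                -- (c)
                (∃ F' G' H' : Vec d → Vec d,
                  IsDecomp₃ volume p q r (locFn (E u)) F' G' H' ∧
                  eLpNorm F' p volume ≤ c p q r 𝒜 * eLpNorm F p (volume.restrict U) ∧
                  eLpNorm G' q volume ≤ c p q r 𝒜 * eLpNorm G q (volume.restrict U) ∧
                  eLpNorm H' r volume ≤ c p q r 𝒜 * eLpNorm (sobFn u) r (volume.restrict U)) ∧
                -- (d), on the neighbourhood that carries `E u`, and on `ℝ^d` if `dist(0, 𝒜) = 0`
                (∀ V : Set (Vec d),
                  (V = outerNhd U (jonesRadius U δ * α) ∨ (V = univ ∧ 0 ∈ closure 𝒜)) →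
                  ∃ F' G' H' : Vec d → ℝ,
                    IsDecomp₃ (volume.restrict V) p q r (distTo (locGrad (E u)) 𝒜) F' G' H' ∧
                    (∀ᵐ x ∂(volume.restrict (outerNhd U (jonesRadius U δ * α'))), H' x = 0) ∧
                    eLpNorm F' p (volume.restrict V) ≤
                      c p q r 𝒜 * eLpNorm F p (volume.restrict U) ∧
                    eLpNorm G' q (volume.restrict V) ≤
                      c p q r 𝒜 * eLpNorm G q (volume.restrict U) ∧
                    eLpNorm H' r (volume.restrict V) ≤
                      c p q r 𝒜 * (ENNReal.ofReal (jonesRadius U δ)⁻¹ *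
                          eLpNorm (sobFn u) r
                            (volume.restrict (innerPart U (jonesRadius U δ * α''))) +
                        eLpNorm (sobGrad u) r
                          (volume.restrict (innerPart U (jonesRadius U δ * α'')))))) ∧
              -- the special cases `p = q = r` of (c) and (d)
              (p = q → q = r →
                eLpNorm (locFn (E u)) p volume ≤
                  c p q r 𝒜 * (eLpNorm (sobFn u) p (volume.restrict U) +
                    eLpNorm (distTo (sobGrad u) 𝒜) p (volume.restrict U)) ∧
                eLpNorm (distTo (locGrad (E u)) 𝒜) p
                    (volume.restrict (outerNhd U (jonesRadius U δ * α'))) ≤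
                  c p q r 𝒜 * eLpNorm (distTo (sobGrad u) 𝒜) p (volume.restrict U)) := by
  -- The constant must be fixed before the domain. It is chosen for all `p`, `q`, `𝒜` at once, with
  -- the default `0` where rigidity fails.
  have hrig : ∀ (p q : ℝ≥0∞) (𝒜 : Set (Mat d)), ∃ C : ℝ, 0 ≤ C ∧ (1 ≤ p → 1 ≤ q → RigidityOnCubes 𝒜 p q →
      ∀ (U : Set (Vec d)) (u : Vec d → Vec d) (g : Vec d → Mat d),
        IsWeakGradient U u g → IntegrableOn u U → IntegrableOn g U → ∀ F G : Vec d → ℝ,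
          IsDecomp₂ (volume.restrict U) p q (distTo g 𝒜) F G → OscControl U g 𝒜 p q F G C) := by
    intro p q 𝒜
    by_cases h : 1 ≤ p ∧ 1 ≤ q ∧ RigidityOnCubes 𝒜 p q
    · obtain ⟨C, hC, hO⟩ := h.2.2.exists_oscControl h.1 h.2.1
      exact ⟨C, hC, fun _ _ _ => hO⟩
    · exact ⟨0, le_rfl, fun h1 h2 h3 => (h ⟨h1, h2, h3⟩).elim⟩
  choose C hC hO using hrig
  -- With coarsest scale `ρ / 32`, the pure gradient estimate holds up to distance `2 * ρ / 32` and
  -- the extension vanishes beyond `4 * ρ / 32`. The third number is the depth in `U` reached by the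
  -- averages at distance `ρ / 32`.
  refine ⟨1 / 16, 1 / 8, e ^ 3 / 131072 / 32, fun p q _ 𝒜 => (extensionC d e (C p q 𝒜)).toNNReal,
    by norm_num, by norm_num, by positivity, fun p q _ 𝒜 => ?_, ?_⟩
  · have := (le_extensionC (d := d) he (hC p q 𝒜)).1
    exact Real.toNNReal_pos.2 (by linarith)
  intro δ U hUo hUb hne hJ hcomp
  have hU : IsExtensionDomain U e δ := ⟨hUo, hUb, hne, hJ, hcomp, jonesRadius_pos hd hUo hUb hne hJ.δ_pos⟩
  refine ⟨hU.extOp, hU.exists_bound_extOp, hU.extOp_eq_of_mem, hU.extOp_eq_zero, ?_⟩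
  intro r p q 𝒜 hr hp hpq _ hR w
  have hq : 1 ≤ q := hp.trans hpq
  obtain ⟨h1, h2, h3⟩ := sobGrad_spec w
  have hO' := hO p q 𝒜 hp hq hR U (sobFn w) (sobGrad w) h1 h2 h3
  refine ⟨fun F G hdec => ⟨hU.exists_extOp_decomp (hC p q 𝒜) hp hq hr w hdec (hO' F G hdec), fun V hV => ?_⟩, ?_⟩
  · obtain ⟨F', G', H', hd', hH, nF, nG, nH⟩ :=
      hU.exists_extOp_grad_decomp (hC p q 𝒜) hp hq hr w hdec (hO' F G hdec) hV
    exact ⟨F', G', H', hd', (ae_restrict_mem (measurableSet_infDist_le _)).mono hH, nF, nG, nH⟩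
  · rintro rfl rfl
    exact hU.extOp_special (hC p p 𝒜) hp w hO'
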